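/- Work over $\mathbb{C}$ and let $0<k_1<k_2<n$ be integers. Let $\mathrm{Gr}(k,m)$ denote the Grassmannian of $k$-dimensional subspaces of $\mathbb{C}^m$, with tautological subbundle $\mathcal{U}$ (of rank $k$), tautological quotient bundle $\mathcal{Q}=\mathcal{O}^{\oplus m}/\mathcal{U}$ and $\mathcal{O}(-1)=\det\mathcal{U}$. For a vector bundle $E$ on $X$ let $\mathrm{Gr}_X(k,E)$ denote the Grassmann bundle of rank $k$ subbundles of $E$. Let $\mathrm{Fl}(k_1,k_2,n)$ be the two-step flag variety of subspaces $V_1\subset V_2\subset\mathbb{C}^n$ with $\dim V_i=k_i$, and let $\mathcal{U}_1$ and $\mathcal{Q}_2$ be the pullbacks to $\mathrm{Fl}(k_1,k_2,n)$ of the tautological subbundle of $\mathrm{Gr}(k_1,n)$ and of the tautological quotient bundle of $\mathrm{Gr}(k_2,n)$. For a vector bundle $\mathcal{F}$ on $\mathrm{Fl}(k_1,k_2,n)$, let $\mathscr{Z}(\mathcal{F})$ denote the (scheme-theoretic) zero locus of a general global section of $\mathcal{F}$, that is, of any section in a suitable nonempty Zariski open subset of the finite-dimensional vector space $H^0(\mathrm{Fl}(k_1,k_2,n),\mathcal{F})$.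 Then there are isomorphisms of schemes over $\mathbb{C}$ $$\mathscr{Z}(\mathcal{Q}_2)\;\cong\;\mathrm{Gr}_{\mathrm{Gr}(k_2-1,\,n-1)}\bigl(k_1,\ \overline{\mathcal{U}}\oplus\mathcal{O}\bigr),$$ $$\mathscr{Z}(\mathcal{U}_1^{\vee})\;\cong\;\mathrm{Gr}_{\mathrm{Gr}(k_1,\,n-1)}\bigl(k_2-k_1,\ \overline{\mathcal{Q}}(-1)\oplus\mathcal{O}(-1)\bigr),$$ where $\overline{\mathcal{U}}$ is the tautological subbundle on $\mathrm{Gr}(k_2-1,n-1)$ and $\overline{\mathcal{Q}}$ is the tautological quotient bundle on $\mathrm{Gr}(k_1,n-1)$. -/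

import Mathlib

open CategoryTheory

noncomputable section

/-! ### Semilinear base change -/

section BaseChange

variable {A B : Type} [CommRing A] [CommRing B]

/-- The `φ`-semilinear map `g : M → N` exhibits the `B`-module `N` as the extension of scalars
`B ⊗[A] M` of the `A`-module `M` along `φ : A →+* B`. -/
def IsExtension (φ : A →+* B) {M N : Type} [AddCommGroup M] [Module A M] [AddCommGroup N]
    [Module B N] (g : M →ₛₗ[φ] N) : Prop :=
  letI : Algebra A B := φ.toAlgebra
  letI : Module A N := Module.compHom N φ
  haveI : IsScalarTower A B N := ⟨fun a b n => mul_smul (φ a) b n⟩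
  IsBaseChange B
    ({ toFun := g, map_add' := map_add g, map_smul' := fun a m => g.map_smulₛₗ a m } : M →ₗ[A] N)

variable {φ : A →+* B} {M N : Type} [AddCommGroup M] [Module A M] [AddCommGroup N] [Module B N]
  {g : M →ₛₗ[φ] N}

theorem IsExtension.exists_lift (h : IsExtension φ g) {Q : Type} [AddCommGroup Q] [Module B Q]
    (k : M →ₛₗ[φ] Q) : ∃ k' : N →ₗ[B] Q, ∀ m, k' (g m) = k m := by
  let _ : Algebra A B := φ.toAlgebra
  let _ : Module A N := Module.compHom N φ
  have _ : IsScalarTower A B N := ⟨fun a b n => mul_smul (φ a) b n⟩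
  let _ : Module A Q := Module.compHom Q φ
  have _ : IsScalarTower A B Q := ⟨fun a b n => mul_smul (φ a) b n⟩
  exact ⟨IsBaseChange.lift h
    ({ toFun := k, map_add' := map_add k, map_smul' := fun a m => k.map_smulₛₗ a m } : M →ₗ[A] Q),
    fun m => IsBaseChange.lift_eq h _ m⟩

theorem IsExtension.span_eq_top (h : IsExtension φ g) : Submodule.span B (Set.range g) = ⊤ := by
  let _ : Algebra A B := φ.toAlgebra
  let _ : Module A N := Module.compHom N φ
  have _ : IsScalarTower A B N := ⟨fun a b n => mul_smul (φ a) b n⟩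
  rw [eq_top_iff]
  rintro x -
  induction x using IsBaseChange.inductionOn h with
  | zero => exact zero_mem _
  | tmul m => exact Submodule.subset_span ⟨m, rfl⟩
  | smul s n hn => exact Submodule.smul_mem _ s hn
  | add a b ha hb => exact add_mem ha hb

theorem IsExtension.hom_ext (h : IsExtension φ g) {Q : Type} [AddCommGroup Q] [Module B Q]
    {k₁ k₂ : N →ₗ[B] Q} (e : ∀ m, k₁ (g m) = k₂ (g m)) : k₁ = k₂ := by
  refine LinearMap.ext_on h.span_eq_top ?_
  rintro _ ⟨m, rfl⟩
  exact e m

theorem IsExtension.of_lift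
    (hs : Submodule.span B (Set.range g) = ⊤)
    (h : ∀ (Q : Type) [AddCommGroup Q] [Module B Q] (k : M →ₛₗ[φ] Q),
      ∃ k' : N →ₗ[B] Q, ∀ m, k' (g m) = k m) : IsExtension φ g := by
  let _ : Algebra A B := φ.toAlgebra
  let _ : Module A N := Module.compHom N φ
  have _ : IsScalarTower A B N := ⟨fun a b n => mul_smul (φ a) b n⟩
  refine IsBaseChange.of_lift_unique _ ?_
  intro Q _ _ _ _ k
  let _ : AddCommGroup Q := Module.addCommMonoidToAddCommGroup B
  obtain ⟨k', hk'⟩ := h Q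
    { toFun := k
      map_add' := map_add k
      map_smul' := fun a m => by
        change k (a • m) = φ a • k m
        rw [k.map_smul, ← algebraMap_smul B a (k m)]
        rfl }
  refine ⟨k', LinearMap.ext hk', ?_⟩
  intro k'' hk''
  refine LinearMap.ext_on hs ?_
  rintro _ ⟨m, rfl⟩
  exact (LinearMap.congr_fun hk'' m).trans (hk' m).symm

/-- A finite family generating `M` and `N`, with compatible coordinate functions. -/
theorem IsExtension.of_frame {ι : Type} [Fintype ι] (m : ι → M) (c : ι → M → A)
    (c' : ι → N →ₗ[B] B) (h : ∀ x, ∑ i, c i x • m i = x) (h' : ∀ y, ∑ i, c' i y • g (m i) = y)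
    (hc : ∀ i x, c' i (g x) = φ (c i x)) : IsExtension φ g := by
  refine IsExtension.of_lift ?_ ?_
  · rw [eq_top_iff]
    rintro y -
    rw [← h' y]
    exact Submodule.sum_mem _ fun i _ => Submodule.smul_mem _ _ (Submodule.subset_span ⟨_, rfl⟩)
  · intro Q _ _ k
    refine ⟨∑ i, (c' i).smulRight (k (m i)), fun x => ?_⟩
    conv_rhs => rw [← h x]
    simp [hc]

theorem IsExtension.exists_frame (hg : IsExtension φ g) [Module.Finite A M]
    [Module.Projective A M] :
    ∃ (r : ℕ) (m : Fin r → M) (c : Fin r → M →ₗ[A] A) (c' : Fin r → N →ₗ[B] B),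
      (∀ x, ∑ i, c i x • m i = x) ∧ (∀ y, ∑ i, c' i y • g (m i) = y) ∧
      ∀ i x, c' i (g x) = φ (c i x) := by
  obtain ⟨r, f, s, -, -, hfs⟩ := Module.Finite.exists_comp_eq_id_of_projective A M
  have hx : ∀ x, ∑ i, s x i • f (Pi.single i 1) = x := by
    intro x
    have : f (s x) = x := LinearMap.congr_fun hfs x
    conv_rhs => rw [← this, pi_eq_sum_univ' (s x)]
    simp only [map_sum, map_smul]
  let c : Fin r → M →ₗ[A] A := fun i => LinearMap.proj i ∘ₗ s
  choose c' hc' using fun i => hg.exists_lift (Q := B)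
    ({ toFun := fun x => φ (c i x)
       map_add' := fun x y => by simp
       map_smul' := fun a x => by simp } : M →ₛₗ[φ] B)
  refine ⟨r, fun i => f (Pi.single i 1), c, c', hx, ?_, fun i x => hc' i x⟩
  have key : (∑ i, (c' i).smulRight (g (f (Pi.single i 1)))) = LinearMap.id := by
    refine hg.hom_ext fun x => ?_
    have := congrArg g (hx x)
    simp only [map_sum, LinearMap.map_smulₛₗ] at this
    simpa [hc', c] using this
  intro y
  simpa using LinearMap.congr_fun key y

theorem IsExtension.finite (hg : IsExtension φ g) [Module.Finite A M] [Module.Projective A M] :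
    Module.Finite B N := by
  obtain ⟨r, m, c, c', -, h', -⟩ := hg.exists_frame
  refine Module.Finite.of_surjective (Fintype.linearCombination B fun i => g (m i)) fun y => ?_
  exact ⟨fun i => c' i y, by simpa [Fintype.linearCombination_apply] using h' y⟩

theorem IsExtension.projective (hg : IsExtension φ g) [Module.Finite A M]
    [Module.Projective A M] : Module.Projective B N := by
  obtain ⟨r, m, c, c', -, h', -⟩ := hg.exists_frame
  refine Module.Projective.of_split (LinearMap.pi c')
    (Fintype.linearCombination B fun i => g (m i)) ?_
  ext y
  simpa [Fintype.linearCombination_apply] using h' y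

theorem IsExtension.rankAtStalk_eq (hg : IsExtension φ g) [Module.Finite A M]
    [Module.Projective A M] (p : PrimeSpectrum B) :
    Module.rankAtStalk (R := B) N p = Module.rankAtStalk (R := A) M (p.comap φ) := by
  let _ : Algebra A B := φ.toAlgebra
  let _ : Module A N := Module.compHom N φ
  have _ : IsScalarTower A B N := ⟨fun a b n => mul_smul (φ a) b n⟩
  exact Module.rankAtStalk_isBaseChange hg p

/-- The submodule of `N` generated by the image of a submodule of `M`. -/
def extendSub (g : M →ₛₗ[φ] N) (L : Submodule A M) : Submodule B N := Submodule.span B (g '' L)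

theorem mem_extendSub (g : M →ₛₗ[φ] N) {L : Submodule A M} {x : M} (hx : x ∈ L) :
    g x ∈ extendSub g L := Submodule.subset_span ⟨x, hx, rfl⟩

/-- The map induced by a semilinear map on submodules. -/
def restrictSub (g : M →ₛₗ[φ] N) {L : Submodule A M} {L' : Submodule B N}
    (h : ∀ x ∈ L, g x ∈ L') : L →ₛₗ[φ] L' where
  toFun x := ⟨g x, h x x.2⟩
  map_add' x y := Subtype.ext (by simp)
  map_smul' a x := Subtype.ext (by simp)

theorem exists_retraction (L : Submodule A M) [Module.Projective A (M ⧸ L)] :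
    ∃ p : M →ₗ[A] L, ∀ x : L, p x = x := by
  obtain ⟨s, hs⟩ := Module.projective_lifting_property L.mkQ LinearMap.id L.mkQ_surjective
  have hs' : ∀ x, L.mkQ (s x) = x := LinearMap.congr_fun hs
  have hm : ∀ x, ((LinearMap.id : M →ₗ[A] M) - s ∘ₗ L.mkQ) x ∈ L := by
    intro x
    rw [← Submodule.Quotient.mk_eq_zero, ← Submodule.mkQ_apply]
    simp only [LinearMap.sub_apply, LinearMap.id_apply, LinearMap.comp_apply, map_sub, hs',
      sub_self]
  refine ⟨((LinearMap.id : M →ₗ[A] M) - s ∘ₗ L.mkQ).codRestrict L hm, fun x => Subtype.ext ?_⟩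
  · have : L.mkQ (x : M) = 0 := by simp
    simp only [LinearMap.codRestrict_apply, LinearMap.sub_apply, LinearMap.id_apply,
      LinearMap.comp_apply, this, map_zero, sub_zero]

theorem IsExtension.restrictSub_extendSub (hg : IsExtension φ g) [Module.Finite A M]
    [Module.Projective A M] (L : Submodule A M) [Module.Projective A (M ⧸ L)] :
    IsExtension φ (restrictSub g (L := L) (L' := extendSub g L)
      fun _ hx => mem_extendSub g hx) := by
  obtain ⟨r, m, c, c', h, h', hc⟩ := hg.exists_frame
  obtain ⟨p, hp⟩ := exists_retraction L
  have hsum : ∀ x : L, ∑ i, c i x • p (m i) = x := by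
    intro x
    have := congrArg p (h x)
    simpa [hp] using this
  refine IsExtension.of_frame (fun i => p (m i)) (fun i x => c i x)
    (fun i => (c' i) ∘ₗ (extendSub g L).subtype) hsum ?_ (fun i x => hc i x)
  intro y
  have key : ∀ y ∈ extendSub g L, ∑ i, c' i y • g (p (m i)) = y := by
    intro y hy
    induction hy using Submodule.span_induction with
    | mem _ hx =>
      obtain ⟨x, hx, rfl⟩ := hx
      have := congrArg g (congrArg Subtype.val (hsum ⟨x, hx⟩))
      simp only [AddSubmonoidClass.coe_finsetSum, Submodule.coe_smul, map_sum,
        LinearMap.map_smulₛₗ] at this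
      simpa [hc] using this
    | zero => simp
    | add a b _ _ ha hb =>
      simp only [map_add, add_smul, Finset.sum_add_distrib, ha, hb]
    | smul s a _ ha =>
      simp only [map_smul, smul_eq_mul, mul_smul, ← Finset.smul_sum, ha]
  refine Subtype.ext ?_
  have := key y y.2
  simpa [restrictSub] using this

/-- The map induced by a semilinear map on quotients. -/
def mapQuot (g : M →ₛₗ[φ] N) {L : Submodule A M} {L' : Submodule B N}
    (h : ∀ x ∈ L, g x ∈ L') : (M ⧸ L) →ₛₗ[φ] (N ⧸ L') :=
  L.mapQ L' g h

@[simp] theorem mapQuot_mk (g : M →ₛₗ[φ] N) {L : Submodule A M} {L' : Submodule B N}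
    (h : ∀ x ∈ L, g x ∈ L') (x : M) :
    mapQuot g h (Submodule.Quotient.mk x) = Submodule.Quotient.mk (g x) := rfl

theorem IsExtension.mapQuot_extendSub (hg : IsExtension φ g) (L : Submodule A M) :
    IsExtension φ (mapQuot g (L := L) (L' := extendSub g L) fun _ hx => mem_extendSub g hx) := by
  refine IsExtension.of_lift ?_ ?_
  · rw [eq_top_iff]
    rintro y -
    obtain ⟨y, rfl⟩ := Submodule.Quotient.mk_surjective _ y
    have hy : y ∈ Submodule.span B (Set.range g) := by rw [hg.span_eq_top]; trivial
    induction hy using Submodule.span_induction with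
    | mem _ hx =>
      obtain ⟨x, rfl⟩ := hx
      exact Submodule.subset_span ⟨Submodule.Quotient.mk x, rfl⟩
    | zero => exact zero_mem _
    | add a b _ _ ha hb => exact add_mem ha hb
    | smul s a _ ha => exact Submodule.smul_mem _ s ha
  · intro Q _ _ k
    obtain ⟨k', hk'⟩ := hg.exists_lift (k.comp L.mkQ)
    refine ⟨(extendSub g L).liftQ k' ?_, ?_⟩
    · refine Submodule.span_le.2 ?_
      rintro _ ⟨x, hx, rfl⟩
      have : (Submodule.Quotient.mk x : M ⧸ L) = 0 := (Submodule.Quotient.mk_eq_zero L).2 hx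
      simp [hk', this]
    · intro y
      obtain ⟨y, rfl⟩ := Submodule.Quotient.mk_surjective _ y
      exact hk' y

/-- The extension of scalars of linear forms. -/
def dualExt (hg : IsExtension φ g) : Module.Dual A M →ₛₗ[φ] Module.Dual B N :=
  have ex : ∀ l : Module.Dual A M, ∃ l' : Module.Dual B N, ∀ m, l' (g m) = φ (l m) := fun l =>
    hg.exists_lift (Q := B)
      ({ toFun := fun x => φ (l x)
         map_add' := fun x y => by simp
         map_smul' := fun a x => by simp } : M →ₛₗ[φ] B)
  { toFun := fun l => (ex l).choose
    map_add' := fun l₁ l₂ => hg.hom_ext fun m => by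
      rw [(ex (l₁ + l₂)).choose_spec, LinearMap.add_apply, LinearMap.add_apply,
        (ex l₁).choose_spec, (ex l₂).choose_spec, map_add]
    map_smul' := fun a l => hg.hom_ext fun m => by
      rw [(ex (a • l)).choose_spec, LinearMap.smul_apply, LinearMap.smul_apply,
        (ex l).choose_spec, smul_eq_mul, smul_eq_mul, map_mul] }

/-- The extended form is the unique linear form with this property. -/
theorem dualExt_apply (hg : IsExtension φ g) (l : Module.Dual A M) (m : M) :
    dualExt hg l (g m) = φ (l m) :=
  (hg.exists_lift (Q := B)
      ({ toFun := fun x => φ (l x)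
         map_add' := fun x y => by simp
         map_smul' := fun a x => by simp } : M →ₛₗ[φ] B)).choose_spec m

theorem IsExtension.dual (hg : IsExtension φ g) [Module.Finite A M] [Module.Projective A M] :
    IsExtension φ (dualExt hg) := by
  obtain ⟨r, m, c, c', h, h', hc⟩ := hg.exists_frame
  have hcc : ∀ i, dualExt hg (c i) = c' i := fun i => hg.hom_ext fun x => by
    rw [dualExt_apply, hc]
  refine IsExtension.of_frame c (fun i l => l (m i))
    (fun i => Module.Dual.eval B N (g (m i))) ?_ ?_ ?_
  · intro l
    ext x
    conv_rhs => rw [← h x]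
    simp [mul_comm]
  · intro l
    ext y
    conv_rhs => rw [← h' y]
    simp [hcc, mul_comm]
  · intro i l
    simp [dualExt_apply]

/-- The map induced by a semilinear map on exterior powers,
`v₁ ∧ ⋯ ∧ v_k ↦ g v₁ ∧ ⋯ ∧ g v_k`. -/
def exteriorExt (k : ℕ) (g : M →ₛₗ[φ] N) : (⋀[A]^k M) →ₛₗ[φ] (⋀[B]^k N) :=
  letI : Module A (⋀[B]^k N) := Module.compHom _ φ
  let a : M [⋀^Fin k]→ₗ[A] (⋀[B]^k N) :=
    { toFun := fun v => exteriorPower.ιMulti B k (g ∘ v)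
      map_update_add' := by
        intro _ v i x y
        simp only [Function.comp_update, map_add, AlternatingMap.map_update_add]
      map_update_smul' := by
        intro _ v i c x
        simp only [Function.comp_update, LinearMap.map_smulₛₗ, AlternatingMap.map_update_smul]
        rfl
      map_eq_zero_of_eq' := by
        intro v i j hv hij
        exact (exteriorPower.ιMulti B k).map_eq_zero_of_eq _ (by simp [hv]) hij }
  let l := exteriorPower.alternatingMapLinearEquiv a
  { toFun := l
    map_add' := map_add l
    map_smul' := fun c x => l.map_smul c x }

@[simp] theorem exteriorExt_ιMulti (k : ℕ) (g : M →ₛₗ[φ] N) (v : Fin k → M) :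
    exteriorExt k g (exteriorPower.ιMulti A k v) = exteriorPower.ιMulti B k (g ∘ v) := by
  let _ : Module A (⋀[B]^k N) := Module.compHom _ φ
  exact exteriorPower.alternatingMapLinearEquiv_apply_ιMulti _ v

theorem exterior_induction (k : ℕ) {P : (⋀[A]^k M) → Prop} (h0 : P 0)
    (hadd : ∀ x y, P x → P y → P (x + y)) (hsmul : ∀ (a : A) x, P x → P (a • x))
    (hι : ∀ v, P (exteriorPower.ιMulti A k v)) (x : ⋀[A]^k M) : P x := by
  have hx : x ∈ Submodule.span A (Set.range (exteriorPower.ιMulti A k (M := M))) := by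
    rw [exteriorPower.ιMulti_span]; trivial
  induction hx using Submodule.span_induction with
  | mem _ h => obtain ⟨v, rfl⟩ := h; exact hι v
  | zero => exact h0
  | add a b _ _ ha hb => exact hadd a b ha hb
  | smul s a _ ha => exact hsmul s a ha

theorem IsExtension.exterior (k : ℕ) (hg : IsExtension φ g) [Module.Finite A M]
    [Module.Projective A M] : IsExtension φ (exteriorExt k g) := by
  obtain ⟨r, m, c, c', h, h', hc⟩ := hg.exists_frame
  let b := Pi.basisFun A (Fin r)
  let b' := Pi.basisFun B (Fin r)
  let s : M →ₗ[A] (Fin r → A) := LinearMap.pi c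
  let s' : N →ₗ[B] (Fin r → B) := LinearMap.pi c'
  let t : (Fin r → A) →ₗ[A] M := Fintype.linearCombination A m
  let t' : (Fin r → B) →ₗ[B] N := Fintype.linearCombination B fun i => g (m i)
  have hts : t ∘ₗ s = LinearMap.id := LinearMap.ext fun x => by
    simpa [t, s, Fintype.linearCombination_apply] using h x
  have hts' : t' ∘ₗ s' = LinearMap.id := LinearMap.ext fun x => by
    simpa [t', s', Fintype.linearCombination_apply] using h' x
  have tb : ∀ i, t (b i) = m i := fun i => by simp [t, b, Fintype.linearCombination_apply_single]
  have tb' : ∀ i, t' (b' i) = g (m i) := fun i => by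
    simp [t', b', Fintype.linearCombination_apply_single]
  refine IsExtension.of_frame
    (fun I => exteriorPower.map k t (b.exteriorPower k I))
    (fun I x => exteriorPower.ιMultiDual A k b I (exteriorPower.map k s x))
    (fun I => exteriorPower.ιMultiDual B k b' I ∘ₗ exteriorPower.map k s') ?_ ?_ ?_
  · intro x
    have e := congrArg (exteriorPower.map k t) ((b.exteriorPower k).sum_repr
      (exteriorPower.map k s x))
    rw [← LinearMap.comp_apply (exteriorPower.map k t), ← exteriorPower.map_comp, hts,
      exteriorPower.map_id] at e
    simpa [exteriorPower.basis_repr_apply] using e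
  · intro y
    have e := congrArg (exteriorPower.map k t') ((b'.exteriorPower k).sum_repr
      (exteriorPower.map k s' y))
    rw [← LinearMap.comp_apply (exteriorPower.map k t'), ← exteriorPower.map_comp, hts',
      exteriorPower.map_id] at e
    have key : ∀ I, exteriorExt k g (exteriorPower.map k t (b.exteriorPower k I)) =
        exteriorPower.map k t' (b'.exteriorPower k I) := by
      intro I
      simp only [exteriorPower.basis_apply, exteriorPower.ιMulti_family,
        exteriorPower.map_apply_ιMulti, exteriorExt_ιMulti]
      congr 1
      ext i
      simp [tb, tb']
    simp only [key]
    simpa [exteriorPower.basis_repr_apply] using e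
  · intro I x
    induction x using exterior_induction with
    | h0 => simp
    | hadd x y hx hy => simp only [map_add, hx, hy]
    | hsmul a x hx =>
      simp only [LinearMap.map_smulₛₗ, map_smul, hx, smul_eq_mul, map_mul]
    | hι v =>
      simp only [exteriorExt_ιMulti, LinearMap.comp_apply, exteriorPower.map_apply_ιMulti,
        exteriorPower.ιMultiDual_apply_ιMulti, RingHom.map_det]
      congr 1
      ext i j
      simp [b, b', s, s', hc]

instance exterior_projective (k : ℕ) [Module.Finite A M] [Module.Projective A M] :
    Module.Projective A (⋀[A]^k M) := by
  obtain ⟨r, f, s, -, -, hfs⟩ := Module.Finite.exists_comp_eq_id_of_projective A M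
  refine Module.Projective.of_split (exteriorPower.map k s) (exteriorPower.map k f) ?_
  rw [← exteriorPower.map_comp, hfs, exteriorPower.map_id]

variable {M' N' : Type} [AddCommGroup M'] [Module A M'] [AddCommGroup N'] [Module B N']
  {g' : M' →ₛₗ[φ] N'}

/-- The map `(x, x') ↦ (g x, g' x')` on direct sums. -/
def prodExt (g : M →ₛₗ[φ] N) (g' : M' →ₛₗ[φ] N') : (M × M') →ₛₗ[φ] (N × N') where
  toFun x := (g x.1, g' x.2)
  map_add' x y := by simp
  map_smul' a x := by simp

theorem IsExtension.prod (hg : IsExtension φ g) (hg' : IsExtension φ g') :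
    IsExtension φ (prodExt g g') := by
  refine IsExtension.of_lift ?_ ?_
  · rw [eq_top_iff]
    rintro ⟨y, y'⟩ -
    have h₁ : Submodule.span B (Set.range g) ≤
        (Submodule.span B (Set.range (prodExt g g'))).comap (LinearMap.inl B N N') := by
      refine Submodule.span_le.2 ?_
      rintro _ ⟨x, rfl⟩
      exact Submodule.subset_span ⟨(x, 0), by simp [prodExt]⟩
    have h₂ : Submodule.span B (Set.range g') ≤
        (Submodule.span B (Set.range (prodExt g g'))).comap (LinearMap.inr B N N') := by
      refine Submodule.span_le.2 ?_
      rintro _ ⟨x, rfl⟩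
      exact Submodule.subset_span ⟨(0, x), by simp [prodExt]⟩
    rw [hg.span_eq_top] at h₁
    rw [hg'.span_eq_top] at h₂
    have h₃ : (y, (0 : N')) ∈ Submodule.span B (Set.range (prodExt g g')) :=
      h₁ (show y ∈ (⊤ : Submodule B N) from trivial)
    have h₄ : ((0 : N), y') ∈ Submodule.span B (Set.range (prodExt g g')) :=
      h₂ (show y' ∈ (⊤ : Submodule B N') from trivial)
    simpa using add_mem h₃ h₄
  · intro Q _ _ k
    obtain ⟨k₁, h₁⟩ := hg.exists_lift (k.comp (LinearMap.inl A M M'))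
    obtain ⟨k₂, h₂⟩ := hg'.exists_lift (k.comp (LinearMap.inr A M M'))
    refine ⟨k₁.coprod k₂, fun x => ?_⟩
    simp [prodExt, h₁, h₂, ← map_add]

/-- The map `x ⊗ x' ↦ g x ⊗ g' x'` on tensor products. -/
def tensorExt (g : M →ₛₗ[φ] N) (g' : M' →ₛₗ[φ] N') :
    (TensorProduct A M M') →ₛₗ[φ] (TensorProduct B N N') :=
  TensorProduct.map g g'

open TensorProduct in
theorem IsExtension.tensor (hg : IsExtension φ g) (hg' : IsExtension φ g') [Module.Finite A M]
    [Module.Projective A M] [Module.Finite A M'] [Module.Projective A M'] :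
    IsExtension φ (tensorExt g g') := by
  obtain ⟨r, m, c, d, h, h', hc⟩ := hg.exists_frame
  obtain ⟨r', m', c', d', k, k', hc'⟩ := hg'.exists_frame
  refine IsExtension.of_frame (ι := Fin r × Fin r') (fun i => m i.1 ⊗ₜ m' i.2)
    (fun i => LinearMap.mul' A A ∘ₗ TensorProduct.map (c i.1) (c' i.2))
    (fun i => LinearMap.mul' B B ∘ₗ TensorProduct.map (d i.1) (d' i.2)) ?_ ?_ ?_
  · intro x
    induction x with
    | zero => simp
    | add x y hx hy => simp only [map_add, add_smul, Finset.sum_add_distrib, hx, hy]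
    | tmul x y =>
      conv_rhs => rw [← h x, ← k y]
      rw [TensorProduct.sum_tmul]
      simp only [TensorProduct.tmul_sum, TensorProduct.smul_tmul_smul, Fintype.sum_prod_type]
      simp
  · intro x
    induction x with
    | zero => simp
    | add x y hx hy => simp only [map_add, add_smul, Finset.sum_add_distrib, hx, hy]
    | tmul x y =>
      conv_rhs => rw [← h' x, ← k' y]
      rw [TensorProduct.sum_tmul]
      simp only [TensorProduct.tmul_sum, TensorProduct.smul_tmul_smul, Fintype.sum_prod_type]
      simp [tensorExt]
  · intro i x
    induction x with
    | zero => simp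
    | add x y hx hy => simp only [map_add, hx, hy]
    | tmul x y => simp [tensorExt, hc, hc']

end BaseChange

/-! ### Complex spaces and vector bundles via functors of points

A scheme over `ℂ` is determined, up to unique isomorphism, by its functor of points on commutative
`ℂ`-algebras, and isomorphisms of `ℂ`-schemes are the same as natural isomorphisms between these
functors. All varieties below are given by their functors of points. -/

/-- Functors of points of spaces over `ℂ`. -/
abbrev CSpace := CommAlgCat.{0} ℂ ⥤ Type

/-- A vector bundle on `X`: a finitely generated projective `A`-module for each `A`-point of `X`,
compatible with extension of scalars. (For a scheme `X` this is the same as a locally free sheaf of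
finite rank, its module at `x : Spec A ⟶ X` being the global sections of the pullback along `x`.) -/
structure VectBundle (X : CSpace) where
  fib : ∀ {A : CommAlgCat.{0} ℂ}, X.obj A → Type
  [addCommGroup : ∀ {A : CommAlgCat.{0} ℂ} (x : X.obj A), AddCommGroup (fib x)]
  [module : ∀ {A : CommAlgCat.{0} ℂ} (x : X.obj A), Module A (fib x)]
  finite : ∀ {A : CommAlgCat.{0} ℂ} (x : X.obj A), Module.Finite A (fib x)
  projective : ∀ {A : CommAlgCat.{0} ℂ} (x : X.obj A), Module.Projective A (fib x)
  tr : ∀ {A B : CommAlgCat.{0} ℂ} (f : A ⟶ B) {x : X.obj A} {y : X.obj B}, X.map f x = y →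
    (fib x →ₛₗ[f.hom.toRingHom] fib y)
  tr_id : ∀ {A : CommAlgCat.{0} ℂ} {x : X.obj A} (h : X.map (𝟙 A) x = x) (v : fib x),
    tr (𝟙 A) h v = v
  tr_comp : ∀ {A B C : CommAlgCat.{0} ℂ} (f : A ⟶ B) (g : B ⟶ C) {x : X.obj A} {y : X.obj B}
    {z : X.obj C} (hf : X.map f x = y) (hg : X.map g y = z) (hfg : X.map (f ≫ g) x = z)
    (v : fib x), tr (f ≫ g) hfg v = tr g hg (tr f hf v)
  isExtension : ∀ {A B : CommAlgCat.{0} ℂ} (f : A ⟶ B) {x : X.obj A} {y : X.obj B}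
    (h : X.map f x = y), IsExtension f.hom.toRingHom (tr f h)

namespace VectBundle

attribute [instance] addCommGroup module finite projective

variable {X Y : CSpace}

/-- The trivial bundle of rank `n`. -/
def trivial (X : CSpace) (n : ℕ) : VectBundle X where
  fib {A} _ := Fin n → A
  finite _ := inferInstance
  projective _ := inferInstance
  tr {_ _} f {_ _} _ :=
    { toFun := fun v i => f.hom (v i)
      map_add' := fun v w => by ext i; simp
      map_smul' := fun a v => by ext i; simp }
  tr_id _ v := rfl
  tr_comp {_ _ _} f g {_ _ _} _ _ _ v := rfl
  isExtension {A B} f x y h := by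
    refine IsExtension.of_frame (fun i => Pi.single i 1) (fun i v => v i)
      (fun i => LinearMap.proj i) (fun v => ?_) (fun v => ?_) (fun i v => rfl)
    · ext j
      simp [Finset.sum_apply, Pi.single_apply]
    · ext j
      change (∑ i, v i • fun k => f.hom ((Pi.single i 1 : Fin n → A) k)) j = v j
      simp [Finset.sum_apply, Pi.single_apply, apply_ite]

/-- The structure sheaf `𝒪`. -/
def structureSheaf (X : CSpace) : VectBundle X where
  fib {A} _ := A
  finite _ := inferInstance
  projective _ := inferInstance
  tr {_ _} f {_ _} _ :=
    { toFun := f.hom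
      map_add' := fun v w => by simp
      map_smul' := fun a v => by simp }
  tr_id _ v := rfl
  tr_comp {_ _ _} f g {_ _ _} _ _ _ v := rfl
  isExtension {A B} f x y h := by
    refine IsExtension.of_frame (ι := Fin 1) (fun i => 1) (fun i v => v)
      (fun i => LinearMap.id) (fun v => ?_) (fun v => ?_) (fun i v => rfl)
    · simp
    · change ∑ _ : Fin 1, v • f.hom 1 = v
      simp

/-- The pullback of a bundle along a morphism. -/
def pullback (α : Y ⟶ X) (E : VectBundle X) : VectBundle Y where
  fib y := E.fib (α.app _ y)
  addCommGroup y := E.addCommGroup _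
  module y := E.module _
  finite y := E.finite _
  projective y := E.projective _
  tr {_ _} f {x y} h := E.tr f (by rw [← h]; exact (NatTrans.naturality_apply α f x).symm)
  tr_id _ v := E.tr_id _ v
  tr_comp {_ _ _} f g {_ _ _} _ _ _ v := E.tr_comp f g _ _ _ v
  isExtension {_ _} f {_ _} _ := E.isExtension f _

/-- The direct sum. -/
def sum (E F : VectBundle X) : VectBundle X where
  fib x := E.fib x × F.fib x
  finite _ := inferInstance
  projective _ := inferInstance
  tr {_ _} f {_ _} h := prodExt (E.tr f h) (F.tr f h)
  tr_id h v := Prod.ext (E.tr_id h v.1) (F.tr_id h v.2)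
  tr_comp {_ _ _} f g {_ _ _} h h' h'' v := Prod.ext (E.tr_comp f g h h' h'' v.1)
    (F.tr_comp f g h h' h'' v.2)
  isExtension {_ _} f {_ _} h := (E.isExtension f h).prod (F.isExtension f h)

/-- The tensor product. -/
def tensor (E F : VectBundle X) : VectBundle X where
  fib {A} x := TensorProduct A (E.fib x) (F.fib x)
  finite _ := inferInstance
  projective _ := inferInstance
  tr {_ _} f {_ _} h := tensorExt (E.tr f h) (F.tr f h)
  tr_id {A x} h v := by
    induction v with
    | zero => rw [map_zero]
    | add v w hv hw => rw [map_add, hv, hw]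
    | tmul v w => exact congrArg₂ (· ⊗ₜ[A] ·) (E.tr_id h v) (F.tr_id h w)
  tr_comp {_ _ C} f g {_ _ _} h h' h'' v := by
    induction v with
    | zero => rw [map_zero, map_zero, map_zero]
    | add v w hv hw => rw [map_add, map_add, map_add, hv, hw]
    | tmul v w => exact congrArg₂ (· ⊗ₜ[C] ·) (E.tr_comp f g h h' h'' v) (F.tr_comp f g h h' h'' w)
  isExtension {_ _} f {_ _} h := (E.isExtension f h).tensor (F.isExtension f h)

/-- The dual bundle. -/
def dual (E : VectBundle X) : VectBundle X where
  fib {A} x := Module.Dual A (E.fib x)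
  finite _ := inferInstance
  projective _ := inferInstance
  tr {_ _} f {_ _} h := dualExt (E.isExtension f h)
  tr_id h v := by
    ext m
    have := dualExt_apply (E.isExtension (𝟙 _) h) v m
    rw [E.tr_id] at this
    exact this
  tr_comp {_ _ _} f g {_ _ _} h h' h'' v := by
    refine (E.isExtension (f ≫ g) h'').hom_ext fun m => ?_
    rw [dualExt_apply, E.tr_comp f g h h' h'', dualExt_apply, dualExt_apply]
    rfl
  isExtension {_ _} f {_ _} h := (E.isExtension f h).dual

/-- The exterior powers. -/
def exterior (k : ℕ) (E : VectBundle X) : VectBundle X where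
  fib {A} x := ⋀[A]^k (E.fib x)
  finite _ := inferInstance
  projective _ := inferInstance
  tr {_ _} f {_ _} h := exteriorExt k (E.tr f h)
  tr_id {A x} h v := by
    induction v using exterior_induction with
    | h0 => rw [map_zero]
    | hadd v w hv hw => rw [map_add, hv, hw]
    | hsmul a v hv => rw [LinearMap.map_smulₛₗ, hv]; rfl
    | hι v =>
      rw [exteriorExt_ιMulti]
      exact congrArg _ (funext fun i => E.tr_id h (v i))
  tr_comp {_ _ _} f g {_ _ _} h h' h'' v := by
    induction v using exterior_induction with
    | h0 => rw [map_zero, map_zero, map_zero]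
    | hadd v w hv hw => rw [map_add, map_add, map_add, hv, hw]
    | hsmul a v hv =>
      rw [LinearMap.map_smulₛₗ, LinearMap.map_smulₛₗ, LinearMap.map_smulₛₗ, hv]; rfl
    | hι v =>
      rw [exteriorExt_ιMulti, exteriorExt_ιMulti, exteriorExt_ιMulti]
      exact congrArg _ (funext fun i => E.tr_comp f g h h' h'' (v i))
  isExtension {_ _} f {_ _} h := (E.isExtension f h).exterior k

/-! ### Global sections, zero loci -/

instance complexModule (E : VectBundle X) {A : CommAlgCat.{0} ℂ} (x : X.obj A) :
    Module ℂ (E.fib x) := Module.compHom _ (algebraMap ℂ A)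

/-- The complex vector space `H⁰(X, E)` of global sections. -/
def globalSections (E : VectBundle X) :
    Submodule ℂ (∀ (A : CommAlgCat.{0} ℂ) (x : X.obj A), E.fib x) where
  carrier := {s | ∀ (A B : CommAlgCat.{0} ℂ) (f : A ⟶ B) (x : X.obj A) (y : X.obj B)
    (h : X.map f x = y), E.tr f h (s A x) = s B y}
  add_mem' := by
    intro s t hs ht A B f x y h
    exact (map_add (E.tr f h) _ _).trans (congrArg₂ (· + ·) (hs A B f x y h) (ht A B f x y h))
  zero_mem' := by
    intro A B f x y h
    exact map_zero (E.tr f h)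
  smul_mem' := by
    intro c s hs A B f x y h
    change E.tr f h (algebraMap ℂ A c • s A x) = algebraMap ℂ B c • s B y
    rw [LinearMap.map_smulₛₗ, hs A B f x y h]
    congr 1
    exact f.hom.commutes c

/-- The scheme-theoretic zero locus of a global section. -/
def zeroLocus {E : VectBundle X} (s : E.globalSections) : Subfunctor X where
  obj A := {x | s.1 A x = 0}
  map {A B} f x hx := by
    change s.1 B (X.map f x) = 0
    rw [← s.2 A B f x _ rfl, show s.1 A x = 0 from hx, map_zero]

end VectBundle

/-- `P` holds for a general element of the complex vector space `V`: `V` is finite-dimensional and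
`P` holds on a nonempty Zariski-open subset, namely where some nonzero polynomial in linear
coordinates does not vanish. -/
def HoldsForGeneral {V : Type*} [AddCommGroup V] [Module ℂ V] (P : V → Prop) : Prop :=
  ∃ (m : ℕ) (b : Module.Basis (Fin m) ℂ V) (p : MvPolynomial (Fin m) ℂ), p ≠ 0 ∧
    ∀ v : V, MvPolynomial.eval (b.equivFun v) p ≠ 0 → P v

/-! ### Grassmann bundles -/

/-- `L ⊆ M` is a subbundle of rank `k`: a direct summand, locally free of rank `k`. -/
structure IsSubbundle {A M : Type} [CommRing A] [AddCommGroup M] [Module A M] (k : ℕ)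
    (L : Submodule A M) : Prop where
  projective_quotient : Module.Projective A (M ⧸ L)
  rank_eq : ∀ p : PrimeSpectrum A, Module.rankAtStalk (R := A) L p = k

theorem IsSubbundle.finite_projective {A M : Type} [CommRing A] [AddCommGroup M] [Module A M]
    [Module.Finite A M] [Module.Projective A M] {k : ℕ} {L : Submodule A M}
    (h : IsSubbundle k L) : Module.Finite A L ∧ Module.Projective A L := by
  have := h.projective_quotient
  obtain ⟨p, hp⟩ := exists_retraction L
  exact ⟨Module.Finite.of_surjective p fun x => ⟨x, hp x⟩,
    Module.Projective.of_split L.subtype p (LinearMap.ext hp)⟩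

theorem IsSubbundle.extend {A B M N : Type} [CommRing A] [CommRing B] {φ : A →+* B}
    [AddCommGroup M] [Module A M] [AddCommGroup N] [Module B N] {g : M →ₛₗ[φ] N}
    [Module.Finite A M] [Module.Projective A M]
    (hg : IsExtension φ g) {k : ℕ} {L : Submodule A M} (h : IsSubbundle k L) :
    IsSubbundle k (extendSub g L) := by
  have := h.projective_quotient
  obtain ⟨_, _⟩ := h.finite_projective
  exact ⟨(hg.mapQuot_extendSub L).projective, fun p => by
    rw [(hg.restrictSub_extendSub L).rankAtStalk_eq, h.rank_eq]⟩

variable {X : CSpace}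

/-- An `A`-point of the Grassmann bundle `Gr_X(k, E)` of rank `k` subbundles of `E`: a point `x`
of `X` together with a rank `k` subbundle of `E` at `x`. -/
structure GrPoint (k : ℕ) (E : VectBundle X) (A : CommAlgCat.{0} ℂ) where
  base : X.obj A
  sub : Submodule A (E.fib base)
  isSubbundle : IsSubbundle k sub

/-- The image of a point of a Grassmann bundle under a homomorphism of algebras. -/
def GrPoint.map {k : ℕ} {E : VectBundle X} {A B : CommAlgCat.{0} ℂ} (f : A ⟶ B)
    (p : GrPoint k E A) : GrPoint k E B where
  base := X.map f p.base
  sub := extendSub (E.tr f rfl) p.sub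
  isSubbundle := p.isSubbundle.extend (E.isExtension f rfl)

theorem GrPoint.map_eq {k : ℕ} {E : VectBundle X} {A B : CommAlgCat.{0} ℂ} (f : A ⟶ B)
    (p : GrPoint k E A) (q : GrPoint k E B) (h : X.map f p.base = q.base)
    (hs : extendSub (E.tr f h) p.sub = q.sub) : p.map f = q := by
  obtain ⟨y, S, hS⟩ := q
  obtain rfl : X.map f p.base = y := h
  obtain rfl : extendSub (E.tr f rfl) p.sub = S := hs
  rfl

theorem GrPoint.sub_eq {k : ℕ} {E : VectBundle X} {A B : CommAlgCat.{0} ℂ} {f : A ⟶ B}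
    {p : GrPoint k E A} {q : GrPoint k E B} (h : p.map f = q) :
    q.sub = extendSub (E.tr f (congrArg GrPoint.base h)) p.sub := by
  subst h
  rfl

theorem GrPoint.base_eq {k : ℕ} {E : VectBundle X} {A B : CommAlgCat.{0} ℂ} {f : A ⟶ B}
    {p : GrPoint k E A} {q : GrPoint k E B} (h : p.map f = q) : X.map f p.base = q.base :=
  congrArg GrPoint.base h

theorem GrPoint.tr_mem {k : ℕ} {E : VectBundle X} {A B : CommAlgCat.{0} ℂ} {f : A ⟶ B}
    {p : GrPoint k E A} {q : GrPoint k E B} (h : p.map f = q) :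
    ∀ v ∈ p.sub, E.tr f (GrPoint.base_eq h) v ∈ q.sub := by
  subst h
  exact fun v hv => mem_extendSub _ hv

/-- The Grassmann bundle `Gr_X(k, E)`. -/
def grassmannBundle (k : ℕ) (E : VectBundle X) : CSpace where
  obj A := GrPoint k E A
  map f := ↾(GrPoint.map f)
  map_id A := by
    ext p
    refine GrPoint.map_eq _ p p (by simp) ?_
    have : ∀ v, E.tr (𝟙 A) (by simp) v = v := E.tr_id (x := p.base) (by simp)
    have h2 : (E.tr (𝟙 A) (by simp) : E.fib p.base → E.fib p.base) '' p.sub = p.sub := by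
      ext v
      exact ⟨fun ⟨w, hw, e⟩ => by rw [← e, this]; exact hw, fun hv => ⟨v, hv, this v⟩⟩
    rw [extendSub, h2]
    exact Submodule.span_eq p.sub
  map_comp {A B C} f g := by
    ext p
    have hb : X.map (f ≫ g) p.base = X.map g (X.map f p.base) := by simp
    refine GrPoint.map_eq _ p ((p.map f).map g) hb ?_
    have := E.tr_comp f g (x := p.base) rfl rfl hb
    change extendSub (E.tr (f ≫ g) hb) p.sub =
      extendSub (E.tr g (rfl : X.map g (X.map f p.base) = _)) (extendSub (E.tr f rfl) p.sub)
    refine le_antisymm (Submodule.span_le.2 ?_) (Submodule.span_le.2 ?_)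
    · rintro _ ⟨v, hv, rfl⟩
      rw [this]
      exact mem_extendSub _ (mem_extendSub _ hv)
    · rintro _ ⟨v, hv, rfl⟩
      change v ∈ Submodule.span B _ at hv
      induction hv using Submodule.span_induction with
      | mem _ h =>
        obtain ⟨w, hw, rfl⟩ := h
        exact Submodule.subset_span ⟨w, hw, this w⟩
      | zero => rw [map_zero]; exact zero_mem _
      | add a b _ _ ha hb =>
        rw [map_add]
        exact add_mem ha hb
      | smul s a _ ha =>
        rw [LinearMap.map_smulₛₗ]
        exact Submodule.smul_mem _ _ ha

/-- The tautological subbundle on `Gr_X(k, E)`. -/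
def tautSub (k : ℕ) (E : VectBundle X) : VectBundle (grassmannBundle k E) where
  fib {A} (p : GrPoint k E A) := p.sub
  addCommGroup {A} (p : GrPoint k E A) := inferInstanceAs (AddCommGroup p.sub)
  module {A} (p : GrPoint k E A) := inferInstanceAs (Module A p.sub)
  finite {A} (p : GrPoint k E A) := p.isSubbundle.finite_projective.1
  projective {A} (p : GrPoint k E A) := p.isSubbundle.finite_projective.2
  tr {A B} f {p q} (h : GrPoint.map f p = q) := restrictSub (E.tr f (GrPoint.base_eq h))
    (GrPoint.tr_mem h)
  tr_id h v := Subtype.ext (E.tr_id _ _)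
  tr_comp {_ _ _} f g {_ _ _} h h' h'' v := Subtype.ext (E.tr_comp f g _ _ _ _)
  isExtension {A B} f {p q} (h : GrPoint.map f p = q) := by
    subst h
    have := p.isSubbundle.projective_quotient
    exact (E.isExtension f _).restrictSub_extendSub p.sub

/-- The tautological quotient bundle on `Gr_X(k, E)`. -/
def tautQuot (k : ℕ) (E : VectBundle X) : VectBundle (grassmannBundle k E) where
  fib {A} (p : GrPoint k E A) := E.fib p.base ⧸ p.sub
  addCommGroup {A} (p : GrPoint k E A) := inferInstanceAs (AddCommGroup (_ ⧸ p.sub))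
  module {A} (p : GrPoint k E A) := inferInstanceAs (Module A (_ ⧸ p.sub))
  finite {A} (p : GrPoint k E A) := inferInstanceAs (Module.Finite A (_ ⧸ p.sub))
  projective {A} (p : GrPoint k E A) := p.isSubbundle.projective_quotient
  tr {A B} f {p q} (h : GrPoint.map f p = q) := mapQuot (E.tr f (GrPoint.base_eq h))
    (GrPoint.tr_mem h)
  tr_id {A p} h v := by
    obtain ⟨v, rfl⟩ := Submodule.Quotient.mk_surjective _ v
    exact congrArg Submodule.Quotient.mk (E.tr_id _ v)
  tr_comp {_ _ _} f g {_ _ _} h h' h'' v := by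
    obtain ⟨v, rfl⟩ := Submodule.Quotient.mk_surjective _ v
    exact congrArg Submodule.Quotient.mk (E.tr_comp f g _ _ _ v)
  isExtension {A B} f {p q} (h : GrPoint.map f p = q) := by
    subst h
    exact (E.isExtension f _).mapQuot_extendSub p.sub

/-! ### Grassmannians and two-step flag varieties -/

/-- The point `Spec ℂ`. -/
def pt : CSpace := (Functor.const _).obj PUnit

/-- The Grassmannian `Gr(k, n)` of `k`-dimensional subspaces of `ℂⁿ`. -/
abbrev Gr (k n : ℕ) : CSpace := grassmannBundle k (VectBundle.trivial pt n)

/-- The tautological subbundle `𝒰` on `Gr(k, n)`, of rank `k`. -/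
abbrev tautU (k n : ℕ) : VectBundle (Gr k n) := tautSub k (VectBundle.trivial pt n)

/-- The tautological quotient bundle `𝒬` on `Gr(k, n)`, of rank `n - k`. -/
abbrev tautQ (k n : ℕ) : VectBundle (Gr k n) := tautQuot k (VectBundle.trivial pt n)

/-- The line bundle `𝒪(-1) = det 𝒰` on `Gr(k, n)`, dual to the Plücker line bundle `𝒪(1)`. -/
abbrev grO (k n : ℕ) : VectBundle (Gr k n) := (tautU k n).exterior k

/-- The two-step flag variety `Fl(k₁, k₂, n)` of subspaces `V₁ ⊆ V₂ ⊆ ℂⁿ` of dimensions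
`k₁` and `k₂`. -/
def Fl (k₁ k₂ n : ℕ) : CSpace where
  obj A := {p : GrPoint k₁ (VectBundle.trivial pt n) A × GrPoint k₂ (VectBundle.trivial pt n) A //
    (p.1.sub : Submodule A (Fin n → A)) ≤ p.2.sub}
  map f := ↾fun p => ⟨(p.1.1.map f, p.1.2.map f), Submodule.span_mono (Set.image_mono p.2)⟩
  map_id A := by
    refine ConcreteCategory.hom_ext _ _ fun p => ?_
    have h₁ : p.1.1.map (𝟙 A) = p.1.1 := types_congr_hom ((Gr k₁ n).map_id A) p.1.1
    have h₂ : p.1.2.map (𝟙 A) = p.1.2 := types_congr_hom ((Gr k₂ n).map_id A) p.1.2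
    exact Subtype.ext (Prod.ext h₁ h₂)
  map_comp f g := by
    refine ConcreteCategory.hom_ext _ _ fun p => ?_
    have h₁ : p.1.1.map (f ≫ g) = (p.1.1.map f).map g :=
      types_congr_hom ((Gr k₁ n).map_comp f g) p.1.1
    have h₂ : p.1.2.map (f ≫ g) = (p.1.2.map f).map g :=
      types_congr_hom ((Gr k₂ n).map_comp f g) p.1.2
    exact Subtype.ext (Prod.ext h₁ h₂)

/-- The projection `π₁ : Fl(k₁, k₂, n) ⟶ Gr(k₁, n)`. -/
def flProj₁ (k₁ k₂ n : ℕ) : Fl k₁ k₂ n ⟶ Gr k₁ n where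
  app A := ↾fun p => p.1.1

/-- The projection `π₂ : Fl(k₁, k₂, n) ⟶ Gr(k₂, n)`. -/
def flProj₂ (k₁ k₂ n : ℕ) : Fl k₁ k₂ n ⟶ Gr k₂ n where
  app A := ↾fun p => p.1.2

/-- `𝒰₁`, the pullback of the tautological subbundle of `Gr(k₁, n)` to `Fl(k₁, k₂, n)`. -/
abbrev flU₁ (k₁ k₂ n : ℕ) : VectBundle (Fl k₁ k₂ n) := (tautU k₁ n).pullback (flProj₁ k₁ k₂ n)

/-- `𝒬₂`, the pullback of the tautological quotient bundle of `Gr(k₂, n)` to `Fl(k₁, k₂, n)`. -/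
abbrev flQ₂ (k₁ k₂ n : ℕ) : VectBundle (Fl k₁ k₂ n) := (tautQ k₂ n).pullback (flProj₂ k₁ k₂ n)

end

/-! The first step identifies the global sections: `H⁰(Fl, 𝒬₂)` is `ℂⁿ` (`secQ_bijective`) and
`H⁰(Fl, 𝒰₁^∨)` is its dual (`secU_bijective`). A general section is then a vector `v` with `v 0 ≠
0`, respectively a linear form `l` with `l 0 ≠ 0`.

The vector `v` vanishes at a flag exactly when `v ∈ V₂`. After splitting `ℂⁿ = ℂⁿ⁻¹ ⊕ ℂv`, this says
`V₂ = W ⊕ ℂv` with `W` in `Gr(k₂ - 1, n - 1)`, and `V₁` is an arbitrary rank `k₁` subbundle of `W ⊕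
𝒪`. The form `l` vanishes exactly when `V₁ ⊆ ker l = ℂⁿ⁻¹`. Then `V₁` is a point of `Gr(k₁, n - 1)`,
and `V₂` amounts to the subbundle `V₂ / V₁` of `ℂⁿ / V₁ = 𝒬 ⊕ 𝒪`. Tensoring with the line bundle
`𝒪(-1)` does not change the Grassmann bundle. Both descriptions are bijections on `A`-points,
natural in `A`, hence isomorphisms of functors of points.

For the global sections, a section of `𝒰₁^∨` is evaluated at the flag of columns of `g ∈ GL_n`, on
the first column of `g`. This is a regular function on `GL_n`, homogeneous of degree one in that
column and invariant under the column operations that preserve the flag and the column. The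
invariance extends to the opposite operations, since a regular function on `ℙ¹` is constant
(`GLFunction.ColInvariant.symm`). So the function depends on the first column only
(`GLFunction.eq_of_col_eq`), extends from `𝔸ⁿ ∖ 0` to a polynomial by a Hartogs argument
(`GLFunction.exists_polynomial`), and is linear by homogeneity (`GLFunction.exists_linear`). For
`𝒬₂` the same argument runs on inverse transposes, pairing the section with linear forms that vanish
on `V₂`. Sections are determined over local rings, where every flag comes from a matrix. -/

open Matrix

noncomputable section

/-! ### Regular functions on general linear groups -/

/-- A regular function on the group scheme `GL_ι` over `ℂ`. -/
structure GLFunction (ι : Type) [Fintype ι] [DecidableEq ι] where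
  toFun : ∀ (A : Type) [CommRing A] [Algebra ℂ A], GL ι A → A
  natural : ∀ {A B : Type} [CommRing A] [Algebra ℂ A] [CommRing B] [Algebra ℂ B] (φ : A →ₐ[ℂ] B)
    (g : GL ι A), toFun B (GeneralLinearGroup.map φ.toRingHom g) = φ (toFun A g)

namespace GLFunction

theorem map_transvection {ι : Type} [DecidableEq ι] {A B : Type} [CommRing A] [CommRing B]
    (φ : A →+* B) (i j : ι) (c : A) :
    (transvection i j c).map φ = transvection i j (φ c) := by
  simp [transvection, Matrix.map_add, Matrix.map_one, Matrix.map_single]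

variable {ι : Type} [Fintype ι] [DecidableEq ι]

/-- `f` is unchanged when a multiple of the column `i` is added to the column `j`. -/
def ColInvariant (f : GLFunction ι) (i j : ι) : Prop :=
  ∀ (A : Type) [CommRing A] [Algebra ℂ A] (g g' : GL ι A) (c : A),
    g'.1 = g.1 * transvection i j c → f.toFun A g' = f.toFun A g

/-- Scaling the columns scales `f` by the factor of the column `o`. -/
def ScalesAt (f : GLFunction ι) (o : ι) : Prop :=
  ∀ (A : Type) [CommRing A] [Algebra ℂ A] (g g' : GL ι A) (d : ι → A),
    g'.1 = g.1 * diagonal d → f.toFun A g' = d o * f.toFun A g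

theorem natural_of_map_eq (f : GLFunction ι) {A B : Type} [CommRing A] [Algebra ℂ A] [CommRing B]
    [Algebra ℂ B] (φ : A →ₐ[ℂ] B) (g : GL ι A) (g' : GL ι B) (h : g'.1 = g.1.map φ) :
    f.toFun B g' = φ (f.toFun A g) := by
  rw [← f.natural φ g]
  congr 1
  ext i j
  rw [h]
  rfl

theorem exists_mul_transvection {A : Type} [CommRing A] (g : GL ι A) {i j : ι} (h : i ≠ j) (c : A) :
    ∃ g' : GL ι A, g'.1 = g.1 * transvection i j c :=
  ⟨g * ⟨transvection i j c, transvection i j (-c),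
    by rw [transvection_mul_transvection_same _ _ h, add_neg_cancel, transvection_zero],
    by rw [transvection_mul_transvection_same _ _ h, neg_add_cancel, transvection_zero]⟩, rfl⟩

theorem exists_mul_of_isUnit_det {A : Type} [CommRing A] (g : GL ι A) {q : Matrix ι ι A}
    (h : IsUnit q.det) : ∃ g' : GL ι A, g'.1 = g.1 * q :=
  ⟨g * GeneralLinearGroup.mk'' q h, rfl⟩

/-- This is `H⁰(ℙ¹, 𝒪) = R`: a polynomial in `T` that is also a polynomial in `T⁻¹` is constant. -/
theorem exists_of_T_of_T_inv {R : Type} [CommRing R] (p q : Polynomial R)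
    (h : p.toLaurent = LaurentPolynomial.invert q.toLaurent) : ∃ a, p = Polynomial.C a := by
  -- Multiplying by `T ^ deg q` clears the negative powers; the right side has degree at most `deg
  -- q`, so `p` has no terms of positive degree.
  have h1 : p * Polynomial.X ^ q.natDegree = q.reverse := by
    apply Polynomial.toLaurent_injective
    rw [LaurentPolynomial.toLaurent_reverse, ← h, map_mul, Polynomial.toLaurent_X_pow]
  refine ⟨p.coeff 0, Polynomial.ext fun n => ?_⟩
  rw [Polynomial.coeff_C]
  split_ifs with hn
  · rw [hn]
  · rw [← Polynomial.coeff_mul_X_pow p q.natDegree n, h1]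
    exact Polynomial.coeff_eq_zero_of_natDegree_lt
      ((Polynomial.reverse_natDegree_le q).trans_lt (by omega))

/-- A computation in `SL₂` that relates the two charts of `ℙ¹ = SL₂ / B`, with coordinates `t` and
`s = t⁻¹`. The product of three transvections is the Weyl element. -/
theorem lower_transvection_eq {A : Type} [CommRing A] {i j : ι} (h : i ≠ j) {t s : A}
    (hts : t * s = 1) :
    transvection j i t * transvection i j (-s) =
      transvection i j s * (transvection i j (-1) * transvection j i 1 * transvection i j (-1)) *
        diagonal (Function.update (Function.update 1 i t) j s) := by
  have hst : s * t = 1 := by rw [mul_comm, hts]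
  ext k l
  simp only [← mul_assoc, mul_diagonal]
  by_cases hj : l = j
  · subst hj
    simp [h, h.symm, mul_transvection_apply_of_ne, mul_transvection_apply_same]
    simp [transvection, single_apply, one_apply]
    by_cases hk : k = l <;> by_cases hk' : k = i <;> simp_all [eq_comm]
  by_cases hi : l = i
  · subst hi
    simp [h, mul_transvection_apply_of_ne, mul_transvection_apply_same]
    simp [transvection, single_apply, one_apply]
    by_cases hk : k = l <;> by_cases hk' : k = j <;> simp_all [eq_comm]
  · simp [hi, hj, mul_transvection_apply_of_ne]
    simp [transvection, one_apply, Ne.symm hi, Ne.symm hj]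

theorem map_mul_eq {A B : Type} [CommRing A] [CommRing B] (φ : A →+* B) {g g₁ : GL ι A}
    {q : Matrix ι ι A} (h : g₁.1 = g.1 * q) :
    (GeneralLinearGroup.map φ g₁).1 = (GeneralLinearGroup.map φ g).1 * q.map φ := by
  change g₁.1.map φ = g.1.map φ * q.map φ
  rw [h, Matrix.map_mul]

/-- The comparison of the two charts of `ℙ¹`: `φ` and `ψ` will send the variable to `T` and to
`T⁻¹`. The diagonal factor has no effect because its entry at `o` is `1`. -/
theorem ColInvariant.exists_eq {f : GLFunction ι} {i j o : ι} (hij : i ≠ j) (hio : i ≠ o)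
    (hjo : j ≠ o) (hs : f.ScalesAt o) (h : f.ColInvariant i j) {P L : Type} [CommRing P]
    [Algebra ℂ P] [CommRing L] [Algebra ℂ L] (φ ψ : P →ₐ[ℂ] L) (g : GL ι P)
    (hg : GeneralLinearGroup.map φ.toRingHom g = GeneralLinearGroup.map ψ.toRingHom g)
    (x : P) (hx : φ x * ψ x = 1) (g₁ : GL ι P) (hg₁ : g₁.1 = g.1 * transvection j i x) :
    ∃ a : P, φ (f.toFun P g₁) = ψ a := by
  obtain ⟨g₂, hg₂⟩ := exists_mul_of_isUnit_det g
    (q := transvection i j x * (transvection i j (-1) * transvection j i 1 * transvection i j (-1)))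
    (by simp [hij, hij.symm])
  refine ⟨f.toFun P g₂, ?_⟩
  rw [← f.natural, ← f.natural]
  have e₁ := map_mul_eq φ.toRingHom hg₁
  have e₂ := map_mul_eq ψ.toRingHom hg₂
  rw [map_transvection, hg] at e₁
  simp only [Matrix.map_mul, map_transvection, map_neg, map_one] at e₂
  obtain ⟨g₃, hg₃⟩ := exists_mul_transvection (GeneralLinearGroup.map φ.toRingHom g₁) hij (-ψ x)
  have h₃ := hs L (GeneralLinearGroup.map ψ.toRingHom g₂) g₃
    (Function.update (Function.update 1 i (φ x)) j (ψ x)) (by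
      rw [hg₃, e₁, e₂, mul_assoc, mul_assoc]
      congr 1
      exact lower_transvection_eq hij hx)
  rw [Function.update_of_ne hjo.symm, Function.update_of_ne hio.symm, Pi.one_apply,
    one_mul] at h₃
  rw [← h₃, h L _ _ _ hg₃]

/-- For fixed `g`, the value of `f` along the opposite transvections is a polynomial in the
parameter. By invariance under the given ones it is also a polynomial in the inverse of the
parameter, hence constant. -/
theorem ColInvariant.symm {f : GLFunction ι} {i j o : ι} (hij : i ≠ j) (hio : i ≠ o) (hjo : j ≠ o)
    (hs : f.ScalesAt o) (h : f.ColInvariant i j) : f.ColInvariant j i := by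
  intro R _ _ g g' c hg
  obtain ⟨g₁, hg₁⟩ := exists_mul_transvection
    (GeneralLinearGroup.map (Polynomial.CAlgHom (R := ℂ) (A := R)).toRingHom g) hij.symm
    Polynomial.X
  have ex : ∃ a, f.toFun (Polynomial R) g₁ = Polynomial.C a := by
    obtain ⟨a, ha⟩ := h.exists_eq hij hio hjo hs
      ((Polynomial.toLaurentAlg (R := R)).restrictScalars ℂ)
      ((((LaurentPolynomial.invert (R := R)) :
        LaurentPolynomial R →ₐ[R] LaurentPolynomial R).restrictScalars ℂ).comp
        ((Polynomial.toLaurentAlg (R := R)).restrictScalars ℂ)) _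
      (by
        refine Units.ext (Matrix.ext fun k l => ?_)
        change Polynomial.toLaurent (Polynomial.C (g.1 k l)) =
          LaurentPolynomial.invert (Polynomial.toLaurent (Polynomial.C (g.1 k l)))
        rw [Polynomial.toLaurent_C, LaurentPolynomial.invert_C]) Polynomial.X
      (by
        change Polynomial.toLaurent (Polynomial.X : Polynomial R) *
          LaurentPolynomial.invert (Polynomial.toLaurent Polynomial.X) = 1
        rw [Polynomial.toLaurent_X, LaurentPolynomial.invert_T, ← LaurentPolynomial.T_add,
          add_neg_cancel, LaurentPolynomial.T_zero]) g₁ hg₁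
    exact exists_of_T_of_T_inv _ _ ha
  obtain ⟨a, ha⟩ := ex
  -- Specializing the variable to `r` gives the constant `a` for every `r`; the values at `c` and at
  -- `0` are then compared.
  have hev : ∀ r : R, ∀ g'' : GL ι R, g''.1 = g.1 * transvection j i r → f.toFun R g'' = a := by
    intro r g'' hr
    rw [f.natural_of_map_eq ((Polynomial.aeval r).restrictScalars ℂ) g₁ g'', ha]
    · exact Polynomial.aeval_C _ _
    · rw [hg₁, hr]
      change _ = (_ * transvection j i Polynomial.X).map (Polynomial.aeval r).toRingHom
      rw [Matrix.map_mul, map_transvection]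
      congr 1
      · ext k l
        exact (Polynomial.aeval_C r (g.1 k l)).symm
      · congr 1
        exact (Polynomial.aeval_X r).symm
  rw [hev c g' hg, hev 0 g (by simp)]

end GLFunction

/-! ### Invariant functions depend on a single column -/

namespace GLFunction

variable {ι : Type} [Fintype ι] [DecidableEq ι]

/-- The block matrix with a block `h` away from the index `o` and the entry `1` at `(o, o)`. -/
def extendByOne {K : Type} [CommRing K] (o : ι) (h : Matrix {a // a ≠ o} {a // a ≠ o} K) :
    Matrix ι ι K :=
  reindexAlgEquiv K K (Equiv.sumCompl fun a => a ≠ o) (fromBlocks h 0 0 1)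

section extendByOne

variable {K : Type} [CommRing K] (o : ι)

theorem extendByOne_mul (h h' : Matrix {a // a ≠ o} {a // a ≠ o} K) :
    extendByOne o (h * h') = extendByOne o h * extendByOne o h' := by
  simp only [extendByOne]
  rw [← map_mul, fromBlocks_multiply]
  simp

theorem det_extendByOne (h : Matrix {a // a ≠ o} {a // a ≠ o} K) :
    (extendByOne o h).det = h.det := by
  simp [extendByOne]

theorem extendByOne_apply_ne (h : Matrix {a // a ≠ o} {a // a ≠ o} K) (k l : {a // a ≠ o}) :
    extendByOne o h k l = h k l := by
  simp [extendByOne, coe_reindexAlgEquiv, k.2, l.2]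

theorem extendByOne_apply_left (h : Matrix {a // a ≠ o} {a // a ≠ o} K) (l : ι) :
    extendByOne o h o l = (1 : Matrix ι ι K) o l := by
  by_cases hl : l = o
  · subst hl; simp [extendByOne, coe_reindexAlgEquiv]
  · simp [extendByOne, coe_reindexAlgEquiv, hl, Ne.symm hl]

theorem extendByOne_apply_right (h : Matrix {a // a ≠ o} {a // a ≠ o} K) (l : ι) :
    extendByOne o h l o = (1 : Matrix ι ι K) l o := by
  by_cases hl : l = o
  · subst hl; simp [extendByOne, coe_reindexAlgEquiv]
  · simp [extendByOne, coe_reindexAlgEquiv, hl]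

theorem extendByOne_diagonal (d : {a // a ≠ o} → K) :
    ∃ d' : ι → K, d' o = 1 ∧ extendByOne o (diagonal d) = diagonal d' := by
  refine ⟨Sum.elim d 1 ∘ (Equiv.sumCompl fun a => a ≠ o).symm, by simp, ?_⟩
  simp only [extendByOne]
  rw [← diagonal_one, fromBlocks_diagonal]
  simp [coe_reindexAlgEquiv, submatrix_diagonal_equiv]
  exact fun _ => rfl

theorem extendByOne_transvection (t : TransvectionStruct {a // a ≠ o} K) :
    extendByOne o t.toMatrix = transvection (t.i : ι) (t.j : ι) t.c := by
  simp only [extendByOne]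
  rw [← TransvectionStruct.toMatrix_sumInl, ← TransvectionStruct.toMatrix_reindexEquiv]
  rfl

end extendByOne

/-- Over a field, an invertible block is a product of transvections and diagonal matrices, and each
of these leaves `f` unchanged. -/
theorem eq_of_mul_extendByOne {f : GLFunction ι} {o : ι} (hs : f.ScalesAt o)
    (hc : ∀ i j, i ≠ j → j ≠ o → f.ColInvariant i j) {K : Type} [Field K] [Algebra ℂ K]
    (h : Matrix {a // a ≠ o} {a // a ≠ o} K) (hh : h.det ≠ 0) (g g' : GL ι K)
    (hg : g'.1 = g.1 * extendByOne o h) : f.toFun K g' = f.toFun K g := by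
  revert g g'
  refine diagonal_transvection_induction_of_det_ne_zero (fun h => ∀ g g' : GL ι K,
    g'.1 = g.1 * extendByOne o h → f.toFun K g' = f.toFun K g) h hh ?_ ?_ ?_
  · intro D _ g g' hg
    obtain ⟨d, hd, e⟩ := extendByOne_diagonal o D
    rw [hs K g g' d (by rw [hg, e]), hd, one_mul]
  · intro t g g' hg
    exact hc t.i t.j (fun e => t.hij (Subtype.ext e)) t.j.2 K g g' t.c
      (by rw [hg, extendByOne_transvection])
  · intro A B hA _ hPA hPB g g' hg
    obtain ⟨g₁, hg₁⟩ := exists_mul_of_isUnit_det g (q := extendByOne o A)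
      (by rw [det_extendByOne]; exact hA.isUnit)
    rw [hPB g₁ g' (by rw [hg, hg₁, extendByOne_mul, mul_assoc]), hPA g g₁ hg₁]

/-- The matrix is a product of the transvections `transvection o j (r j)`: the cross terms vanish
because `o ∉ s`. -/
theorem eq_of_mul_row {f : GLFunction ι} {o : ι}
    (hc : ∀ i j, i ≠ j → j ≠ o → f.ColInvariant i j) {A : Type} [CommRing A] [Algebra ℂ A]
    (r : ι → A) (s : Finset ι) (hs : o ∉ s) (g g' : GL ι A)
    (hg : g'.1 = g.1 * (1 + ∑ j ∈ s, single o j (r j))) : f.toFun A g' = f.toFun A g := by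
  induction s using Finset.induction_on generalizing g' with
  | empty =>
    congr 1
    exact Units.ext (by simpa using hg)
  | insert j s hj ih =>
    rw [Finset.mem_insert, not_or] at hs
    obtain ⟨g₁, hg₁⟩ := exists_mul_transvection g' hs.1 (-r j)
    have hj' : transvection o j (r j) * transvection o j (-r j) = 1 := by
      rw [transvection_mul_transvection_same _ _ hs.1, add_neg_cancel, transvection_zero]
    have e : (1 + ∑ i ∈ insert j s, single o i (r i) : Matrix ι ι A) =
        (1 + ∑ i ∈ s, single o i (r i)) * transvection o j (r j) := by
      rw [Finset.sum_insert hj, transvection, mul_add, mul_one, add_mul, one_mul, Finset.sum_mul,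
        Finset.sum_eq_zero (f := fun i => single o i (r i) * single o j (r j))]
      · abel
      · intro i hi
        exact single_mul_single_of_ne _ _ _ _ (by rintro rfl; exact hs.2 hi) _
    rw [← ih hs.2 g₁ (by rw [hg₁, hg, e, mul_assoc, mul_assoc, hj', mul_one]),
      hc o j hs.1 (Ne.symm hs.1) A g' g₁ _ hg₁]

/-- The matrix `g⁻¹ g'` fixes the basis vector `o`, and the stabilizer of that vector is generated
by the block matrices and the row matrices treated above. -/
theorem eq_of_col_eq {f : GLFunction ι} {o : ι} (hs : f.ScalesAt o)
    (hc : ∀ i j, i ≠ j → j ≠ o → f.ColInvariant i j) {K : Type} [Field K] [Algebra ℂ K]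
    (g g' : GL ι K) (hg : ∀ k, g'.1 k o = g.1 k o) : f.toFun K g' = f.toFun K g := by
  set q : Matrix ι ι K := (g⁻¹ * g' : GL ι K).1 with hq
  have hgq : g'.1 = g.1 * q := by simp [hq]
  have hqo : ∀ k, q k o = (1 : Matrix ι ι K) k o := by
    intro k
    have : ((g⁻¹ : GL ι K).1 * g.1) k o = (1 : Matrix ι ι K) k o := by simp
    rw [← this, hq, Units.val_mul, Matrix.mul_apply, Matrix.mul_apply]
    simp only [hg]
  let h : Matrix {a // a ≠ o} {a // a ≠ o} K := q.submatrix (↑) (↑)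
  -- The block part `h` is `q` with row and column `o` removed, and the second factor restores the
  -- row `o`.
  have key : q = extendByOne o h * (1 + ∑ j ∈ Finset.univ.erase o, single o j (q o j)) := by
    rw [mul_add, mul_one]
    have e : extendByOne o h * ∑ j ∈ Finset.univ.erase o, single o j (q o j) =
        ∑ j ∈ Finset.univ.erase o, single o j (q o j) := by
      rw [Finset.mul_sum]
      refine Finset.sum_congr rfl fun j _ => ?_
      ext k l
      by_cases hl : l = j
      · subst hl
        rw [mul_single_apply_same, extendByOne_apply_right, single_apply, one_apply]
        simp [eq_comm]
      · simp [hl, Ne.symm hl]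
    rw [e]
    ext k l
    rw [Matrix.add_apply, Matrix.sum_apply]
    by_cases hk : k = o
    · subst hk
      rw [extendByOne_apply_left]
      by_cases hl : l = k
      · subst hl
        rw [hqo, Finset.sum_eq_zero, add_zero]
        intro j hj
        simp [Finset.ne_of_mem_erase hj]
      · simp [single_apply, one_apply, Ne.symm hl, hl]
    · rw [Finset.sum_eq_zero (fun j _ => by simp [Ne.symm hk]), add_zero]
      by_cases hl : l = o
      · subst hl
        rw [extendByOne_apply_right, hqo]
      · exact (extendByOne_apply_ne o h ⟨k, hk⟩ ⟨l, hl⟩).symm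
  have hdet : h.det ≠ 0 := by
    have : IsUnit q.det := (Matrix.isUnit_iff_isUnit_det _).1 (Units.isUnit _)
    rw [key, det_mul, det_extendByOne] at this
    exact left_ne_zero_of_mul this.ne_zero
  obtain ⟨g₁, hg₁⟩ := exists_mul_of_isUnit_det g (q := extendByOne o h)
    (by rw [det_extendByOne]; exact hdet.isUnit)
  rw [eq_of_mul_row hc (q o) (Finset.univ.erase o) (by simp) g₁ g'
    (by rw [hg₁, mul_assoc, ← key, hgq]), eq_of_mul_extendByOne hs hc h hdet g g₁ hg₁]

end GLFunction

/-! ### From functions of one column to linear forms -/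

theorem exists_algHom_away {S B : Type} [CommRing S] [Algebra ℂ S] [CommRing B] [Algebra ℂ B]
    (x : S) (φ : S →ₐ[ℂ] B) (h : IsUnit (φ x)) :
    ∃ ψ : Localization.Away x →ₐ[ℂ] B, ∀ s, ψ (algebraMap S _ s) = φ s := by
  refine ⟨IsLocalization.liftAlgHom (M := Submonoid.powers x) (f := φ) ?_, fun s => ?_⟩
  · rintro ⟨_, n, rfl⟩
    simpa using h.pow n
  · simp

/-- The coefficient of `t` in `P(tX)` is the linear part of `P`, while in `tP` it is `P` itself. -/
theorem MvPolynomial.eq_linear_of_homogeneous {ι : Type} [Fintype ι]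
    (P : MvPolynomial ι ℂ)
    (h : MvPolynomial.aeval (fun k => Polynomial.X * Polynomial.C (MvPolynomial.X k :
      MvPolynomial ι ℂ)) P = Polynomial.X * Polynomial.C P) :
    ∃ l : ι → ℂ, P = ∑ k, MvPolynomial.C (l k) * MvPolynomial.X k := by
  classical
  have key : ∀ Q : MvPolynomial ι ℂ, (MvPolynomial.aeval (fun k => Polynomial.X *
      Polynomial.C (MvPolynomial.X k : MvPolynomial ι ℂ)) Q).coeff 0 = MvPolynomial.C (Q.coeff 0) ∧
      (MvPolynomial.aeval (fun k => Polynomial.X *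
      Polynomial.C (MvPolynomial.X k : MvPolynomial ι ℂ)) Q).coeff 1 =
      ∑ k, MvPolynomial.C (Q.coeff (Finsupp.single k 1)) * MvPolynomial.X k := by
    intro Q
    induction Q using MvPolynomial.induction_on with
    | C a =>
      rw [MvPolynomial.aeval_C, IsScalarTower.algebraMap_apply ℂ (MvPolynomial ι ℂ) (Polynomial _),
        Polynomial.algebraMap_eq, Polynomial.coeff_C, Polynomial.coeff_C]
      simp [MvPolynomial.coeff_C, eq_comm (a := (0 : ι →₀ ℕ)), MvPolynomial.algebraMap_eq]
    | add p q hp hq =>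
      simp only [map_add, Polynomial.coeff_add, MvPolynomial.coeff_add, hp, hq, add_mul,
        Finset.sum_add_distrib, and_self]
    | mul_X p k hp =>
      have e : ∀ q : Polynomial (MvPolynomial ι ℂ), q * (Polynomial.X * Polynomial.C
          (MvPolynomial.X k)) = q * Polynomial.C (MvPolynomial.X k) * Polynomial.X := fun q => by
        ring
      rw [map_mul, MvPolynomial.aeval_X, e, Polynomial.coeff_mul_X, Polynomial.coeff_mul_X_zero,
        Polynomial.coeff_mul_C, hp.1]
      simp only [MvPolynomial.coeff_mul_X']
      refine ⟨by simp, ?_⟩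
      rw [Finset.sum_eq_single k]
      · simp
      · intro b _ hb
        simp [Ne.symm hb]
      · simp
  refine ⟨fun k => P.coeff (Finsupp.single k 1), ?_⟩
  rw [← (key P).2, h]
  simp

namespace GLFunction

variable {ι : Type} [Fintype ι] [DecidableEq ι]

/-- Swapping the rows `i` and `o` moves the unit entry to the diagonal; the identity matrix with its
column `o` replaced then has that entry as determinant. -/
theorem exists_col_eq {A : Type} [CommRing A] (o i : ι) (c : ι → A) (h : IsUnit (c i)) :
    ∃ g : GL ι A, ∀ k, g.1 k o = c k := by
  let M : Matrix ι ι A := (updateCol 1 o (c ∘ Equiv.swap i o)).submatrix (Equiv.swap i o) id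
  have hM : IsUnit M.det := by
    rw [det_permute, ← cramer_apply, cramer_one]
    refine IsUnit.mul ?_ (by simpa using h)
    exact (Equiv.Perm.sign (Equiv.swap i o)).isUnit.map (Int.castRingHom A)
  exact ⟨GeneralLinearGroup.mk'' M hM, fun k => by
    change M k o = c k
    simp [M]⟩

/-- Hartogs for `𝔸ⁿ ∖ 0`. On the chart where the `i`-th coordinate is invertible, some matrix has
the generic column, so `f` has only powers of `X i` in its denominator. Two coprime denominators
leave none, which is why two indices are needed. -/
theorem exists_polynomial {f : GLFunction ι} {o : ι} (hs : f.ScalesAt o)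
    (hc : ∀ i j, i ≠ j → j ≠ o → f.ColInvariant i j) [Nontrivial ι] :
    ∃ P : MvPolynomial ι ℂ, ∀ (K : Type) [Field K] [Algebra ℂ K] (φ : MvPolynomial ι ℂ →ₐ[ℂ] K)
      (_ : Function.Injective φ) (g : GL ι K), (∀ k, g.1 k o = φ (MvPolynomial.X k)) →
      f.toFun K g = φ P := by
  let S := MvPolynomial ι ℂ
  have loc : ∀ i : ι, ∃ (p : S) (m : ℕ), ∀ (K : Type) [Field K] [Algebra ℂ K] (φ : S →ₐ[ℂ] K)
      (_ : Function.Injective φ) (g : GL ι K), (∀ k, g.1 k o = φ (MvPolynomial.X k)) →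
      f.toFun K g * φ (MvPolynomial.X i) ^ m = φ p := by
    intro i
    let x : S := MvPolynomial.X i
    obtain ⟨g₀, hg₀⟩ := exists_col_eq o i
      (fun k => algebraMap S (Localization.Away x) (MvPolynomial.X k))
      (IsLocalization.Away.algebraMap_isUnit x)
    obtain ⟨m, p, hp⟩ := IsLocalization.Away.surj x (f.toFun _ g₀)
    refine ⟨p, m, fun K _ _ φ hφ g hg => ?_⟩
    obtain ⟨ψ, hψ⟩ := exists_algHom_away x φ
      ((map_ne_zero_iff φ hφ).2 (MvPolynomial.X_ne_zero i)).isUnit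
    rw [eq_of_col_eq hs hc (GeneralLinearGroup.map ψ.toRingHom g₀) g
      (fun k => by
        rw [hg]
        change _ = ψ (g₀.1 k o)
        rw [hg₀, hψ]), f.natural, ← hψ p, ← hp, map_mul, map_pow, hψ]
  obtain ⟨i, j, hij⟩ := exists_pair_ne ι
  obtain ⟨p, m, hp⟩ := loc i
  obtain ⟨q, l, hq⟩ := loc j
  have hX : ∀ k, (MvPolynomial.X k : S) ≠ 0 := fun k => MvPolynomial.X_ne_zero k
  -- The two expressions for the same value give `p * X j ^ l = X i ^ m * q`, and the prime `X i`
  -- does not divide `X j`.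
  have hdvd : (MvPolynomial.X i : S) ^ m ∣ p := by
    let φ : S →ₐ[ℂ] FractionRing S := IsScalarTower.toAlgHom ℂ S (FractionRing S)
    have hφ : Function.Injective φ := IsFractionRing.injective S (FractionRing S)
    obtain ⟨g, hg⟩ := exists_col_eq o o (fun k => φ (MvPolynomial.X k))
      ((map_ne_zero_iff φ hφ).2 (hX o)).isUnit
    have h₁ := hp _ φ hφ g hg
    have h₂ := hq _ φ hφ g hg
    have e : p * MvPolynomial.X j ^ l = MvPolynomial.X i ^ m * q := by
      apply hφ
      rw [map_mul, map_mul, ← h₁, ← h₂, map_pow, map_pow]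
      ring
    have hpr : Prime (MvPolynomial.X i : S) := MvPolynomial.X_prime
    refine hpr.pow_dvd_of_dvd_mul_right m (fun hd => ?_) ⟨q, e⟩
    have := hpr.dvd_of_dvd_pow hd
    rw [MvPolynomial.X_dvd_X] at this
    simp_all
  obtain ⟨P, rfl⟩ := hdvd
  refine ⟨P, fun K _ _ φ hφ g hg => ?_⟩
  have h₁ := hp K φ hφ g hg
  rw [map_mul, map_pow, mul_comm] at h₁
  exact mul_left_cancel₀ (pow_ne_zero _ ((map_ne_zero_iff φ hφ).2 (hX i))) h₁

theorem map_eq_mul_of_scales {f : GLFunction ι} {o : ι} (hs : f.ScalesAt o)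
    {P : MvPolynomial ι ℂ} {K : Type} [Field K] [Algebra ℂ K]
    (hP : ∀ (φ : MvPolynomial ι ℂ →ₐ[ℂ] K) (_ : Function.Injective φ) (g : GL ι K),
      (∀ k, g.1 k o = φ (MvPolynomial.X k)) → f.toFun K g = φ P)
    (φ ψ : MvPolynomial ι ℂ →ₐ[ℂ] K) (hφ : Function.Injective φ) (hψ : Function.Injective ψ)
    (t : K) (ht : t ≠ 0) (h : ∀ k, φ (MvPolynomial.X k) = t * ψ (MvPolynomial.X k)) :
    φ P = t * ψ P := by
  obtain ⟨g, hg⟩ := exists_col_eq o o (fun k => ψ (MvPolynomial.X k))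
    ((map_ne_zero_iff ψ hψ).2 (MvPolynomial.X_ne_zero o)).isUnit
  obtain ⟨g', hg'⟩ := exists_mul_of_isUnit_det g (q := diagonal (Function.update 1 o t))
    (by simp [det_diagonal, Finset.prod_update_of_mem, ht])
  rw [← hP ψ hψ g hg, ← hP φ hφ g' fun k => by
    rw [hg', mul_diagonal, hg, Function.update_self, h, mul_comm]]
  rw [hs K g g' _ hg', Function.update_self]

/-- Over the fraction field of `ℂ[X][t]`, both the generic column and its multiple by `t` have
algebraically independent entries. Comparing `f` at the two yields `P(tX) = tP(X)`. -/
theorem exists_linear_generic {f : GLFunction ι} {o : ι} (hs : f.ScalesAt o)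
    (hc : ∀ i j, i ≠ j → j ≠ o → f.ColInvariant i j) [Nontrivial ι] :
    ∃ l : ι → ℂ, ∀ (K : Type) [Field K] [Algebra ℂ K] (φ : MvPolynomial ι ℂ →ₐ[ℂ] K)
      (_ : Function.Injective φ) (g : GL ι K), (∀ k, g.1 k o = φ (MvPolynomial.X k)) →
      f.toFun K g = ∑ k, algebraMap ℂ K (l k) * g.1 k o := by
  obtain ⟨P, hP⟩ := exists_polynomial hs hc
  have h₄ : MvPolynomial.aeval (fun k => Polynomial.X * Polynomial.C (MvPolynomial.X k :
      MvPolynomial ι ℂ)) P = Polynomial.X * Polynomial.C P := by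
    let T := Polynomial (MvPolynomial ι ℂ)
    let i : T →ₐ[ℂ] FractionRing T := IsScalarTower.toAlgHom ℂ T (FractionRing T)
    have hi : Function.Injective i := IsFractionRing.injective T (FractionRing T)
    let α : MvPolynomial ι ℂ →ₐ[ℂ] T :=
      MvPolynomial.aeval fun k => Polynomial.X * Polynomial.C (MvPolynomial.X k)
    -- Setting `t = 1` is a left inverse.
    have hα : Function.Injective α := by
      have : ((Polynomial.aeval (1 : MvPolynomial ι ℂ)).restrictScalars ℂ).comp α =
          AlgHom.id ℂ (MvPolynomial ι ℂ) := by
        refine MvPolynomial.algHom_ext fun k => ?_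
        have h₁ : α (MvPolynomial.X k) = Polynomial.X * Polynomial.C (MvPolynomial.X k) :=
          MvPolynomial.aeval_X _ _
        change Polynomial.aeval (1 : MvPolynomial ι ℂ) (α (MvPolynomial.X k)) = MvPolynomial.X k
        rw [h₁, map_mul, Polynomial.aeval_X, Polynomial.aeval_C, one_mul]
        rfl
      exact Function.LeftInverse.injective
        (g := ((Polynomial.aeval (1 : MvPolynomial ι ℂ)).restrictScalars ℂ))
        fun s => DFunLike.congr_fun this s
    refine hi ?_
    rw [map_mul]
    refine map_eq_mul_of_scales hs (hP (FractionRing T)) (i.comp α) (i.comp Polynomial.CAlgHom)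
      (hi.comp hα) (hi.comp Polynomial.C_injective) (i Polynomial.X)
      ((map_ne_zero_iff i hi).2 Polynomial.X_ne_zero) fun k => ?_
    change i (α (MvPolynomial.X k)) = i Polynomial.X * i (Polynomial.C _)
    rw [← map_mul]
    exact congrArg i (MvPolynomial.aeval_X _ _)
  obtain ⟨l, hl⟩ := MvPolynomial.eq_linear_of_homogeneous P h₄
  refine ⟨l, fun K _ _ φ hφ g hg => ?_⟩
  rw [hP K φ hφ g hg, hl, map_sum]
  refine Finset.sum_congr rfl fun k _ => ?_
  rw [map_mul, hg, ← MvPolynomial.algebraMap_eq, AlgHom.commutes]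

/-- The formula is checked for the universal invertible matrix, whose coordinate ring embeds in a
field where its column is generic. Every other invertible matrix is a specialization of this one. -/
theorem exists_linear {f : GLFunction ι} {o : ι} (hs : f.ScalesAt o)
    (hc : ∀ i j, i ≠ j → j ≠ o → f.ColInvariant i j) [Nontrivial ι] :
    ∃ l : ι → ℂ, ∀ (A : Type) [CommRing A] [Algebra ℂ A] (g : GL ι A),
      f.toFun A g = ∑ k, algebraMap ℂ A (l k) * g.1 k o := by
  obtain ⟨l, hl⟩ := exists_linear_generic hs hc
  refine ⟨l, ?_⟩
  let S := MvPolynomial (ι × ι) ℂ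
  let d : S := (mvPolynomialX ι ι ℂ).det
  have hd : d ≠ 0 := det_mvPolynomialX_ne_zero ι ℂ
  let L := Localization.Away d
  have hle : Submonoid.powers d ≤ nonZeroDivisors S :=
    powers_le_nonZeroDivisors_of_noZeroDivisors hd
  have : IsDomain L := IsLocalization.isDomain_localization hle
  have hSL : Function.Injective (algebraMap S L) := IsLocalization.injective L hle
  let φ : MvPolynomial ι ℂ →ₐ[ℂ] FractionRing L :=
    (IsScalarTower.toAlgHom ℂ L (FractionRing L)).comp
      ((IsScalarTower.toAlgHom ℂ S L).comp (MvPolynomial.rename fun k => (k, o)))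
  have hφ : Function.Injective φ :=
    (IsFractionRing.injective L (FractionRing L)).comp
      (hSL.comp (MvPolynomial.rename_injective _ fun a b h => congrArg Prod.fst h))
  let G : GL ι L := GeneralLinearGroup.mk'' ((mvPolynomialX ι ι ℂ).map (algebraMap S L)) (by
    rw [← RingHom.mapMatrix_apply, ← RingHom.map_det]
    exact IsLocalization.Away.algebraMap_isUnit d)
  have hG : ∀ k m, G.1 k m = algebraMap S L (MvPolynomial.X (k, m)) := fun k m => rfl
  have h₁ : f.toFun L G = ∑ k, algebraMap ℂ L (l k) * G.1 k o := by
    apply IsFractionRing.injective L (FractionRing L)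
    have := hl (FractionRing L) φ hφ (GeneralLinearGroup.map
      (IsScalarTower.toAlgHom ℂ L (FractionRing L)).toRingHom G) (fun k => by
        change algebraMap L (FractionRing L) (G.1 k o) = _
        rw [hG]
        exact congrArg (fun s => algebraMap L (FractionRing L) (algebraMap S L s))
          (MvPolynomial.rename_X (fun k => (k, o)) k).symm)
    rw [f.natural] at this
    refine this.trans ?_
    rw [map_sum]
    refine Finset.sum_congr rfl fun k _ => ?_
    rw [map_mul, ← IsScalarTower.algebraMap_apply]
    rfl
  intro A _ _ g
  have hdet : MvPolynomial.aeval (fun p : ι × ι => g.1 p.1 p.2) d = g.1.det := by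
    rw [AlgHom.map_det]
    congr 1
    ext
    simp [mvPolynomialX]
  obtain ⟨ψ, hψ⟩ := exists_algHom_away d (MvPolynomial.aeval fun p : ι × ι => g.1 p.1 p.2)
    (by rw [hdet]; exact (Matrix.isUnit_iff_isUnit_det _).1 g.isUnit)
  have hGg : ∀ k m, g.1 k m = ψ (G.1 k m) := fun k m => by rw [hG, hψ, MvPolynomial.aeval_X]
  rw [f.natural_of_map_eq ψ G g (Matrix.ext hGg), h₁, map_sum]
  refine Finset.sum_congr rfl fun k _ => ?_
  rw [map_mul, AlgHom.commutes, hGg]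

end GLFunction

/-! ### Subbundles spanned by part of a basis -/

theorem extendSub_span {A B : Type} [CommRing A] [CommRing B] {φ : A →+* B} {M N : Type}
    [AddCommGroup M] [Module A M] [AddCommGroup N] [Module B N] (g : M →ₛₗ[φ] N) (S : Set M) :
    extendSub g (Submodule.span A S) = Submodule.span B (g '' S) := by
  refine le_antisymm (Submodule.span_le.2 ?_) (Submodule.span_mono (Set.image_mono
    Submodule.subset_span))
  rintro _ ⟨x, hx, rfl⟩
  induction hx using Submodule.span_induction with
  | mem _ h => exact Submodule.subset_span ⟨_, h, rfl⟩
  | zero => rw [map_zero]; exact zero_mem _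
  | add a b _ _ ha hb => rw [map_add]; exact add_mem ha hb
  | smul s a _ ha => rw [LinearMap.map_smulₛₗ]; exact Submodule.smul_mem _ _ ha

theorem projective_quotient_of_retraction {A M : Type} [CommRing A] [AddCommGroup M] [Module A M]
    [Module.Projective A M] {L : Submodule A M} (p : M →ₗ[A] L) (hp : ∀ x : L, p x = x) :
    Module.Projective A (M ⧸ L) := by
  refine Module.Projective.of_split (L.liftQ (LinearMap.id - L.subtype ∘ₗ p) ?_) L.mkQ ?_
  · intro x hx
    simpa [sub_eq_zero] using (congrArg Subtype.val (hp ⟨x, hx⟩)).symm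
  · ext x
    simp

theorem isSubbundle_span_basis {A M ι : Type} [CommRing A] [AddCommGroup M] [Module A M]
    (b : Module.Basis ι A M) (J : Set ι) [Finite J] :
    IsSubbundle (Nat.card J) (Submodule.span A (b '' J)) := by
  classical
  have := Module.Projective.of_basis b
  have hmem : ∀ i ∈ J, b i ∈ Submodule.span A (b '' J) := fun i hi =>
    Submodule.subset_span ⟨i, hi, rfl⟩
  let p : M →ₗ[A] Submodule.span A (b '' J) :=
    b.constr A fun i => if hi : i ∈ J then ⟨b i, hmem i hi⟩ else 0
  refine ⟨projective_quotient_of_retraction p ?_, fun P => ?_⟩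
  · have h : ∀ x ∈ Submodule.span A (b '' J), (p x : M) = x := by
      intro x hx
      induction hx using Submodule.span_induction with
      | mem _ h =>
        obtain ⟨i, hi, rfl⟩ := h
        simp [p, hi]
      | zero => simp
      | add a b _ _ ha hb => simp [ha, hb]
      | smul s a _ ha => simp [ha]
    exact fun x => Subtype.ext (h x x.2)
  · have := P.nontrivial
    have := Fintype.ofFinite J
    have hr : b '' J = Set.range (fun i : J => b i) := by
      ext; simp
    have hli : LinearIndependent A (fun i : J => b i) :=
      b.linearIndependent.comp _ Subtype.val_injective
    rw [hr]
    have := Module.Free.of_basis (Module.Basis.span hli)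
    rw [Module.rankAtStalk_eq_finrank_of_free]
    simp [Module.finrank_eq_card_basis (Module.Basis.span hli)]

/-! ### Points of flag varieties given by invertible matrices -/

section flPoint

variable {n : ℕ} {A : Type} [CommRing A]

/-- The columns of an invertible matrix. -/
def colVec (g : GL (Fin n) A) (j : Fin n) : Fin n → A := fun i => g.1 i j

/-- The span of the first `k` columns of a matrix. -/
def colSpan (k : ℕ) (g : GL (Fin n) A) : Submodule A (Fin n → A) :=
  Submodule.span A (colVec g '' {j | j.1 < k})

theorem col_mem_colSpan {k : ℕ} (g : GL (Fin n) A) {j : Fin n} (hj : j.1 < k) :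
    colVec g j ∈ colSpan k g := Submodule.subset_span ⟨j, hj, rfl⟩

/-- The basis of columns of an invertible matrix. -/
def colBasis (g : GL (Fin n) A) : Module.Basis (Fin n) A (Fin n → A) :=
  (Pi.basisFun A (Fin n)).map (Matrix.toLin'OfInv g.inv_mul g.mul_inv)

theorem colBasis_apply (g : GL (Fin n) A) (j : Fin n) : colBasis g j = colVec g j := by
  ext i
  simp [colBasis, colVec]

theorem isSubbundle_colSpan {k : ℕ} (hk : k ≤ n) (g : GL (Fin n) A) :
    IsSubbundle k (colSpan k g) := by
  have h := isSubbundle_span_basis (colBasis g) {j : Fin n | j.1 < k}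
  have hc : Nat.card {j : Fin n | j.1 < k} = k := by
    simp [Fin.card_filter_val_lt, hk]
  rw [hc] at h
  convert h using 1
  simp only [colSpan]
  congr 1
  ext v
  simp [colBasis_apply]

theorem colSpan_le_of_transvection {k : ℕ} {i j : Fin n} (h : j.1 < k → i.1 < k) (c : A)
    {g g' : GL (Fin n) A} (hg : g'.1 = g.1 * transvection i j c) : colSpan k g' ≤ colSpan k g := by
  refine Submodule.span_le.2 ?_
  rintro _ ⟨l, hl, rfl⟩
  by_cases hlj : l = j
  · subst hlj
    have : colVec g' l = colVec g l + c • colVec g i := by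
      ext a
      simp [colVec, hg, mul_transvection_apply_same]
    rw [this]
    exact add_mem (col_mem_colSpan g hl) (Submodule.smul_mem _ _ (col_mem_colSpan g (h hl)))
  · have : colVec g' l = colVec g l := by
      ext a
      simp [colVec, hg, mul_transvection_apply_of_ne, hlj]
    rw [this]
    exact col_mem_colSpan g hl

/-- The condition on the indices describes the column operations in the parabolic subgroup that
stabilizes the span of the first `k` columns. -/
theorem colSpan_transvection {k : ℕ} {i j : Fin n} (hij : i ≠ j) (h : j.1 < k → i.1 < k) (c : A)
    {g g' : GL (Fin n) A} (hg : g'.1 = g.1 * transvection i j c) : colSpan k g' = colSpan k g := by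
  refine le_antisymm (colSpan_le_of_transvection h c hg)
    (colSpan_le_of_transvection h (-c) ?_)
  rw [hg, mul_assoc, transvection_mul_transvection_same _ _ hij, add_neg_cancel,
    transvection_zero, mul_one]

theorem isUnit_of_mul_diagonal {d : Fin n → A} {g g' : GL (Fin n) A}
    (hg : g'.1 = g.1 * diagonal d) (i : Fin n) : IsUnit (d i) := by
  have h : IsUnit (diagonal d).det := by
    rw [← Matrix.isUnit_iff_isUnit_det]
    have : diagonal d = (g⁻¹ * g' : GL (Fin n) A).1 := by simp [hg]
    rw [this]
    exact Units.isUnit _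
  rw [det_diagonal] at h
  exact isUnit_of_dvd_unit (Finset.dvd_prod_of_mem d (Finset.mem_univ i)) h

theorem colSpan_diagonal (k : ℕ) {d : Fin n → A} {g g' : GL (Fin n) A}
    (hg : g'.1 = g.1 * diagonal d) : colSpan k g' = colSpan k g := by
  have e : ∀ l, colVec g' l = d l • colVec g l := fun l => by
    ext a
    simp [colVec, hg, mul_comm]
  refine le_antisymm (Submodule.span_le.2 ?_) (Submodule.span_le.2 ?_)
  · rintro _ ⟨l, hl, rfl⟩
    rw [e]
    exact Submodule.smul_mem _ _ (col_mem_colSpan g hl)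
  · rintro _ ⟨l, hl, rfl⟩
    obtain ⟨u, hu⟩ := isUnit_of_mul_diagonal hg l
    have : colVec g l = (↑u⁻¹ : A) • colVec g' l := by
      rw [e, ← hu, smul_smul, Units.inv_mul, one_smul]
    rw [this]
    exact Submodule.smul_mem _ _ (col_mem_colSpan g' hl)

end flPoint

/-- The point of `Gr(k, n)` given by the first `k` columns of an invertible matrix. -/
def grPoint {n k : ℕ} (hk : k ≤ n) {A : CommAlgCat.{0} ℂ} (g : GL (Fin n) A) :
    GrPoint k (VectBundle.trivial pt n) A where
  base := PUnit.unit
  sub := colSpan k g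
  isSubbundle := isSubbundle_colSpan hk g

/-- The flag given by the columns of an invertible matrix. -/
def flPoint {n k₁ k₂ : ℕ} (h₁ : k₁ ≤ k₂) (h₂ : k₂ ≤ n) {A : CommAlgCat.{0} ℂ} (g : GL (Fin n) A) :
    (Fl k₁ k₂ n).obj A :=
  ⟨(grPoint (h₁.trans h₂) g, grPoint h₂ g),
    Submodule.span_mono (Set.image_mono fun _ h => lt_of_lt_of_le h h₁)⟩

/-- A point of the Grassmannian is a submodule. -/
theorem GrPoint.trivial_ext {n k : ℕ} {A : CommAlgCat.{0} ℂ}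
    {p q : GrPoint k (VectBundle.trivial pt n) A}
    (h : (p.sub : Submodule A (Fin n → A)) = q.sub) : p = q := by
  obtain ⟨⟨⟩, S, hS⟩ := p
  obtain ⟨⟨⟩, T, hT⟩ := q
  obtain rfl : S = T := h
  rfl

theorem Fl.ext {n k₁ k₂ : ℕ} {A : CommAlgCat.{0} ℂ} {x y : (Fl k₁ k₂ n).obj A}
    (h₁ : (x.1.1.sub : Submodule A (Fin n → A)) = y.1.1.sub)
    (h₂ : (x.1.2.sub : Submodule A (Fin n → A)) = y.1.2.sub) : x = y :=
  Subtype.ext (Prod.ext (GrPoint.trivial_ext h₁) (GrPoint.trivial_ext h₂))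

theorem grPoint_map {n k : ℕ} (hk : k ≤ n) {A B : CommAlgCat.{0} ℂ} (f : A ⟶ B)
    (g : GL (Fin n) A) :
    (grPoint hk g).map f = grPoint hk (GeneralLinearGroup.map f.hom.toRingHom g) := by
  refine GrPoint.trivial_ext ?_
  refine (extendSub_span _ _).trans ?_
  change _ = Submodule.span B _
  congr 1
  exact Set.image_image (f := colVec g) (g := fun (v : Fin n → A) i => f.hom (v i)) _

theorem flPoint_map {n k₁ k₂ : ℕ} (h₁ : k₁ ≤ k₂) (h₂ : k₂ ≤ n) {A B : CommAlgCat.{0} ℂ}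
    (f : A ⟶ B) (g : GL (Fin n) A) :
    (Fl k₁ k₂ n).map f (flPoint h₁ h₂ g) =
      flPoint h₁ h₂ (GeneralLinearGroup.map f.hom.toRingHom g) :=
  Subtype.ext (Prod.ext (grPoint_map (h₁.trans h₂) f g) (grPoint_map h₂ f g))

/-! ### Reduction to local rings -/

/-- The fibre is projective, so `v` is determined by finitely many coordinates in `A`, and an
element of `A` that vanishes in every localization at a maximal ideal is zero. -/
theorem VectBundle.eq_zero_of_local {X : CSpace} (E : VectBundle X)
    {A : CommAlgCat.{0} ℂ} {x : X.obj A} (v : E.fib x)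
    (h : ∀ (B : CommAlgCat.{0} ℂ), IsLocalRing B → ∀ f : A ⟶ B,
      E.tr f (y := X.map f x) rfl v = 0) : v = 0 := by
  have gen : ∀ (B : CommAlgCat.{0} ℂ) (f : A ⟶ B), E.tr f (y := X.map f x) rfl v = 0 →
      ∀ c : Module.Dual A (E.fib x), f.hom (c v) = 0 := by
    intro B f hB c
    have := dualExt_apply (E.isExtension f (x := x) rfl) c v
    rw [hB, map_zero] at this
    exact this.symm
  -- Base change along the identity serves only to produce a dual frame of the fibre.
  obtain ⟨r, m, c, -, hm, -, -⟩ := (E.isExtension (𝟙 A) (x := x) rfl).exists_frame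
  rw [← hm v]
  refine Finset.sum_eq_zero fun i _ => ?_
  have : c i v = 0 := eq_zero_of_localization _ fun J hJ =>
    gen (CommAlgCat.of ℂ (Localization.AtPrime J))
      (CommAlgCat.ofHom (IsScalarTower.toAlgHom ℂ A (Localization.AtPrime J)))
      (h _ (inferInstanceAs (IsLocalRing (Localization.AtPrime J))) _) (c i)
  rw [this, zero_smul]

theorem VectBundle.globalSections_ext {X : CSpace} {E : VectBundle X} {s t : E.globalSections}
    (h : ∀ (A : CommAlgCat.{0} ℂ), IsLocalRing A → ∀ x : X.obj A, s.1 A x = t.1 A x) : s = t := by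
  refine Subtype.ext (funext fun A => funext fun x => ?_)
  rw [← sub_eq_zero]
  refine E.eq_zero_of_local _ fun B hB f => ?_
  rw [map_sub, s.2 A B f x _ rfl, t.2 A B f x _ rfl, h B hB, sub_self]

section IsLocalRing

variable {A M : Type} [CommRing A] [IsLocalRing A] [AddCommGroup M] [Module A M] [Module.Finite A M]

theorem IsSubbundle.exists_basis [Module.Projective A M] {k : ℕ} {L : Submodule A M}
    (h : IsSubbundle k L) : Nonempty (Module.Basis (Fin k) A L) := by
  obtain ⟨_, _⟩ := h.finite_projective
  have : Module.Free A L := Module.free_of_flat_of_isLocalRing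
  have hr : Module.finrank A L = k := by
    have h₁ := h.rank_eq (IsLocalRing.closedPoint A)
    rw [Module.rankAtStalk_eq_finrank_of_free] at h₁
    simpa using h₁
  exact ⟨Module.finBasisOfFinrankEq A L hr⟩

/-- Over a local ring the projective quotient is free, so a basis of it lifts and completes the
given basis of `L`. -/
theorem exists_basis_extending {k m : ℕ} {L : Submodule A M} [Module.Projective A (M ⧸ L)]
    (b : Module.Basis (Fin k) A L) (b' : Module.Basis (Fin m) A M) :
    ∃ (h : k ≤ m) (c : Module.Basis (Fin m) A M), ∀ i, c (Fin.castLE h i) = b i := by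
  have : Module.Free A (M ⧸ L) := Module.free_of_flat_of_isLocalRing
  let q := Module.finBasis A (M ⧸ L)
  let c := (b.sumQuot q).reindex finSumFinEquiv
  have hm : k + Module.finrank A (M ⧸ L) = m := by
    simpa using (Module.finrank_eq_card_basis c).symm.trans (Module.finrank_eq_card_basis b')
  refine ⟨by omega, c.reindex (finCongr hm), fun i => ?_⟩
  have : (finCongr hm).symm (Fin.castLE (by omega) i) = Fin.castAdd _ i := by
    ext; simp
  rw [Module.Basis.reindex_apply, this]
  simp [c]

end IsLocalRing

theorem span_basis_castLE {A M : Type} [CommRing A] [AddCommGroup M] [Module A M] {k m : ℕ}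
    (h : k ≤ m) {L : Submodule A M} (b : Module.Basis (Fin k) A L) (c : Fin m → M)
    (hc : ∀ i, c (Fin.castLE h i) = b i) : Submodule.span A (c '' {j | j.1 < k}) = L := by
  have : c '' {j | j.1 < k} = L.subtype '' Set.range b := by
    ext v
    constructor
    · rintro ⟨j, hj, rfl⟩
      exact ⟨_, ⟨⟨j, hj⟩, rfl⟩, (hc ⟨j, hj⟩).symm⟩
    · rintro ⟨_, ⟨i, rfl⟩, rfl⟩
      exact ⟨Fin.castLE h i, i.2, hc i⟩
  rw [this, Submodule.span_image, b.span_eq, Submodule.map_top, Submodule.range_subtype]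

/-- A basis of `V₁` is extended to `V₂` and then to `Aⁿ`; the resulting vectors are the columns of
the matrix. -/
theorem exists_flPoint_eq {n k₁ k₂ : ℕ} (h₁ : k₁ ≤ k₂) (h₂ : k₂ ≤ n) {A : CommAlgCat.{0} ℂ}
    [IsLocalRing A] (x : (Fl k₁ k₂ n).obj A) : ∃ g : GL (Fin n) A, x = flPoint h₁ h₂ g := by
  let V₁ : Submodule A (Fin n → A) := x.1.1.sub
  let V₂ : Submodule A (Fin n → A) := x.1.2.sub
  have hV₁ : IsSubbundle k₁ V₁ := x.1.1.isSubbundle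
  have hV₂ : IsSubbundle k₂ V₂ := x.1.2.isSubbundle
  have hV : V₁ ≤ V₂ := x.2
  have := hV₁.projective_quotient
  have := hV₂.projective_quotient
  obtain ⟨_, _⟩ := hV₂.finite_projective
  obtain ⟨b₁⟩ := hV₁.exists_basis
  obtain ⟨b₂⟩ := hV₂.exists_basis
  let W : Submodule A V₂ := V₁.submoduleOf V₂
  let e : W ≃ₗ[A] V₁ := Submodule.submoduleOfEquivOfLe hV
  -- A retraction of `Aⁿ` onto `V₁` restricts to `V₂`, so `V₁` is also a direct summand of `V₂`.
  have : Module.Projective A (V₂ ⧸ W) := by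
    obtain ⟨p, hp⟩ := exists_retraction V₁
    refine projective_quotient_of_retraction (e.symm ∘ₗ p ∘ₗ V₂.subtype) fun x => ?_
    have : p x.1.1 = e x := hp (e x)
    simp [this]
  obtain ⟨_, c₂, hc₂⟩ := exists_basis_extending (b₁.map e.symm) b₂
  obtain ⟨_, c, hc⟩ := exists_basis_extending c₂ (Pi.basisFun A (Fin n))
  let g : GL (Fin n) A := ⟨(Pi.basisFun A (Fin n)).toMatrix c, c.toMatrix (Pi.basisFun A (Fin n)),
    Module.Basis.toMatrix_mul_toMatrix_flip _ _, Module.Basis.toMatrix_mul_toMatrix_flip _ _⟩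
  have hg : ∀ j, colVec g j = c j := fun j => rfl
  refine ⟨g, Fl.ext (span_basis_castLE (h₁.trans h₂) b₁ (colVec g) fun i => ?_).symm
    (span_basis_castLE h₂ c₂ (colVec g) fun i => hc i).symm⟩
  exact (hc (Fin.castLE h₁ i)).trans (congrArg Subtype.val (hc₂ i))

namespace GLFunction

variable {ι : Type} [Fintype ι] [DecidableEq ι]

/-- A regular function on `GL_ι` from its values on bundled algebras. -/
def ofBundled (F : ∀ A : CommAlgCat.{0} ℂ, GL ι A → A)
    (h : ∀ {A B : CommAlgCat.{0} ℂ} (f : A ⟶ B) (g : GL ι A),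
      F B (GeneralLinearGroup.map f.hom.toRingHom g) = f.hom (F A g)) : GLFunction ι where
  toFun A _ _ g := F (CommAlgCat.of ℂ A) g
  natural φ g := h (CommAlgCat.ofHom φ) g

theorem scalesAt_of_bundled {f : GLFunction ι} {o : ι}
    (hs : ∀ (A : CommAlgCat.{0} ℂ) (g g' : GL ι A) (d : ι → A),
      g'.1 = g.1 * diagonal d → f.toFun A g' = d o * f.toFun A g) : f.ScalesAt o :=
  fun A _ _ => hs (CommAlgCat.of ℂ A)

theorem colInvariant_of_bundled {f : GLFunction ι} {i j : ι}
    (hs : ∀ (A : CommAlgCat.{0} ℂ) (g g' : GL ι A) (c : A),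
      g'.1 = g.1 * transvection i j c → f.toFun A g' = f.toFun A g) : f.ColInvariant i j :=
  fun A _ _ => hs (CommAlgCat.of ℂ A)

end GLFunction

/-! ### Genericity as a nonzero coordinate, and complex linear forms -/

theorem HoldsForGeneral.of_linearEquiv {V : Type*} [AddCommGroup V] [Module ℂ V] {n : ℕ}
    (e : (Fin n → ℂ) ≃ₗ[ℂ] V) {P : V → Prop} (i : Fin n) (h : ∀ l, l i ≠ 0 → P (e l)) :
    HoldsForGeneral P := by
  refine ⟨n, Module.Basis.ofEquivFun e.symm, MvPolynomial.X i, MvPolynomial.X_ne_zero i,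
    fun v hv => ?_⟩
  have := h (e.symm v) (by simpa using hv)
  simpa using this

/-- The linear form on `Aⁿ` with given complex coefficients. -/
def linForm {n : ℕ} (l : Fin n → ℂ) (A : CommAlgCat.{0} ℂ) : (Fin n → A) →ₗ[A] A :=
  ∑ i, algebraMap ℂ A (l i) • LinearMap.proj i

theorem linForm_apply {n : ℕ} (l : Fin n → ℂ) (A : CommAlgCat.{0} ℂ) (v : Fin n → A) :
    linForm l A v = ∑ i, algebraMap ℂ A (l i) * v i := by
  simp [linForm, Algebra.smul_def]

theorem linForm_map {n : ℕ} (l : Fin n → ℂ) {A B : CommAlgCat.{0} ℂ} (f : A ⟶ B) (v : Fin n → A) :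
    linForm l B (fun i => f.hom (v i)) = f.hom (linForm l A v) := by
  simp only [linForm_apply, map_sum, map_mul]
  refine Finset.sum_congr rfl fun i _ => ?_
  rw [AlgHom.commutes]

theorem linForm_add {n : ℕ} (l l' : Fin n → ℂ) (A : CommAlgCat.{0} ℂ) (v : Fin n → A) :
    linForm (l + l') A v = linForm l A v + linForm l' A v := by
  simp only [linForm_apply, Pi.add_apply, map_add, add_mul, Finset.sum_add_distrib]

theorem linForm_smul {n : ℕ} (c : ℂ) (l : Fin n → ℂ) (A : CommAlgCat.{0} ℂ) (v : Fin n → A) :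
    linForm (c • l) A v = algebraMap ℂ A c * linForm l A v := by
  simp only [linForm_apply, Pi.smul_apply, smul_eq_mul, map_mul, mul_assoc, Finset.mul_sum]

/-! ### Global sections of `𝒰₁^∨` -/

section sectionsU

variable {n k₁ k₂ : ℕ}

/-- The restriction to `𝒰₁` of a linear form on `ℂⁿ`. -/
def secU (k₁ k₂ n : ℕ) : (Fin n → ℂ) →ₗ[ℂ] (flU₁ k₁ k₂ n).dual.globalSections where
  toFun l := ⟨fun A x => (linForm l A).comp x.1.1.sub.subtype, by
    intro A B f x y h
    refine ((flU₁ k₁ k₂ n).isExtension f h).hom_ext fun v => ?_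
    exact (dualExt_apply ((flU₁ k₁ k₂ n).isExtension f h)
      ((linForm l A).comp x.1.1.sub.subtype) v).trans (linForm_map l f v.1).symm⟩
  map_add' l l' :=
    Subtype.ext (funext fun A => funext fun x => LinearMap.ext fun v => linForm_add l l' A v.1)
  map_smul' c l :=
    Subtype.ext (funext fun A => funext fun x => LinearMap.ext fun v => linForm_smul c l A v.1)

/-- The first subspace of a flag. -/
abbrev flSub₁ {A : CommAlgCat.{0} ℂ} (x : (Fl k₁ k₂ n).obj A) : Submodule A (Fin n → A) :=
  x.1.1.sub

/-- The second subspace of a flag. -/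
abbrev flSub₂ {A : CommAlgCat.{0} ℂ} (x : (Fl k₁ k₂ n).obj A) : Submodule A (Fin n → A) :=
  x.1.2.sub

/-- A section of `𝒰₁^∨` as a linear form on the first subspace of a flag. -/
def formU (s : (flU₁ k₁ k₂ n).dual.globalSections) {A : CommAlgCat.{0} ℂ}
    (x : (Fl k₁ k₂ n).obj A) : flSub₁ x →ₗ[A] A :=
  s.1 A x

theorem formU_congr (s : (flU₁ k₁ k₂ n).dual.globalSections) {A : CommAlgCat.{0} ℂ}
    {x y : (Fl k₁ k₂ n).obj A} (h : x = y) (v : flSub₁ x) (w : flSub₁ y) (hvw : v.1 = w.1) :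
    formU s x v = formU s y w := by
  subst h
  exact congrArg _ (Subtype.ext hvw)

theorem formU_map (s : (flU₁ k₁ k₂ n).dual.globalSections) {A B : CommAlgCat.{0} ℂ} (f : A ⟶ B)
    {x : (Fl k₁ k₂ n).obj A} {y : (Fl k₁ k₂ n).obj B} (h : (Fl k₁ k₂ n).map f x = y)
    (v : flSub₁ x) (w : flSub₁ y) (hvw : w.1 = fun i => f.hom (v.1 i)) :
    formU s y w = f.hom (formU s x v) := by
  have h₁ := s.2 A B f x y h
  rw [formU, ← h₁]
  obtain rfl : w = (flU₁ k₁ k₂ n).tr f h v := Subtype.ext hvw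
  exact dualExt_apply ((flU₁ k₁ k₂ n).isExtension f h) (s.1 A x) v

section

variable (h₁ : k₁ ≤ k₂) (h₂ : k₂ ≤ n)

/-- A column vector as an element of the first subspace of a flag. -/
def colU {A : CommAlgCat.{0} ℂ} (g : GL (Fin n) A) {o : Fin n} (ho : o.1 < k₁) :
    flSub₁ (flPoint h₁ h₂ g) :=
  ⟨colVec g o, col_mem_colSpan g ho⟩

/-- The value of a section of `𝒰₁^∨` at the `o`-th column vector of a matrix. -/
def colFunctionU (s : (flU₁ k₁ k₂ n).dual.globalSections) {o : Fin n} (ho : o.1 < k₁) :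
    GLFunction (Fin n) :=
  GLFunction.ofBundled (fun _ g => formU s (flPoint h₁ h₂ g) (colU h₁ h₂ g ho))
    fun f g => formU_map s f (flPoint_map h₁ h₂ f g) _ _ rfl

theorem colFunctionU_scalesAt (s : (flU₁ k₁ k₂ n).dual.globalSections) {o : Fin n}
    (ho : o.1 < k₁) : (colFunctionU h₁ h₂ s ho).ScalesAt o := by
  refine GLFunction.scalesAt_of_bundled fun A g g' d hg => ?_
  have hp : flPoint h₁ h₂ g' = flPoint h₁ h₂ g :=
    Fl.ext (colSpan_diagonal k₁ hg) (colSpan_diagonal k₂ hg)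
  refine (formU_congr s hp _ (d o • colU h₁ h₂ g ho) ?_).trans
    (map_smul (formU s (flPoint h₁ h₂ g)) _ _)
  funext i
  change g'.1 i o = d o * g.1 i o
  simp [hg, mul_comm]

theorem colFunctionU_colInvariant (s : (flU₁ k₁ k₂ n).dual.globalSections) {o : Fin n}
    (ho : o.1 < k₁) {i j : Fin n} (hij : i ≠ j) (hj : j ≠ o) (hi₁ : j.1 < k₁ → i.1 < k₁)
    (hi₂ : j.1 < k₂ → i.1 < k₂) : (colFunctionU h₁ h₂ s ho).ColInvariant i j := by
  refine GLFunction.colInvariant_of_bundled fun A g g' c hg => ?_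
  have hp : flPoint h₁ h₂ g' = flPoint h₁ h₂ g :=
    Fl.ext (colSpan_transvection hij hi₁ c hg) (colSpan_transvection hij hi₂ c hg)
  refine formU_congr s hp _ _ ?_
  funext i
  change g'.1 i o = g.1 i o
  simp [hg, mul_transvection_apply_of_ne, hj.symm]

/-- The first column lies in `V₁` and yields the linear form. The other columns of `V₁` follow by
additivity, after adding them to the first. -/
theorem exists_formU_colU_eq (s : (flU₁ k₁ k₂ n).dual.globalSections) (hk₁ : 0 < k₁)
    (hn : 1 < n) :
    ∃ l : Fin n → ℂ, ∀ (A : CommAlgCat.{0} ℂ) (g : GL (Fin n) A) (j : Fin n) (hj : j.1 < k₁),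
      formU s (flPoint h₁ h₂ g) (colU h₁ h₂ g hj) = linForm l A (colVec g j) := by
  let o : Fin n := ⟨0, by omega⟩
  have ho : o.1 < k₁ := hk₁
  have : Nontrivial (Fin n) := Fin.nontrivial_iff_two_le.2 hn
  have hs := colFunctionU_scalesAt h₁ h₂ s ho
  have hup : ∀ i j : Fin n, i < j → j ≠ o →
      (colFunctionU h₁ h₂ s ho).ColInvariant i j := fun i j hij hj =>
    colFunctionU_colInvariant h₁ h₂ s _ hij.ne hj (by omega) (by omega)
  -- Adding an earlier column to a later one preserves the flag. The opposite operations need not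
  -- preserve it, and for them invariance comes from `GLFunction.ColInvariant.symm`.
  obtain ⟨l, hl⟩ := GLFunction.exists_linear hs fun i j hij hj => by
    by_cases hlt : i < j
    · exact hup i j hlt hj
    · have hji : j < i := lt_of_le_of_ne (not_lt.1 hlt) hij.symm
      have hi : i ≠ o := fun h => absurd (h ▸ hji : j < o) (Nat.not_lt_zero _)
      exact (hup j i hji hi).symm hij.symm hj hi hs
  have hl' : ∀ (A : CommAlgCat.{0} ℂ) (g : GL (Fin n) A),
      formU s (flPoint h₁ h₂ g) (colU h₁ h₂ g ho) = linForm l A (colVec g o) :=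
    fun A g => (hl A g).trans (linForm_apply l A _).symm
  refine ⟨l, fun A g j hj => ?_⟩
  by_cases hjo : j = o
  · subst hjo
    exact hl' A g
  -- Column `j` is added to the first column. Both lie in `V₁`, so the flag does not change.
  obtain ⟨g', hg'⟩ := GLFunction.exists_mul_transvection g hjo 1
  have e : colVec g' o = colVec g o + colVec g j := by
    ext i
    simp [colVec, hg', mul_transvection_apply_same]
  have hp : flPoint h₁ h₂ g' = flPoint h₁ h₂ g :=
    Fl.ext (colSpan_transvection hjo (fun _ => hj) 1 hg')
      (colSpan_transvection hjo (fun _ => hj.trans_le h₁) 1 hg')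
  have h := formU_congr s hp (colU h₁ h₂ g' ho) (colU h₁ h₂ g ho + colU h₁ h₂ g hj) e
  rw [map_add, hl', hl', e, map_add] at h
  exact (add_left_cancel h).symm

end

theorem secU_bijective (h₁ : k₁ ≤ k₂) (h₂ : k₂ ≤ n) (hk₁ : 0 < k₁) (hn : 1 < n) :
    Function.Bijective (secU k₁ k₂ n) := by
  constructor
  · rw [← LinearMap.ker_eq_bot, LinearMap.ker_eq_bot']
    intro l hl
    funext i
    let o : Fin n := ⟨0, by omega⟩
    -- A matrix over `ℂ` whose first column is the `i`-th basis vector reads off the coefficient `l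
    -- i`.
    obtain ⟨g, hg⟩ := GLFunction.exists_col_eq (A := CommAlgCat.of ℂ ℂ) o i (Pi.single i 1)
      (by simp)
    have h : formU (secU k₁ k₂ n l) (flPoint h₁ h₂ g) (colU h₁ h₂ g (o := o) hk₁) = 0 := by
      rw [hl]; rfl
    have h' : linForm l (CommAlgCat.of ℂ ℂ) (colVec g o) = 0 := h
    rw [linForm_apply] at h'
    simpa [colVec, hg, Pi.single_apply] using h'
  · intro s
    obtain ⟨l, hl⟩ := exists_formU_colU_eq h₁ h₂ s hk₁ hn
    refine ⟨l, VectBundle.globalSections_ext fun A _ x => ?_⟩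
    obtain ⟨g, rfl⟩ := exists_flPoint_eq h₁ h₂ x
    have key : ∀ v (hv : v ∈ colSpan k₁ g),
        linForm l A v = formU s (flPoint h₁ h₂ g) ⟨v, hv⟩ := by
      intro v hv
      induction hv using Submodule.span_induction with
      | mem _ h =>
        obtain ⟨j, hj, rfl⟩ := h
        exact (hl A g j hj).symm
      | zero => exact (map_zero _).trans (map_zero (formU s (flPoint h₁ h₂ g))).symm
      | add v w hv hw ihv ihw =>
        rw [map_add, ihv, ihw]
        exact (map_add (formU s (flPoint h₁ h₂ g)) ⟨v, hv⟩ ⟨w, hw⟩).symm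
      | smul c v hv ihv =>
        rw [map_smul, ihv]
        exact (map_smul (formU s (flPoint h₁ h₂ g)) c ⟨v, hv⟩).symm
    exact LinearMap.ext fun v => key v.1 v.2

end sectionsU

/-! ### Inverse transposes and dual bases -/

section contragredient

variable {n : ℕ} {A : Type} [CommRing A]

/-- The inverse transpose of an invertible matrix. -/
def contra (h : GL (Fin n) A) : GL (Fin n) A where
  val := (h⁻¹).1ᵀ
  inv := h.1ᵀ
  val_inv := by rw [← transpose_mul, h.mul_inv, transpose_one]
  inv_val := by rw [← transpose_mul, h.inv_mul, transpose_one]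

theorem contra_mul_transpose (h : GL (Fin n) A) : (contra h).1 * h.1ᵀ = 1 := (contra h).mul_inv

theorem transpose_mul_contra (h : GL (Fin n) A) : h.1ᵀ * (contra h).1 = 1 := (contra h).inv_mul

theorem contra_contra (h : GL (Fin n) A) : contra (contra h) = h :=
  Units.ext (transpose_transpose h.1)

theorem contra_map {B : Type} [CommRing B] (φ : A →+* B) (h : GL (Fin n) A) :
    contra (GeneralLinearGroup.map φ h) = GeneralLinearGroup.map φ (contra h) := by
  ext i j
  change ((GeneralLinearGroup.map φ h)⁻¹ : GL (Fin n) B).1 j i = φ ((h⁻¹ : GL (Fin n) A).1 j i)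
  rw [← map_inv]
  rfl

theorem colVec_dotProduct_contra (h : GL (Fin n) A) (i j : Fin n) :
    colVec h i ⬝ᵥ colVec (contra h) j = if i = j then 1 else 0 := by
  rw [← one_apply, ← transpose_mul_contra h]
  rfl

theorem sum_dotProduct_smul_contra (h : GL (Fin n) A) (w : Fin n → A) :
    ∑ j, (colVec h j ⬝ᵥ w) • colVec (contra h) j = w := by
  have : (contra h).1 *ᵥ (h.1ᵀ *ᵥ w) = w := by
    rw [mulVec_mulVec, contra_mul_transpose, one_mulVec]
  conv_rhs => rw [← this]
  ext i
  simp only [Finset.sum_apply, Pi.smul_apply, smul_eq_mul, mulVec, dotProduct]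
  exact Finset.sum_congr rfl fun j _ => mul_comm _ _

/-- Passing to the inverse transpose reverses the direction of column operations. This is why the
order of the indices is opposite in the arguments for `𝒬₂`. -/
theorem contra_mul_transvection {h h' : GL (Fin n) A} {i j : Fin n} (hij : i ≠ j) {c : A}
    (hh : h'.1 = h.1 * transvection i j c) :
    (contra h').1 = (contra h).1 * transvection j i (-c) := by
  have ht : (transvection i j c)ᵀ = transvection j i c := by
    simp [transvection]
  have : (contra h).1 * transvection j i (-c) * h'.1ᵀ = 1 := by
    rw [hh, transpose_mul, ht, mul_assoc, ← mul_assoc (transvection j i (-c)),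
      transvection_mul_transvection_same _ _ hij.symm, neg_add_cancel, transvection_zero, one_mul,
      contra_mul_transpose]
  calc (contra h').1 = (contra h).1 * transvection j i (-c) * h'.1ᵀ * (contra h').1 := by
        rw [this, one_mul]
    _ = _ := by rw [mul_assoc, transpose_mul_contra, mul_one]

theorem contra_mul_diagonal {h h' : GL (Fin n) A} {d : Fin n → A} (hh : h'.1 = h.1 * diagonal d) :
    (contra h).1 = (contra h').1 * diagonal d := by
  have : (contra h').1 * diagonal d * h.1ᵀ = 1 := by
    have := contra_mul_transpose h'
    rwa [hh, transpose_mul, diagonal_transpose, ← mul_assoc] at this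
  calc (contra h).1 = (contra h').1 * diagonal d * h.1ᵀ * (contra h).1 := by
        rw [this, one_mul]
    _ = _ := by rw [mul_assoc, transpose_mul_contra, mul_one]

/-- The columns of `h` and of `contra h` are dual bases, so the last columns of `h` are the
equations of the span of the first columns of `contra h`. -/
theorem mem_colSpan_contra_iff {k : ℕ} (h : GL (Fin n) A) (w : Fin n → A) :
    w ∈ colSpan k (contra h) ↔ ∀ j : Fin n, k ≤ j.1 → colVec h j ⬝ᵥ w = 0 := by
  constructor
  · intro hw j hj
    induction hw using Submodule.span_induction with
    | mem _ hx =>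
      obtain ⟨l, hl, rfl⟩ := hx
      rw [colVec_dotProduct_contra, if_neg]
      rintro rfl
      exact absurd hl (not_lt.2 hj)
    | zero => exact dotProduct_zero _
    | add v w _ _ hv hw => rw [dotProduct_add, hv, hw, add_zero]
    | smul c v _ hv => rw [dotProduct_smul, hv, smul_zero]
  · intro hw
    rw [← sum_dotProduct_smul_contra h w]
    refine Submodule.sum_mem _ fun j _ => ?_
    by_cases hj : j.1 < k
    · exact Submodule.smul_mem _ _ (col_mem_colSpan _ hj)
    · rw [hw j (not_lt.1 hj), zero_smul]
      exact zero_mem _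

end contragredient

/-- The vector of `Aⁿ` with given complex coordinates. -/
def constVec {n : ℕ} (v : Fin n → ℂ) (A : CommAlgCat.{0} ℂ) : Fin n → A :=
  fun i => algebraMap ℂ A (v i)

theorem dotProduct_constVec {n : ℕ} (v : Fin n → ℂ) (A : CommAlgCat.{0} ℂ) (w : Fin n → A) :
    w ⬝ᵥ constVec v A = linForm v A w := by
  rw [linForm_apply]
  exact Finset.sum_congr rfl fun i _ => mul_comm _ _

/-! ### Global sections of `𝒬₂` -/

section sectionsQ

variable {n k₁ k₂ : ℕ}

/-- The section of `𝒬₂` given by a vector of `ℂⁿ`. -/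
def secQ (k₁ k₂ n : ℕ) : (Fin n → ℂ) →ₗ[ℂ] (flQ₂ k₁ k₂ n).globalSections where
  toFun v := ⟨fun A x => Submodule.Quotient.mk (p := flSub₂ x) (constVec v A), by
    intro A B f x y h
    refine congrArg (Submodule.Quotient.mk (p := flSub₂ y)) (funext fun i => ?_)
    exact f.hom.commutes (v i)⟩
  map_add' v w := by
    refine Subtype.ext (funext fun A => funext fun x => ?_)
    refine congrArg (Submodule.Quotient.mk (p := flSub₂ x)) (funext fun i => ?_)
    exact map_add (algebraMap ℂ A) (v i) (w i)
  map_smul' c v := by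
    refine Subtype.ext (funext fun A => funext fun x => ?_)
    refine congrArg (Submodule.Quotient.mk (p := flSub₂ x)) (funext fun i => ?_)
    exact map_mul (algebraMap ℂ A) c (v i)

/-- The value of a section of `𝒬₂` at a flag, as an element of a quotient of `Aⁿ`. -/
def valueQ (s : (flQ₂ k₁ k₂ n).globalSections) {A : CommAlgCat.{0} ℂ}
    (x : (Fl k₁ k₂ n).obj A) : (Fin n → A) ⧸ flSub₂ x :=
  s.1 A x

/-- The pairing of a section of `𝒬₂` with a linear form that vanishes on the second subspace of
a flag. -/
def pairQ (s : (flQ₂ k₁ k₂ n).globalSections) {A : CommAlgCat.{0} ℂ}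
    (x : (Fl k₁ k₂ n).obj A) (c : Fin n → A) (hc : ∀ w ∈ flSub₂ x, c ⬝ᵥ w = 0) : A :=
  (flSub₂ x).liftQ (dotProductBilin A A c) hc (valueQ s x)

theorem pairQ_eq (s : (flQ₂ k₁ k₂ n).globalSections) {A : CommAlgCat.{0} ℂ}
    {x : (Fl k₁ k₂ n).obj A} {c : Fin n → A} (hc : ∀ w ∈ flSub₂ x, c ⬝ᵥ w = 0) {w : Fin n → A}
    (hw : valueQ s x = Submodule.Quotient.mk w) : pairQ s x c hc = c ⬝ᵥ w := by
  rw [pairQ, hw]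
  rfl

theorem pairQ_congr (s : (flQ₂ k₁ k₂ n).globalSections) {A : CommAlgCat.{0} ℂ}
    {x y : (Fl k₁ k₂ n).obj A} (h : x = y) {c d : Fin n → A}
    (hc : ∀ w ∈ flSub₂ x, c ⬝ᵥ w = 0) (hd : ∀ w ∈ flSub₂ y, d ⬝ᵥ w = 0) (hcd : c = d) :
    pairQ s x c hc = pairQ s y d hd := by
  subst h hcd
  rfl

theorem pairQ_map (s : (flQ₂ k₁ k₂ n).globalSections) {A B : CommAlgCat.{0} ℂ} (f : A ⟶ B)
    {x : (Fl k₁ k₂ n).obj A} {y : (Fl k₁ k₂ n).obj B} (h : (Fl k₁ k₂ n).map f x = y)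
    (c : Fin n → A) (hc : ∀ w ∈ flSub₂ x, c ⬝ᵥ w = 0) (d : Fin n → B)
    (hd : ∀ w ∈ flSub₂ y, d ⬝ᵥ w = 0) (hcd : d = fun i => f.hom (c i)) :
    pairQ s y d hd = f.hom (pairQ s x c hc) := by
  obtain ⟨w, hw⟩ := Submodule.Quotient.mk_surjective _ (valueQ s x)
  have hy : valueQ s y = Submodule.Quotient.mk fun i => f.hom (w i) := by
    rw [valueQ, ← s.2 A B f x y h]
    exact congrArg ((flQ₂ k₁ k₂ n).tr f h) hw.symm
  rw [pairQ_eq s hc hw.symm, pairQ_eq s hd hy, hcd]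
  simp [dotProduct]

section

variable (h₁ : k₁ ≤ k₂) (h₂ : k₂ ≤ n)

/-- The pairing of a section of `𝒬₂` with the `o`-th column vector of a matrix. -/
def colPairQ (s : (flQ₂ k₁ k₂ n).globalSections) {o : Fin n} (ho : k₂ ≤ o.1)
    {A : CommAlgCat.{0} ℂ} (h : GL (Fin n) A) : A :=
  pairQ s (flPoint h₁ h₂ (contra h)) (colVec h o)
    fun w hw => (mem_colSpan_contra_iff h w).1 hw o ho

/-- The pairing of a section of `𝒬₂` with the `o`-th column vector of a matrix, as a regular
function. -/
def colFunctionQ (s : (flQ₂ k₁ k₂ n).globalSections) {o : Fin n} (ho : k₂ ≤ o.1) :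
    GLFunction (Fin n) :=
  GLFunction.ofBundled (fun _ h => colPairQ h₁ h₂ s ho h) fun f h =>
    pairQ_map s f ((flPoint_map h₁ h₂ f (contra h)).trans (by rw [contra_map])) _ _ _ _ rfl

theorem colFunctionQ_scalesAt (s : (flQ₂ k₁ k₂ n).globalSections) {o : Fin n}
    (ho : k₂ ≤ o.1) : (colFunctionQ h₁ h₂ s ho).ScalesAt o := by
  refine GLFunction.scalesAt_of_bundled fun A h h' d hh => ?_
  have hp : flPoint h₁ h₂ (contra h') = flPoint h₁ h₂ (contra h) :=
    Fl.ext (colSpan_diagonal k₁ (contra_mul_diagonal hh)).symm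
      (colSpan_diagonal k₂ (contra_mul_diagonal hh)).symm
  have e : colVec h' o = d o • colVec h o := by
    ext i
    simp [colVec, hh, mul_comm]
  have hz : ∀ w ∈ flSub₂ (flPoint h₁ h₂ (contra h)), colVec h o ⬝ᵥ w = 0 :=
    fun w hw => (mem_colSpan_contra_iff h w).1 hw o ho
  refine (pairQ_congr s hp _ (d := d o • colVec h o) (fun w hw => ?_) e).trans ?_
  · rw [smul_dotProduct, hz w hw, smul_zero]
  · obtain ⟨w, hw⟩ := Submodule.Quotient.mk_surjective _ (valueQ s (flPoint h₁ h₂ (contra h)))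
    rw [pairQ_eq s _ hw.symm, smul_dotProduct, ← pairQ_eq s hz hw.symm]
    rfl

theorem flPoint_contra_mul_transvection {A : CommAlgCat.{0} ℂ} {i j : Fin n} (hij : i ≠ j)
    (hi₁ : i.1 < k₁ → j.1 < k₁) (hi₂ : i.1 < k₂ → j.1 < k₂) {h h' : GL (Fin n) A} {c : A}
    (hh : h'.1 = h.1 * transvection i j c) :
    flPoint h₁ h₂ (contra h') = flPoint h₁ h₂ (contra h) :=
  Fl.ext (colSpan_transvection hij.symm hi₁ (-c) (contra_mul_transvection hij hh))
    (colSpan_transvection hij.symm hi₂ (-c) (contra_mul_transvection hij hh))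

theorem colFunctionQ_colInvariant (s : (flQ₂ k₁ k₂ n).globalSections) {o : Fin n}
    (ho : k₂ ≤ o.1) {i j : Fin n} (hij : i ≠ j) (hj : j ≠ o) (hi₁ : i.1 < k₁ → j.1 < k₁)
    (hi₂ : i.1 < k₂ → j.1 < k₂) : (colFunctionQ h₁ h₂ s ho).ColInvariant i j := by
  refine GLFunction.colInvariant_of_bundled fun A h h' c hh => ?_
  refine pairQ_congr s (flPoint_contra_mul_transvection h₁ h₂ hij hi₁ hi₂ hh) _ _ ?_
  funext i
  simp [colVec, hh, mul_transvection_apply_of_ne, hj.symm]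

/-- Dual to the argument for `𝒰₁^∨`: the last column of `h` is a linear form vanishing on `V₂`, and
its pairing with `s` is linear in it. The remaining forms vanishing on `V₂` are reached by adding
them to the last column. -/
theorem exists_colPairQ_eq (s : (flQ₂ k₁ k₂ n).globalSections) (hk₂ : k₂ < n) (hn : 1 < n) :
    ∃ v : Fin n → ℂ, ∀ (A : CommAlgCat.{0} ℂ) (h : GL (Fin n) A) (j : Fin n) (hj : k₂ ≤ j.1),
      colPairQ h₁ h₂ s hj h = colVec h j ⬝ᵥ constVec v A := by
  let o : Fin n := ⟨n - 1, by omega⟩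
  have ho : k₂ ≤ o.1 := by change k₂ ≤ n - 1; omega
  have : Nontrivial (Fin n) := Fin.nontrivial_iff_two_le.2 hn
  have hs := colFunctionQ_scalesAt h₁ h₂ s ho
  have hup : ∀ i j : Fin n, j < i → j ≠ o →
      (colFunctionQ h₁ h₂ s ho).ColInvariant i j := fun i j hij hj =>
    colFunctionQ_colInvariant h₁ h₂ s _ hij.ne' hj (by omega) (by omega)
  obtain ⟨v, hv⟩ := GLFunction.exists_linear hs fun i j hij hj => by
    by_cases hlt : j < i
    · exact hup i j hlt hj
    · have hji : i < j := lt_of_le_of_ne (not_lt.1 hlt) hij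
      have hi : i ≠ o := by
        rintro rfl
        have : n - 1 < j.1 := hji
        omega
      exact (hup j i hji hi).symm hij.symm hj hi hs
  have hv' : ∀ (A : CommAlgCat.{0} ℂ) (h : GL (Fin n) A),
      colPairQ h₁ h₂ s ho h = colVec h o ⬝ᵥ constVec v A := fun A h =>
    ((hv A h).trans (linForm_apply v A _).symm).trans (dotProduct_constVec v A _).symm
  refine ⟨v, fun A h j hj => ?_⟩
  by_cases hjo : j = o
  · subst hjo
    exact hv' A h
  obtain ⟨h', hh'⟩ := GLFunction.exists_mul_transvection h hjo 1
  have e : colVec h' o = colVec h o + colVec h j := by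
    ext i
    simp [colVec, hh', mul_transvection_apply_same]
  have hp : flPoint h₁ h₂ (contra h') = flPoint h₁ h₂ (contra h) :=
    flPoint_contra_mul_transvection h₁ h₂ hjo (by omega) (by omega) hh'
  have hz : ∀ (j : Fin n), k₂ ≤ j.1 → ∀ w ∈ flSub₂ (flPoint h₁ h₂ (contra h)),
      colVec h j ⬝ᵥ w = 0 :=
    fun j hj w hw => (mem_colSpan_contra_iff h w).1 hw j hj
  have key : colPairQ h₁ h₂ s ho h' = colPairQ h₁ h₂ s ho h + colPairQ h₁ h₂ s hj h := by
    refine (pairQ_congr s hp _ (d := colVec h o + colVec h j) (fun w hw => ?_) e).trans ?_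
    · rw [add_dotProduct, hz o ho w hw, hz j hj w hw, add_zero]
    · obtain ⟨w, hw⟩ := Submodule.Quotient.mk_surjective _ (valueQ s (flPoint h₁ h₂ (contra h)))
      rw [pairQ_eq s _ hw.symm, add_dotProduct, colPairQ, colPairQ, pairQ_eq s _ hw.symm,
        pairQ_eq s _ hw.symm]
  rw [hv', hv', e, add_dotProduct] at key
  exact (add_left_cancel key).symm

end

theorem secQ_bijective (h₁ : k₁ ≤ k₂) (h₂ : k₂ < n) (hn : 1 < n) :
    Function.Bijective (secQ k₁ k₂ n) := by
  let o : Fin n := ⟨n - 1, by omega⟩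
  have ho : k₂ ≤ o.1 := by change k₂ ≤ n - 1; omega
  constructor
  · rw [← LinearMap.ker_eq_bot, LinearMap.ker_eq_bot']
    intro v hv
    funext i
    obtain ⟨g, hg⟩ := GLFunction.exists_col_eq (A := CommAlgCat.of ℂ ℂ) o i (Pi.single i 1)
      (by simp)
    have h : valueQ (secQ k₁ k₂ n v) (flPoint h₁ h₂.le (contra g)) = 0 := by
      rw [hv]; rfl
    have h' : constVec v (CommAlgCat.of ℂ ℂ) ∈ colSpan k₂ (contra g) :=
      (Submodule.Quotient.mk_eq_zero _).1 h
    have h'' := (mem_colSpan_contra_iff g _).1 h' o ho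
    rw [dotProduct_constVec, linForm_apply] at h''
    simpa [colVec, hg, Pi.single_apply] using h''
  · intro s
    obtain ⟨v, hv⟩ := exists_colPairQ_eq h₁ h₂.le s h₂ hn
    refine ⟨v, VectBundle.globalSections_ext fun A _ x => ?_⟩
    obtain ⟨g, rfl⟩ := exists_flPoint_eq h₁ h₂.le x
    rw [← contra_contra g]
    obtain ⟨w, hw⟩ := Submodule.Quotient.mk_surjective _
      (valueQ s (flPoint h₁ h₂.le (contra (contra g))))
    refine Eq.trans ?_ hw
    -- Two vectors agree modulo `V₂` once every column that is an equation of `V₂` takes the same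
    -- value on them.
    refine (Submodule.Quotient.eq _).2 ((mem_colSpan_contra_iff _ _).2 fun j hj => ?_)
    rw [dotProduct_sub, ← hv A (contra g) j hj, colPairQ, pairQ_eq s _ hw.symm, sub_self]

end sectionsQ

/-! ### Transport of subbundles along split injections -/

section subbundles

variable {A M N : Type} [CommRing A] [AddCommGroup M] [Module A M] [AddCommGroup N] [Module A N]

theorem rankAtStalk_map_of_injective {α : M →ₗ[A] N} (hα : Function.Injective α)
    (L : Submodule A M) : Module.rankAtStalk (R := A) (L.map α) = Module.rankAtStalk L :=
  (Module.rankAtStalk_eq_of_equiv (Submodule.equivMapOfInjective α hα L)).symm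

theorem IsSubbundle.map [Module.Projective A M] [Module.Projective A N] {k : ℕ}
    {L : Submodule A M} (h : IsSubbundle k L) (α : M →ₗ[A] N) (r : N →ₗ[A] M)
    (hr : ∀ x, r (α x) = x) : IsSubbundle k (L.map α) := by
  have hα : Function.Injective α := Function.LeftInverse.injective hr
  have := h.projective_quotient
  obtain ⟨p, hp⟩ := exists_retraction L
  refine ⟨projective_quotient_of_retraction
    ((Submodule.equivMapOfInjective α hα L : L →ₗ[A] L.map α) ∘ₗ p ∘ₗ r) ?_, fun P => ?_⟩
  · rintro ⟨_, x, hx, rfl⟩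
    refine Subtype.ext ?_
    simp only [LinearMap.comp_apply, hr, hp ⟨x, hx⟩]
    rfl
  · rw [rankAtStalk_map_of_injective hα, h.rank_eq]

theorem IsSubbundle.of_map [Module.Projective A M] {k : ℕ} {L : Submodule A M} {α : M →ₗ[A] N}
    (hα : Function.Injective α) (h : IsSubbundle k (L.map α)) : IsSubbundle k L := by
  have := h.projective_quotient
  obtain ⟨p, hp⟩ := exists_retraction (L.map α)
  let e := Submodule.equivMapOfInjective α hα L
  refine ⟨projective_quotient_of_retraction (e.symm.toLinearMap ∘ₗ p ∘ₗ α) fun x => ?_, fun P => ?_⟩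
  · have : p (α x) = e x := hp (e x)
    simp [this]
  · rw [← h.rank_eq P, rankAtStalk_map_of_injective hα]

theorem extendSub_map {A B : Type} [CommRing A] [CommRing B] {φ : A →+* B} {M N M' N' : Type}
    [AddCommGroup M] [Module A M] [AddCommGroup N] [Module B N]
    [AddCommGroup M'] [Module A M'] [AddCommGroup N'] [Module B N'] {g : M →ₛₗ[φ] N}
    {g' : M' →ₛₗ[φ] N'} {α : M →ₗ[A] M'} {β : N →ₗ[B] N'} (h : ∀ x, g' (α x) = β (g x))
    (L : Submodule A M) : extendSub g' (L.map α) = (extendSub g L).map β := by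
  rw [extendSub, extendSub, Submodule.map_span, Submodule.map_coe, Set.image_image, Set.image_image]
  simp only [h]

theorem IsExtension.extendSub_top {A B : Type} [CommRing A] [CommRing B] {φ : A →+* B} {M N : Type}
    [AddCommGroup M] [Module A M] [AddCommGroup N] [Module B N] {g : M →ₛₗ[φ] N}
    (h : IsExtension φ g) : extendSub g ⊤ = ⊤ := by
  rw [extendSub, Submodule.top_coe, Set.image_univ, h.span_eq_top]

end subbundles

/-! ### Flags from submodules, and splittings `A^(m + 1) = Aᵐ × A` -/

/-- The flag given by two subbundles of `Aⁿ`. -/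
def flMk {n k₁ k₂ : ℕ} {A : CommAlgCat.{0} ℂ} {V₁ V₂ : Submodule A (Fin n → A)}
    (h₁ : IsSubbundle k₁ V₁) (h₂ : IsSubbundle k₂ V₂) (h : V₁ ≤ V₂) : (Fl k₁ k₂ n).obj A :=
  ⟨(GrPoint.mk (E := VectBundle.trivial pt n) (A := A) PUnit.unit V₁ h₁,
    GrPoint.mk (E := VectBundle.trivial pt n) (A := A) PUnit.unit V₂ h₂), h⟩

/-- The coordinatewise application of a homomorphism of algebras. -/
def mapVec {A B : CommAlgCat.{0} ℂ} (f : A ⟶ B) (n : ℕ) :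
    (Fin n → A) →ₛₗ[f.hom.toRingHom] (Fin n → B) :=
  (VectBundle.trivial pt n).tr f (x := PUnit.unit) rfl

/-- A natural family of splittings of `A^(m + 1)` as `Aᵐ × A`. -/
structure Splitting (m : ℕ) where
  equiv : ∀ A : CommAlgCat.{0} ℂ, (Fin (m + 1) → A) ≃ₗ[A] (Fin m → A) × A
  natural : ∀ {A B : CommAlgCat.{0} ℂ} (f : A ⟶ B) (v : Fin (m + 1) → A),
    equiv B (fun i => f.hom (v i)) =
      (fun i => f.hom ((equiv A v).1 i), f.hom (equiv A v).2)

theorem Splitting.natural_symm {m : ℕ} (ψ : Splitting m) {A B : CommAlgCat.{0} ℂ} (f : A ⟶ B)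
    (w : Fin m → A) (a : A) : (ψ.equiv B).symm (fun i => f.hom (w i), f.hom a) =
      fun i => f.hom ((ψ.equiv A).symm (w, a) i) := by
  rw [LinearEquiv.symm_apply_eq, ψ.natural, LinearEquiv.apply_symm_apply]

/-- The splitting adapted to a vector `v` with `v 0 ≠ 0`. -/
def vectorSplitting {m : ℕ} (v : Fin (m + 1) → ℂ) (hv : v 0 ≠ 0) : Splitting m where
  equiv A :=
    { toFun x := (fun i => x i.succ - algebraMap ℂ A ((v 0)⁻¹ * v i.succ) * x 0,
        algebraMap ℂ A (v 0)⁻¹ * x 0)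
      invFun y := Fin.cons (algebraMap ℂ A (v 0) * y.2)
        fun i => y.1 i + algebraMap ℂ A (v i.succ) * y.2
      map_add' x y := by
        ext i <;> simp <;> ring
      map_smul' c x := by
        ext i <;> simp <;> ring
      left_inv x := by
        have h : algebraMap ℂ A (v 0) * algebraMap ℂ A (v 0)⁻¹ = 1 := by
          rw [← map_mul, mul_inv_cancel₀ hv, map_one]
        funext i
        refine Fin.cases ?_ (fun i => ?_) i
        · simp [← mul_assoc, h]
        · simp only [Fin.cons_succ, map_mul]
          ring
      right_inv y := by
        have h : algebraMap ℂ A (v 0)⁻¹ * algebraMap ℂ A (v 0) = 1 := by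
          rw [← map_mul, inv_mul_cancel₀ hv, map_one]
        refine Prod.ext (funext fun i => ?_) ?_
        · simp only [Fin.cons_succ, Fin.cons_zero, map_mul]
          linear_combination (-algebraMap ℂ A (v i.succ) * y.2) * h
        · simp [← mul_assoc, h] }
  natural f x := by
    refine Prod.ext (funext fun i => ?_) ?_
    · change f.hom (x i.succ) - _ * f.hom (x 0) = f.hom (x i.succ - _ * x 0)
      rw [map_sub, map_mul f.hom, f.hom.commutes]
    · change _ * f.hom (x 0) = f.hom (_ * x 0)
      rw [map_mul, f.hom.commutes]

theorem vectorSplitting_constVec {m : ℕ} (v : Fin (m + 1) → ℂ) (hv : v 0 ≠ 0)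
    (A : CommAlgCat.{0} ℂ) : ((vectorSplitting v hv).equiv A).symm (0, 1) = constVec v A := by
  funext i
  refine Fin.cases ?_ (fun i => ?_) i
  · change algebraMap ℂ A (v 0) * 1 = _
    simp [constVec]
  · change 0 + algebraMap ℂ A (v i.succ) * 1 = _
    simp [constVec]

/-- The splitting adapted to a linear form `l` with `l 0 ≠ 0`. -/
def formSplitting {m : ℕ} (l : Fin (m + 1) → ℂ) (hl : l 0 ≠ 0) : Splitting m where
  equiv A :=
    { toFun x := (fun i => x i.succ, linForm l A x)
      invFun y := Fin.cons (algebraMap ℂ A (l 0)⁻¹ * (y.2 - linForm (fun i => l i.succ) A y.1)) y.1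
      map_add' x y := by
        rw [map_add]; rfl
      map_smul' c x := by
        rw [map_smul]; rfl
      left_inv x := by
        have h : algebraMap ℂ A (l 0)⁻¹ * algebraMap ℂ A (l 0) = 1 := by
          rw [← map_mul, inv_mul_cancel₀ hl, map_one]
        funext i
        refine Fin.cases ?_ (fun i => rfl) i
        simp only [Fin.cons_zero, linForm_apply, Fin.sum_univ_succ, add_sub_cancel_right]
        rw [← mul_assoc, h, one_mul]
      right_inv y := by
        have h : algebraMap ℂ A (l 0) * algebraMap ℂ A (l 0)⁻¹ = 1 := by
          rw [← map_mul, mul_inv_cancel₀ hl, map_one]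
        refine Prod.ext rfl ?_
        simp only [linForm_apply, Fin.sum_univ_succ, Fin.cons_zero, Fin.cons_succ]
        rw [← mul_assoc, h, one_mul, sub_add_cancel] }
  natural f x := Prod.ext rfl (linForm_map l f x)

/-! ### The zero locus of a section of `𝒬₂` -/

section zeroLocusQ

variable {l m k : ℕ}

/-- The bundle `𝒰 ⊕ 𝒪`. -/
abbrev tautUSum (l m : ℕ) : VectBundle (Gr l m) :=
  (tautU l m).sum (VectBundle.structureSheaf (Gr l m))

/-- A point of a Grassmannian as a submodule. -/
abbrev GrPoint.submodule {A : CommAlgCat.{0} ℂ} (p : (Gr l m).obj A) : Submodule A (Fin m → A) :=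
  GrPoint.sub p

/-- A subbundle of `𝒰 ⊕ 𝒪` as a submodule. -/
abbrev GrPoint.submoduleUSum {A : CommAlgCat.{0} ℂ} (p : GrPoint k (tautUSum l m) A) :
    Submodule A (GrPoint.submodule p.base × A) :=
  p.sub

/-- The embedding of `W × A` into `A^(m + 1)` given by a splitting. -/
def Splitting.embed (ψ : Splitting m) {A : CommAlgCat.{0} ℂ} (W : Submodule A (Fin m → A)) :
    (W × A) →ₗ[A] (Fin (m + 1) → A) :=
  (ψ.equiv A).symm.toLinearMap ∘ₗ W.subtype.prodMap LinearMap.id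

theorem Splitting.embed_injective (ψ : Splitting m) {A : CommAlgCat.{0} ℂ}
    (W : Submodule A (Fin m → A)) : Function.Injective (ψ.embed W) :=
  (ψ.equiv A).symm.injective.comp
    (Function.Injective.prodMap W.injective_subtype Function.injective_id)

theorem Splitting.mem_range_embed (ψ : Splitting m) {A : CommAlgCat.{0} ℂ}
    (W : Submodule A (Fin m → A)) (x : Fin (m + 1) → A) :
    x ∈ LinearMap.range (ψ.embed W) ↔ (ψ.equiv A x).1 ∈ W := by
  constructor
  · rintro ⟨⟨w, a⟩, rfl⟩
    simp [Splitting.embed]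
  · intro h
    exact ⟨(⟨_, h⟩, (ψ.equiv A x).2), by simp [Splitting.embed]⟩

theorem Splitting.exists_retraction_embed (ψ : Splitting m) {A : CommAlgCat.{0} ℂ}
    {W : Submodule A (Fin m → A)} (hW : IsSubbundle l W) :
    ∃ r : (Fin (m + 1) → A) →ₗ[A] (W × A), ∀ x, r (ψ.embed W x) = x := by
  have := hW.projective_quotient
  obtain ⟨p, hp⟩ := exists_retraction W
  exact ⟨p.prodMap LinearMap.id ∘ₗ (ψ.equiv A).toLinearMap, fun x => by
    simp [Splitting.embed, hp]⟩

theorem rankAtStalk_prod_self {A M : Type} [CommRing A] [AddCommGroup M] [Module A M]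
    [Module.Finite A M] [Module.Projective A M] (P : PrimeSpectrum A) :
    Module.rankAtStalk (R := A) (M × A) P = Module.rankAtStalk (R := A) M P + 1 := by
  have := P.nontrivial
  rw [Module.rankAtStalk_prod, Module.rankAtStalk_self]
  rfl

theorem Splitting.isSubbundle_range_embed (ψ : Splitting m) {A : CommAlgCat.{0} ℂ}
    {W : Submodule A (Fin m → A)} (hW : IsSubbundle l W) :
    IsSubbundle (l + 1) (LinearMap.range (ψ.embed W)) := by
  obtain ⟨_, _⟩ := hW.finite_projective
  obtain ⟨r, hr⟩ := ψ.exists_retraction_embed hW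
  rw [← Submodule.map_top]
  refine IsSubbundle.map ⟨?_, fun P => ?_⟩ _ r hr
  · have := Submodule.Quotient.subsingleton_iff.2 (rfl : (⊤ : Submodule A (W × A)) = ⊤)
    infer_instance
  · rw [Module.rankAtStalk_eq_of_equiv (Submodule.topEquiv : (⊤ : Submodule A (W × A)) ≃ₗ[A] _),
      rankAtStalk_prod_self, hW.rank_eq]

/-- The flag `L ⊆ W × A` in `A^(m + 1)` given by `W ⊆ Aᵐ` and `L ⊆ W × A`. -/
def flagOfUSum (ψ : Splitting m) {A : CommAlgCat.{0} ℂ} (p : GrPoint k (tautUSum l m) A) :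
    (Fl k (l + 1) (m + 1)).obj A :=
  flMk (V₁ := p.submoduleUSum.map (ψ.embed (GrPoint.submodule p.base)))
    (by
      obtain ⟨_, _⟩ := p.base.isSubbundle.finite_projective
      obtain ⟨r, hr⟩ := ψ.exists_retraction_embed p.base.isSubbundle
      exact p.isSubbundle.map (ψ.embed (GrPoint.submodule p.base)) r hr)
    (ψ.isSubbundle_range_embed p.base.isSubbundle) LinearMap.map_le_range

/-- The embedding commutes with base change. The second subspace is the image of `⊤`, so both
subspaces are handled by `extendSub_map`. -/
theorem flagOfUSum_map (ψ : Splitting m) {A B : CommAlgCat.{0} ℂ} (f : A ⟶ B)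
    (p : GrPoint k (tautUSum l m) A) :
    flagOfUSum ψ (p.map f) = (Fl k (l + 1) (m + 1)).map f (flagOfUSum ψ p) := by
  have e : ∀ x : GrPoint.submodule p.base × A,
      mapVec f (m + 1) (ψ.embed _ x) = ψ.embed (GrPoint.submodule (p.map f).base)
        ((tautUSum l m).tr f (x := p.base) rfl x) :=
    fun x => (ψ.natural_symm f x.1.1 x.2).symm
  refine Fl.ext ?_ ?_
  · exact (extendSub_map (g := (tautUSum l m).tr f (x := p.base) rfl) e p.submoduleUSum).symm
  · have h := extendSub_map (g := (tautUSum l m).tr f (x := p.base) rfl) e ⊤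
    rw [((tautUSum l m).isExtension f (x := p.base) rfl).extendSub_top] at h
    exact (Submodule.map_top (ψ.embed (GrPoint.submodule (p.map f).base))).symm.trans
      (h.symm.trans (congrArg (extendSub (mapVec f (m + 1)))
        (Submodule.map_top (ψ.embed (GrPoint.submodule p.base)))))

theorem flagOfUSum_injective (ψ : Splitting m) (A : CommAlgCat.{0} ℂ) :
    Function.Injective (flagOfUSum ψ : GrPoint k (tautUSum l m) A → _) := by
  intro p q h
  obtain ⟨W, L, hL⟩ := p
  obtain ⟨W', L', hL'⟩ := q
  have h₁ : Submodule.map (ψ.embed (GrPoint.submodule W)) L =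
      Submodule.map (ψ.embed (GrPoint.submodule W')) L' := congrArg flSub₁ h
  have h₂ : LinearMap.range (ψ.embed (GrPoint.submodule W)) =
      LinearMap.range (ψ.embed (GrPoint.submodule W')) := congrArg flSub₂ h
  have hW : W = W' := by
    refine GrPoint.trivial_ext (Submodule.ext fun w => ?_)
    -- `W` is recovered from `V₂` as the set of `w` for which `(w, 0)` lies in `V₂`.
    have := SetLike.ext_iff.1 h₂ ((ψ.equiv A).symm (w, 0))
    rwa [ψ.mem_range_embed, ψ.mem_range_embed, LinearEquiv.apply_symm_apply] at this
  subst hW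
  obtain rfl := Submodule.map_injective_of_injective (ψ.embed_injective _) h₁
  rfl

/-- Since `V₂` contains the vector `(0, 1)`, it equals `W × A` with `W` its intersection with `Aᵐ`;
the rank of `W` is then one less than that of `V₂`. -/
theorem exists_flagOfUSum_eq (ψ : Splitting m) {A : CommAlgCat.{0} ℂ}
    (x : (Fl k (l + 1) (m + 1)).obj A) (hx : (ψ.equiv A).symm (0, 1) ∈ flSub₂ x) :
    ∃ p : GrPoint k (tautUSum l m) A, flagOfUSum ψ p = x := by
  let W : Submodule A (Fin m → A) :=
    (flSub₂ x).comap ((ψ.equiv A).symm.toLinearMap ∘ₗ LinearMap.inl A _ _)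
  have hmem : ∀ v, v ∈ flSub₂ x ↔ (ψ.equiv A v).1 ∈ W := by
    intro v
    have e : v = (ψ.equiv A).symm ((ψ.equiv A v).1, 0) +
        (ψ.equiv A v).2 • (ψ.equiv A).symm (0, 1) := by
      rw [← map_smul, ← map_add, LinearEquiv.eq_symm_apply]
      simp
    have h := Submodule.add_mem_iff_left (flSub₂ x) (x := (ψ.equiv A).symm ((ψ.equiv A v).1, 0))
      (Submodule.smul_mem _ (ψ.equiv A v).2 hx)
    rw [← e] at h
    exact h
  have hrange : LinearMap.range (ψ.embed W) = flSub₂ x := by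
    ext v
    rw [ψ.mem_range_embed, hmem]
  have hW : IsSubbundle l W := by
    have hV : IsSubbundle (l + 1) (flSub₂ x) := x.1.2.isSubbundle
    have := hV.projective_quotient
    obtain ⟨p, hp⟩ := exists_retraction (flSub₂ x)
    -- A retraction onto `W`: include `Aᵐ` in `A^(m + 1)`, retract onto `V₂`, and take the first
    -- component.
    have hq : Module.Projective A ((Fin m → A) ⧸ W) := by
      refine projective_quotient_of_retraction (LinearMap.codRestrict W
        (LinearMap.fst A _ _ ∘ₗ (ψ.equiv A).toLinearMap ∘ₗ (flSub₂ x).subtype ∘ₗ p ∘ₗ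
          (ψ.equiv A).symm.toLinearMap ∘ₗ LinearMap.inl A _ _)
        fun w => (hmem _).1 (p _).2) fun w => Subtype.ext ?_
      have : ((p ((ψ.equiv A).symm (w.1, 0))) : Fin (m + 1) → A) = (ψ.equiv A).symm (w.1, 0) :=
        congrArg Subtype.val (hp ⟨(ψ.equiv A).symm (w.1, 0), w.2⟩)
      change (ψ.equiv A (p ((ψ.equiv A).symm (w.1, 0))).1).1 = w.1
      rw [this, LinearEquiv.apply_symm_apply]
    obtain ⟨r, hr⟩ := exists_retraction W
    have : Module.Finite A W := Module.Finite.of_surjective r fun x => ⟨x, hr x⟩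
    have : Module.Projective A W :=
      Module.Projective.of_split W.subtype r (LinearMap.ext hr)
    refine ⟨hq, fun P => ?_⟩
    have h₁ := hV.rank_eq P
    rw [← Module.rankAtStalk_eq_of_equiv ((LinearEquiv.ofInjective _ (ψ.embed_injective W)).trans
      (LinearEquiv.ofEq _ _ hrange)), rankAtStalk_prod_self] at h₁
    omega
  let w : (Gr l m).obj A := GrPoint.mk (E := VectBundle.trivial pt m) (A := A) PUnit.unit W hW
  have hL : Submodule.map (ψ.embed W) ((flSub₁ x).comap (ψ.embed W)) = flSub₁ x := by
    rw [Submodule.map_comap_eq, hrange]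
    exact inf_eq_right.2 x.2
  obtain ⟨_, _⟩ := hW.finite_projective
  have hsub : IsSubbundle k ((flSub₁ x).comap (ψ.embed W)) :=
    IsSubbundle.of_map (ψ.embed_injective W) (by rw [hL]; exact x.1.1.isSubbundle)
  exact ⟨GrPoint.mk (E := tautUSum l m) w ((flSub₁ x).comap (ψ.embed W)) hsub, Fl.ext hL hrange⟩

theorem mem_zeroLocus_secQ {n k₁ k₂ : ℕ} {v : Fin n → ℂ} {A : CommAlgCat.{0} ℂ}
    {x : (Fl k₁ k₂ n).obj A} :
    x ∈ (VectBundle.zeroLocus (secQ k₁ k₂ n v)).obj A ↔ constVec v A ∈ flSub₂ x :=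
  Submodule.Quotient.mk_eq_zero (flSub₂ x)

/-- A morphism to a space that identifies its points with those of a subspace is an isomorphism
onto the subspace. -/
theorem nonempty_iso_of_injective {X Y : CSpace} (Z : Subfunctor X) (F : Y ⟶ X)
    (hF : ∀ A, Function.Injective (F.app A)) (hZ : ∀ A x, x ∈ Z.obj A ↔ ∃ y, F.app A y = x) :
    Nonempty (Z.toFunctor ≅ Y) := by
  let G : Y ⟶ Z.toFunctor := Subfunctor.lift F (by
    rintro A _ ⟨y, rfl⟩
    exact (hZ A _).2 ⟨y, rfl⟩)
  have : IsIso G := by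
    rw [NatTrans.isIso_iff_isIso_app]
    intro A
    rw [isIso_iff_bijective]
    refine ⟨fun y z h => hF A (congrArg Subtype.val h), fun ⟨x, hx⟩ => ?_⟩
    obtain ⟨y, rfl⟩ := (hZ A x).1 hx
    exact ⟨y, rfl⟩
  exact ⟨(asIso G).symm⟩

theorem nonempty_zeroLocus_secQ_iso {l m k : ℕ} (v : Fin (m + 1) → ℂ) (hv : v 0 ≠ 0) :
    Nonempty ((VectBundle.zeroLocus (secQ k (l + 1) (m + 1) v)).toFunctor ≅
      grassmannBundle k (tautUSum l m)) := by
  refine nonempty_iso_of_injective _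
    { app A := ↾fun p => flagOfUSum (vectorSplitting v hv) p
      naturality A B f := by
        ext p
        exact flagOfUSum_map (vectorSplitting v hv) f p }
    (fun A => flagOfUSum_injective (vectorSplitting v hv) A) fun A x => ?_
  rw [mem_zeroLocus_secQ, ← vectorSplitting_constVec v hv]
  refine ⟨exists_flagOfUSum_eq (vectorSplitting v hv) x, ?_⟩
  rintro ⟨p, rfl⟩
  exact ((vectorSplitting v hv).mem_range_embed _ _).2 (by
    rw [LinearEquiv.apply_symm_apply]
    exact zero_mem _)

end zeroLocusQ

/-! ### Twisting submodules by a line bundle -/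

section twist

variable {A : Type} [CommRing A]

/-- In the localization at `p` the scalar `u` is a unit, so `f` and `g` are inverse to each other up
to a unit. -/
theorem rankAtStalk_eq_of_comp_eq_smul {M N : Type} [AddCommGroup M] [Module A M] [AddCommGroup N]
    [Module A N] (f : M →ₗ[A] N) (g : N →ₗ[A] M) (u : A) (h₁ : ∀ x, g (f x) = u • x)
    (h₂ : ∀ y, f (g y) = u • y) (p : PrimeSpectrum A) (hu : u ∉ p.asIdeal) :
    Module.rankAtStalk (R := A) M p = Module.rankAtStalk (R := A) N p := by
  let S := p.asIdeal.primeCompl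
  have hU : IsUnit (algebraMap A (Localization S) u) :=
    IsLocalization.map_units (Localization S) (⟨u, hu⟩ : S)
  have e₁ : ∀ x, LocalizedModule.map S g (LocalizedModule.map S f x) =
      algebraMap A (Localization S) u • x := by
    intro x
    induction x using LocalizedModule.induction_on with
    | h x s => rw [LocalizedModule.map_mk, LocalizedModule.map_mk, h₁, algebraMap_smul,
        LocalizedModule.smul'_mk]
  have e₂ : ∀ x, LocalizedModule.map S f (LocalizedModule.map S g x) =
      algebraMap A (Localization S) u • x := by
    intro x
    induction x using LocalizedModule.induction_on with
    | h x s => rw [LocalizedModule.map_mk, LocalizedModule.map_mk, h₂, algebraMap_smul,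
        LocalizedModule.smul'_mk]
  refine LinearEquiv.finrank_eq (LinearEquiv.ofBijective (LocalizedModule.map S f) ⟨?_, ?_⟩)
  · intro x y hxy
    have := congrArg (LocalizedModule.map S g) hxy
    rwa [e₁, e₁, hU.smul_left_cancel] at this
  · intro y
    obtain ⟨v, hv⟩ := hU
    refine ⟨(↑v⁻¹ : Localization S) • LocalizedModule.map S g y, ?_⟩
    rw [map_smul, e₂, ← hv, smul_smul, Units.inv_mul, one_smul]

variable {P E N N' : Type} [AddCommGroup P] [Module A P] [AddCommGroup E] [Module A E]
  [AddCommGroup N] [Module A N] [AddCommGroup N'] [Module A N']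

/-- With `N` a line bundle and `N'` its dual, this says that twisting and untwisting a submodule
returns it. The relation `∑ b (x i) (y i) = 1` replaces a local generator of `N`. -/
theorem map₂_map₂_top {β : P →ₗ[A] N →ₗ[A] E} {γ : E →ₗ[A] N' →ₗ[A] P} {b : N → N' → A}
    (h : ∀ q x y, γ (β q x) y = b x y • q) {ι : Type} [Fintype ι] (x : ι → N) (y : ι → N')
    (hb : ∑ i, b (x i) (y i) = 1) (S : Submodule A P) :
    Submodule.map₂ γ (Submodule.map₂ β S ⊤) ⊤ = S := by
  refine le_antisymm (Submodule.map₂_le.2 fun z hz η _ => ?_) fun q hq => ?_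
  · have : Submodule.map₂ β S ⊤ ≤ S.comap (γ.flip η) := Submodule.map₂_le.2 fun q hq ξ _ => by
      rw [Submodule.mem_comap, LinearMap.flip_apply, h]
      exact S.smul_mem _ hq
    exact this hz
  · rw [← one_smul A q, ← hb, Finset.sum_smul]
    refine Submodule.sum_mem _ fun i _ => ?_
    rw [← h]
    exact Submodule.apply_mem_map₂ _ (Submodule.apply_mem_map₂ _ hq trivial) trivial

theorem IsSubbundle.map₂_top {β : P →ₗ[A] N →ₗ[A] E} {γ : E →ₗ[A] N' →ₗ[A] P} {b : N → N' → A}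
    (h₁ : ∀ q x y, γ (β q x) y = b x y • q) (h₂ : ∀ z x y, β (γ z y) x = b x y • z)
    {ι : Type} [Fintype ι] (x : ι → N) (y : ι → N')
    (hb : ∑ i, b (x i) (y i) = 1) {r : ℕ} {S : Submodule A P} (hS : IsSubbundle r S) :
    IsSubbundle r (Submodule.map₂ β S ⊤) := by
  classical
  have := hS.projective_quotient
  have hβ : ∀ ξ, ∀ q ∈ S, β q ξ ∈ Submodule.map₂ β S ⊤ := fun ξ q hq =>
    Submodule.apply_mem_map₂ _ hq trivial
  have hγ : ∀ η, ∀ z ∈ Submodule.map₂ β S ⊤, γ z η ∈ S := fun η z hz =>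
    (map₂_map₂_top h₁ x y hb S).le (Submodule.apply_mem_map₂ _ hz trivial)
  refine ⟨?_, fun p => ?_⟩
  -- The quotient of `E` is a retract of a finite power of `P ⧸ S`: the maps `γ (·) (y i)` lead
  -- there and the maps `β (·) (x i)` lead back.
  · have : Module.Projective A (ι → P ⧸ S) :=
      .of_equiv (DFinsupp.linearEquivFunOnFintype (R := A) (M := fun _ : ι => P ⧸ S))
    refine Module.Projective.of_split (M := ι → P ⧸ S)
      (LinearMap.pi fun i => Submodule.mapQ (Submodule.map₂ β S ⊤) S (γ.flip (y i)) (hγ (y i)))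
      (∑ i, Submodule.mapQ S (Submodule.map₂ β S ⊤) (β.flip (x i)) (hβ (x i)) ∘ₗ
        (LinearMap.proj i : (ι → P ⧸ S) →ₗ[A] P ⧸ S)) ?_
    refine LinearMap.ext fun z => ?_
    obtain ⟨z, rfl⟩ := Submodule.Quotient.mk_surjective _ z
    rw [LinearMap.comp_apply, LinearMap.sum_apply]
    change ∑ i, (Submodule.map₂ β S ⊤).mkQ (β (γ z (y i)) (x i)) = (Submodule.map₂ β S ⊤).mkQ z
    simp only [h₂]
    rw [← map_sum, ← Finset.sum_smul, hb, one_smul]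
  -- The values `b (x i) (y i)` sum to `1`, so one of them is a unit at `p`, and there the two
  -- submodules are isomorphic.
  · have : ∃ i, b (x i) (y i) ∉ p.asIdeal := by
      by_contra! hcon
      refine p.isPrime.ne_top ((Ideal.eq_top_iff_one _).2 ?_)
      rw [← hb]
      exact Ideal.sum_mem _ fun i _ => hcon i
    obtain ⟨i, hi⟩ := this
    rw [← hS.rank_eq p]
    exact rankAtStalk_eq_of_comp_eq_smul ((γ.flip (y i)).restrict (hγ (y i)))
      ((β.flip (x i)).restrict (hβ (x i))) (b (x i) (y i))
      (fun z => Subtype.ext (h₂ z.1 _ _)) (fun q => Subtype.ext (h₁ q.1 _ _)) p hi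

theorem extendSub_map₂ {B : Type} [CommRing B] {φ : A →+* B} {P' E' M' : Type} [AddCommGroup P']
    [Module B P'] [AddCommGroup E'] [Module B E'] [AddCommGroup M'] [Module B M']
    {β : P →ₗ[A] N →ₗ[A] E} {β' : P' →ₗ[B] M' →ₗ[B] E'} {gP : P →ₛₗ[φ] P'} {gN : N →ₛₗ[φ] M'}
    {gE : E →ₛₗ[φ] E'} (h : ∀ q x, gE (β q x) = β' (gP q) (gN x)) (S : Submodule A P)
    (T : Submodule A N) : extendSub gE (Submodule.map₂ β S T) =
      Submodule.map₂ β' (extendSub gP S) (extendSub gN T) := by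
  rw [Submodule.map₂_eq_span_image2, extendSub_span, extendSub, extendSub, Submodule.map₂_span_span,
    Set.image_image2, Set.image2_image_left, Set.image2_image_right]
  simp only [h]

variable (N) {Q : Type} [AddCommGroup Q] [Module A Q]

open TensorProduct

/-- The map `((q, a), x) ↦ (q ⊗ x, a x)`. -/
def twistMap (Q : Type) [AddCommGroup Q] [Module A Q] :
    (Q × A) →ₗ[A] N →ₗ[A] (Q ⊗[A] N) × N :=
  LinearMap.mk₂ A (fun q x => (q.1 ⊗ₜ x, q.2 • x))
    (fun _ _ _ => by simp [TensorProduct.add_tmul, add_smul])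
    (fun _ _ _ => Prod.ext (TensorProduct.smul_tmul' _ _ _).symm (mul_smul _ _ _))
    (fun _ _ _ => by simp [TensorProduct.tmul_add])
    (fun _ _ _ => Prod.ext (TensorProduct.tmul_smul _ _ _) (smul_comm _ _ _))

/-- The map `((q ⊗ x, y), ξ) ↦ (ξ(x) q, ξ(y))`. -/
def untwistMap (Q : Type) [AddCommGroup Q] [Module A Q] :
    ((Q ⊗[A] N) × N) →ₗ[A] Module.Dual A N →ₗ[A] (Q × A) :=
  LinearMap.mk₂ A (fun z ξ => (TensorProduct.rid A Q (ξ.lTensor Q z.1), ξ z.2))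
    (fun _ _ _ => by simp)
    (fun _ _ _ => by simp)
    (fun _ _ _ => by simp [LinearMap.lTensor_add])
    (fun _ _ _ => by simp [LinearMap.lTensor_smul])

theorem untwistMap_twistMap (q : Q × A) (x : N) (ξ : Module.Dual A N) :
    untwistMap N Q (twistMap N Q q x) ξ = ξ x • q := by
  refine Prod.ext ?_ ?_
  · change TensorProduct.rid A Q (ξ.lTensor Q (q.1 ⊗ₜ x)) = ξ x • q.1
    simp
  · change ξ (q.2 • x) = ξ x * q.2
    simp [mul_comm]

theorem twistMap_untwistMap (hN : ∀ (ξ : Module.Dual A N) (x y : N), ξ x • y = ξ y • x)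
    (z : (Q ⊗[A] N) × N) (x : N) (ξ : Module.Dual A N) :
    twistMap N Q (untwistMap N Q z ξ) x = ξ x • z := by
  obtain ⟨t, y⟩ := z
  refine Prod.ext ?_ (hN ξ y x)
  change (TensorProduct.rid A Q (ξ.lTensor Q t)) ⊗ₜ[A] x = ξ x • t
  induction t with
  | zero => simp
  | add t u ht hu => rw [map_add, map_add, TensorProduct.add_tmul, ht, hu, smul_add]
  | tmul q y =>
    simp only [LinearMap.lTensor_tmul, TensorProduct.rid_tmul]
    rw [TensorProduct.smul_tmul, hN, TensorProduct.tmul_smul]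

end twist

/-! ### Line bundles -/

namespace VectBundle

variable {X : CSpace}

/-- The fibres over local rings are free of rank one. -/
def IsLine (F : VectBundle X) : Prop :=
  ∀ (A : CommAlgCat.{0} ℂ), IsLocalRing A → ∀ x : X.obj A,
    ∃ (e : F.fib x) (c : Module.Dual A (F.fib x)), c e = 1 ∧ ∀ v, c v • e = v

variable {F : VectBundle X} {A : CommAlgCat.{0} ℂ} {x : X.obj A}

/-- Over a local ring both vectors are multiples of one generator, where the identity is
commutativity. -/
theorem IsLine.smul_comm (hF : F.IsLine) (ξ : Module.Dual A (F.fib x)) (v w : F.fib x) :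
    ξ v • w = ξ w • v := by
  rw [← sub_eq_zero]
  refine F.eq_zero_of_local _ fun B hB f => ?_
  obtain ⟨e, c, hc, he⟩ := hF B hB (X.map f x)
  have hξ := dualExt_apply (F.isExtension f (x := x) rfl) ξ
  rw [map_sub, LinearMap.map_smulₛₗ, LinearMap.map_smulₛₗ, ← hξ, ← hξ, ← he (F.tr f rfl v),
    ← he (F.tr f rfl w)]
  simp only [map_smul, smul_smul, smul_eq_mul]
  rw [sub_eq_zero]
  congr 1
  ring

/-- For a dual frame the sum is the trace of the identity, that is, the rank, which is checked to be
`1` over local rings. -/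
theorem IsLine.exists_sum_eq_one (hF : F.IsLine) (x : X.obj A) : ∃ (r : ℕ) (v : Fin r → F.fib x)
    (ξ : Fin r → Module.Dual A (F.fib x)), ∑ i, ξ i (v i) = 1 := by
  obtain ⟨r, v, ξ, -, hv, -, -⟩ := (F.isExtension (𝟙 A) (x := x) rfl).exists_frame
  refine ⟨r, v, ξ, ?_⟩
  have gen : ∀ (B : CommAlgCat.{0} ℂ), IsLocalRing B → ∀ f : A ⟶ B,
      f.hom (∑ i, ξ i (v i) - 1) = 0 := by
    intro B hB f
    obtain ⟨e, c, hc, he⟩ := hF B hB (X.map f x)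
    let hext := F.isExtension f (x := x) rfl
    have key : ∀ z, ∑ i, dualExt hext (ξ i) z • F.tr f rfl (v i) = z := by
      have : ∑ i, (dualExt hext (ξ i)).smulRight (F.tr f rfl (v i)) = LinearMap.id := by
        refine hext.hom_ext fun z => ?_
        simp only [LinearMap.sum_apply, LinearMap.smulRight_apply, dualExt_apply,
          LinearMap.id_apply]
        conv_rhs => rw [← hv z]
        simp only [map_sum, LinearMap.map_smulₛₗ]
      intro z
      simpa using LinearMap.congr_fun this z
    have h₁ := congrArg c (key e)
    simp only [map_sum, map_smul, smul_eq_mul, hc] at h₁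
    rw [map_sub, map_one, sub_eq_zero, map_sum, ← h₁]
    refine Finset.sum_congr rfl fun i _ => ?_
    have h₂ := dualExt_apply hext (ξ i) (v i)
    refine h₂.symm.trans ?_
    conv_lhs => rw [← he (F.tr f rfl (v i))]
    rw [map_smul, smul_eq_mul, mul_comm]
  rw [← sub_eq_zero]
  exact eq_zero_of_localization _ fun J hJ =>
    gen (CommAlgCat.of ℂ (Localization.AtPrime J))
      (inferInstanceAs (IsLocalRing (Localization.AtPrime J)))
      (CommAlgCat.ofHom (IsScalarTower.toAlgHom ℂ A (Localization.AtPrime J)))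

end VectBundle

theorem isLine_grO (k m : ℕ) : (grO k m).IsLine := by
  intro A hA x
  have h : IsSubbundle k (GrPoint.submodule x) := x.isSubbundle
  obtain ⟨b⟩ := h.exists_basis
  have : Module.Free A (GrPoint.submodule x) := Module.Free.of_basis b
  have := h.finite_projective.1
  have hr : Module.finrank A (⋀[A]^k (GrPoint.submodule x)) = 1 := by
    rw [exteriorPower.finrank_eq, Module.finrank_eq_card_basis b, Fintype.card_fin,
      Nat.choose_self]
  let c := Module.finBasisOfFinrankEq A (⋀[A]^k (GrPoint.submodule x)) hr
  have hc : c.coord 0 (c 0) = 1 := by simp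
  refine ⟨c 0, c.coord 0, hc, fun v => ?_⟩
  have := c.sum_repr v
  rwa [Fin.sum_univ_one] at this

/-! ### Subbundles and their preimages under a surjection -/

section comap

variable {A M P : Type} [CommRing A] [AddCommGroup M] [Module A M] [AddCommGroup P] [Module A P]
  {π : M →ₗ[A] P}

/-- The section `σ` splits the preimage of `S` as the direct sum of `ker π` and `S`. -/
theorem rankAtStalk_comap (σ : P →ₗ[A] M) (hσ : ∀ x, π (σ x) = x) (S : Submodule A P)
    [Module.Finite A (LinearMap.ker π)] [Module.Projective A (LinearMap.ker π)]
    [Module.Finite A S] [Module.Projective A S] (p : PrimeSpectrum A) :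
    Module.rankAtStalk (R := A) (S.comap π) p =
      Module.rankAtStalk (R := A) (LinearMap.ker π) p + Module.rankAtStalk (R := A) S p := by
  let F : (LinearMap.ker π × S) →ₗ[A] S.comap π :=
    LinearMap.codRestrict _ ((LinearMap.ker π).subtype.coprod (σ ∘ₗ S.subtype)) fun x => by
      have : π x.1.1 = 0 := x.1.2
      simp [this, hσ]
  have hF : ∀ x, (F x : M) = x.1.1 + σ x.2.1 := fun x => rfl
  have hF' : ∀ x, π (F x) = x.2.1 := fun x => by
    have : π x.1.1 = 0 := x.1.2
    rw [hF, map_add, this, hσ, zero_add]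
  have hbij : Function.Bijective F := by
    constructor
    · rw [← LinearMap.ker_eq_bot, LinearMap.ker_eq_bot']
      intro x hx
      have h₂ : x.2.1 = 0 := by rw [← hF', hx]; exact map_zero π
      have h₁ := hF x
      rw [hx, h₂, map_zero, add_zero] at h₁
      exact Prod.ext (Subtype.ext h₁.symm) (Subtype.ext h₂)
    · intro y
      refine ⟨(⟨y - σ (π y), ?_⟩, ⟨π y, y.2⟩), Subtype.ext ?_⟩
      · rw [LinearMap.mem_ker, map_sub, hσ, sub_self]
      · rw [hF, sub_add_cancel]
  rw [← Module.rankAtStalk_eq_of_equiv (LinearEquiv.ofBijective F hbij), Module.rankAtStalk_prod]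
  rfl

/-- The quotients by a submodule and by its preimage agree. -/
def comapQuotEquiv (hπ : Function.Surjective π) (S : Submodule A P) : (M ⧸ S.comap π) ≃ₗ[A] P ⧸ S :=
  (Submodule.quotEquivOfEq _ _ (by rw [LinearMap.ker_comp, Submodule.ker_mkQ])).trans
    ((S.mkQ ∘ₗ π).quotKerEquivOfSurjective (S.mkQ_surjective.comp hπ))

variable [Module.Finite A M] [Module.Projective A M] [Module.Finite A P] [Module.Projective A P]
  {k : ℕ}

theorem IsSubbundle.comap (hπ : Function.Surjective π) (hk : IsSubbundle k (LinearMap.ker π))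
    {j : ℕ} {S : Submodule A P} (hS : IsSubbundle j S) : IsSubbundle (k + j) (S.comap π) := by
  obtain ⟨σ, hσ⟩ := Module.projective_lifting_property π LinearMap.id hπ
  obtain ⟨_, _⟩ := hk.finite_projective
  obtain ⟨_, _⟩ := hS.finite_projective
  have := hS.projective_quotient
  refine ⟨.of_equiv (comapQuotEquiv hπ S).symm, fun p => ?_⟩
  rw [rankAtStalk_comap σ (LinearMap.congr_fun hσ), hk.rank_eq, hS.rank_eq]

theorem IsSubbundle.of_comap (hπ : Function.Surjective π) (hk : IsSubbundle k (LinearMap.ker π))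
    {j : ℕ} {S : Submodule A P} (hS : IsSubbundle (k + j) (S.comap π)) : IsSubbundle j S := by
  obtain ⟨σ, hσ⟩ := Module.projective_lifting_property π LinearMap.id hπ
  obtain ⟨_, _⟩ := hk.finite_projective
  have := hS.projective_quotient
  have hq : Module.Projective A (P ⧸ S) := .of_equiv (comapQuotEquiv hπ S)
  obtain ⟨r, hr⟩ := exists_retraction S
  have : Module.Finite A S := Module.Finite.of_surjective r fun x => ⟨x, hr x⟩
  have : Module.Projective A S := Module.Projective.of_split S.subtype r (LinearMap.ext hr)
  refine ⟨hq, fun p => ?_⟩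
  have h := hS.rank_eq p
  rw [rankAtStalk_comap σ (LinearMap.congr_fun hσ), hk.rank_eq] at h
  exact Nat.add_left_cancel h

end comap

/-! ### The zero locus of a section of `𝒰₁^∨` -/

section zeroLocusU

variable {k m j : ℕ}

/-- The embedding of `Aᵐ` into `A^(m + 1)` given by a splitting. -/
def Splitting.incl (ψ : Splitting m) (A : CommAlgCat.{0} ℂ) : (Fin m → A) →ₗ[A] (Fin (m + 1) → A) :=
  (ψ.equiv A).symm.toLinearMap ∘ₗ LinearMap.inl A _ _

/-- The projection of `A^(m + 1)` to `Aᵐ` given by a splitting. -/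
def Splitting.fst (ψ : Splitting m) (A : CommAlgCat.{0} ℂ) : (Fin (m + 1) → A) →ₗ[A] (Fin m → A) :=
  LinearMap.fst A _ _ ∘ₗ (ψ.equiv A).toLinearMap

theorem Splitting.fst_incl (ψ : Splitting m) {A : CommAlgCat.{0} ℂ} (w : Fin m → A) :
    ψ.fst A (ψ.incl A w) = w := by
  simp [Splitting.fst, Splitting.incl]

theorem Splitting.incl_fst (ψ : Splitting m) {A : CommAlgCat.{0} ℂ} {v : Fin (m + 1) → A}
    (hv : (ψ.equiv A v).2 = 0) : ψ.incl A (ψ.fst A v) = v := by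
  change (ψ.equiv A).symm ((ψ.equiv A v).1, 0) = v
  rw [← hv, LinearEquiv.symm_apply_apply]

/-- The projection of `A^(m + 1)` to `Aᵐ / W × A` given by a splitting. -/
def Splitting.proj (ψ : Splitting m) {A : CommAlgCat.{0} ℂ} (W : Submodule A (Fin m → A)) :
    (Fin (m + 1) → A) →ₗ[A] ((Fin m → A) ⧸ W) × A :=
  W.mkQ.prodMap LinearMap.id ∘ₗ (ψ.equiv A).toLinearMap

theorem Splitting.proj_surjective (ψ : Splitting m) {A : CommAlgCat.{0} ℂ}
    (W : Submodule A (Fin m → A)) : Function.Surjective (ψ.proj W) :=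
  (Function.Surjective.prodMap W.mkQ_surjective Function.surjective_id).comp
    (ψ.equiv A).surjective

/-- With `W` the copy of `V₁` in the hyperplane, the kernel is `V₁`. So submodules of `Aᵐ / W × A`
correspond to submodules of `A^(m + 1)` containing `V₁`. -/
theorem Splitting.ker_proj (ψ : Splitting m) {A : CommAlgCat.{0} ℂ}
    (W : Submodule A (Fin m → A)) : LinearMap.ker (ψ.proj W) = W.map (ψ.incl A) := by
  ext v
  have : v ∈ LinearMap.ker (ψ.proj W) ↔ (ψ.equiv A v).1 ∈ W ∧ (ψ.equiv A v).2 = 0 := by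
    simp [Splitting.proj]
  rw [this]
  constructor
  · rintro ⟨h₁, h₂⟩
    exact ⟨_, h₁, ψ.incl_fst h₂⟩
  · rintro ⟨w, hw, rfl⟩
    exact ⟨by simpa [Splitting.incl] using hw, by simp [Splitting.incl]⟩

theorem Splitting.isSubbundle_map_incl (ψ : Splitting m) {A : CommAlgCat.{0} ℂ}
    {W : Submodule A (Fin m → A)} (hW : IsSubbundle k W) : IsSubbundle k (W.map (ψ.incl A)) :=
  hW.map _ (ψ.fst A) ψ.fst_incl

/-- The bundle `𝒬(-1) ⊕ 𝒪(-1)`. -/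
abbrev tautQTwist (k m : ℕ) : VectBundle (Gr k m) := ((tautQ k m).tensor (grO k m)).sum (grO k m)

/-- The fibre `⋀ᵏ W` of `𝒪(-1)` at `W`. -/
abbrev GrPoint.det {A : CommAlgCat.{0} ℂ} (w : (Gr k m).obj A) : Type :=
  ⋀[A]^k (GrPoint.submodule w)

theorem GrPoint.det_smul_comm {A : CommAlgCat.{0} ℂ} (w : (Gr k m).obj A)
    (ξ : Module.Dual A (GrPoint.det w)) (x y : GrPoint.det w) : ξ x • y = ξ y • x :=
  (isLine_grO k m).smul_comm (x := w) ξ x y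

theorem GrPoint.exists_det_sum_eq_one {A : CommAlgCat.{0} ℂ} (w : (Gr k m).obj A) :
    ∃ (r : ℕ) (x : Fin r → GrPoint.det w) (ξ : Fin r → Module.Dual A (GrPoint.det w)),
      ∑ i, ξ i (x i) = 1 :=
  (isLine_grO k m).exists_sum_eq_one w

/-- A subbundle of `𝒬(-1) ⊕ 𝒪(-1)` as a submodule. -/
abbrev GrPoint.submoduleQTwist {A : CommAlgCat.{0} ℂ} (p : GrPoint j (tautQTwist k m) A) :
    Submodule A (TensorProduct A ((Fin m → A) ⧸ GrPoint.submodule p.base) (GrPoint.det p.base) ×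
      GrPoint.det p.base) :=
  p.sub

/-- Twisting a submodule of `𝒬 ⊕ 𝒪` by `𝒪(-1)`. -/
abbrev twistSub {A : CommAlgCat.{0} ℂ} (w : (Gr k m).obj A)
    (S : Submodule A (((Fin m → A) ⧸ GrPoint.submodule w) × A)) :
    Submodule A (TensorProduct A ((Fin m → A) ⧸ GrPoint.submodule w) (GrPoint.det w) ×
      GrPoint.det w) :=
  Submodule.map₂ (twistMap (GrPoint.det w) _) S ⊤

/-- Twisting a submodule of `𝒬(-1) ⊕ 𝒪(-1)` by `𝒪(1)`. -/
abbrev untwistSub {A : CommAlgCat.{0} ℂ} (w : (Gr k m).obj A)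
    (L : Submodule A (TensorProduct A ((Fin m → A) ⧸ GrPoint.submodule w) (GrPoint.det w) ×
      GrPoint.det w)) : Submodule A (((Fin m → A) ⧸ GrPoint.submodule w) × A) :=
  Submodule.map₂ (untwistMap (GrPoint.det w) _) L ⊤

theorem untwistSub_twistSub {A : CommAlgCat.{0} ℂ} (w : (Gr k m).obj A)
    (S : Submodule A (((Fin m → A) ⧸ GrPoint.submodule w) × A)) :
    untwistSub w (twistSub w S) = S := by
  obtain ⟨r, x, ξ, h⟩ := GrPoint.exists_det_sum_eq_one w
  exact map₂_map₂_top (b := fun x ξ => ξ x) (untwistMap_twistMap _) x ξ h S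

theorem twistSub_untwistSub {A : CommAlgCat.{0} ℂ} (w : (Gr k m).obj A)
    (L : Submodule A (TensorProduct A ((Fin m → A) ⧸ GrPoint.submodule w) (GrPoint.det w) ×
      GrPoint.det w)) : twistSub w (untwistSub w L) = L := by
  obtain ⟨r, x, ξ, h⟩ := GrPoint.exists_det_sum_eq_one w
  exact map₂_map₂_top (b := fun ξ x => ξ x)
    (fun z ξ x => twistMap_untwistMap _ (GrPoint.det_smul_comm w) z x ξ) ξ x h L

theorem isSubbundle_twistSub {A : CommAlgCat.{0} ℂ} (w : (Gr k m).obj A)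
    {S : Submodule A (((Fin m → A) ⧸ GrPoint.submodule w) × A)} (hS : IsSubbundle j S) :
    IsSubbundle j (twistSub w S) := by
  obtain ⟨r, x, ξ, h⟩ := GrPoint.exists_det_sum_eq_one w
  exact hS.map₂_top (b := fun x ξ => ξ x) (untwistMap_twistMap _)
    (fun z x ξ => twistMap_untwistMap _ (GrPoint.det_smul_comm w) z x ξ) x ξ h

theorem isSubbundle_untwistSub {A : CommAlgCat.{0} ℂ} (w : (Gr k m).obj A)
    {L : Submodule A (TensorProduct A ((Fin m → A) ⧸ GrPoint.submodule w) (GrPoint.det w) ×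
      GrPoint.det w)} (hL : IsSubbundle j L) : IsSubbundle j (untwistSub w L) := by
  obtain ⟨r, x, ξ, h⟩ := GrPoint.exists_det_sum_eq_one w
  exact hL.map₂_top (b := fun ξ x => ξ x)
    (fun z ξ x => twistMap_untwistMap _ (GrPoint.det_smul_comm w) z x ξ)
    (fun q ξ x => untwistMap_twistMap _ q x ξ) ξ x h

/-- The base change map between the fibres of `𝒬 ⊕ 𝒪`. -/
abbrev mapQSum {A B : CommAlgCat.{0} ℂ} (f : A ⟶ B) {w : (Gr k m).obj A} {w' : (Gr k m).obj B}
    (h : (Gr k m).map f w = w') : (((Fin m → A) ⧸ GrPoint.submodule w) × A) →ₛₗ[f.hom.toRingHom]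
      (((Fin m → B) ⧸ GrPoint.submodule w') × B) :=
  ((tautQ k m).sum (VectBundle.structureSheaf _)).tr f h

/-- The base change map between the fibres of `𝒪(-1)`. -/
abbrev mapDet {A B : CommAlgCat.{0} ℂ} (f : A ⟶ B) {w : (Gr k m).obj A} {w' : (Gr k m).obj B}
    (h : (Gr k m).map f w = w') : GrPoint.det w →ₛₗ[f.hom.toRingHom] GrPoint.det w' :=
  (grO k m).tr f h

/-- The base change map between the fibres of `𝒬(-1) ⊕ 𝒪(-1)`. -/
abbrev mapQTwist {A B : CommAlgCat.{0} ℂ} (f : A ⟶ B) {w : (Gr k m).obj A} {w' : (Gr k m).obj B}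
    (h : (Gr k m).map f w = w') :
    (TensorProduct A ((Fin m → A) ⧸ GrPoint.submodule w) (GrPoint.det w) × GrPoint.det w)
      →ₛₗ[f.hom.toRingHom]
      (TensorProduct B ((Fin m → B) ⧸ GrPoint.submodule w') (GrPoint.det w') × GrPoint.det w') :=
  (tautQTwist k m).tr f h

theorem mapQTwist_twistMap {A B : CommAlgCat.{0} ℂ} (f : A ⟶ B) {w : (Gr k m).obj A}
    {w' : (Gr k m).obj B} (h : (Gr k m).map f w = w')
    (q : ((Fin m → A) ⧸ GrPoint.submodule w) × A) (y : GrPoint.det w) :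
    mapQTwist f h (twistMap _ _ q y) = twistMap _ _ (mapQSum f h q) (mapDet f h y) :=
  Prod.ext rfl (LinearMap.map_smulₛₗ (mapDet f h) q.2 y)

theorem extendSub_twistSub {A B : CommAlgCat.{0} ℂ} (f : A ⟶ B) {w : (Gr k m).obj A}
    {w' : (Gr k m).obj B} (h : (Gr k m).map f w = w')
    (S : Submodule A (((Fin m → A) ⧸ GrPoint.submodule w) × A)) :
    extendSub (mapQTwist f h) (twistSub w S) = twistSub w' (extendSub (mapQSum f h) S) := by
  have htop : extendSub (mapDet f h) ⊤ = ⊤ := ((grO k m).isExtension f h).extendSub_top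
  rw [twistSub, extendSub_map₂ (mapQTwist_twistMap f h), htop]

/-- The point of a Grassmannian given by a subbundle of `Aᵐ`. -/
def grMk {A : CommAlgCat.{0} ℂ} {W : Submodule A (Fin m → A)} (hW : IsSubbundle k W) :
    (Gr k m).obj A :=
  GrPoint.mk (E := VectBundle.trivial pt m) (A := A) PUnit.unit W hW

/-- The first subspace of a flag lies in the hyperplane given by a splitting. -/
def Splitting.Contains (ψ : Splitting m) {A : CommAlgCat.{0} ℂ}
    (x : (Fl k (k + j) (m + 1)).obj A) : Prop :=
  ∀ v ∈ flSub₁ x, (ψ.equiv A v).2 = 0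

variable {ψ : Splitting m} {A : CommAlgCat.{0} ℂ} {x : (Fl k (k + j) (m + 1)).obj A}

theorem Splitting.Contains.map_incl_map_fst (hx : ψ.Contains x) :
    ((flSub₁ x).map (ψ.fst A)).map (ψ.incl A) = flSub₁ x := by
  ext v
  constructor
  · rintro ⟨_, ⟨v, hv, rfl⟩, rfl⟩
    rwa [ψ.incl_fst (hx v hv)]
  · intro hv
    exact ⟨_, ⟨v, hv, rfl⟩, ψ.incl_fst (hx v hv)⟩

theorem Splitting.incl_injective (ψ : Splitting m) (A : CommAlgCat.{0} ℂ) :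
    Function.Injective (ψ.incl A) :=
  Function.LeftInverse.injective ψ.fst_incl

theorem Splitting.Contains.isSubbundle (hx : ψ.Contains x) :
    IsSubbundle k ((flSub₁ x).map (ψ.fst A)) :=
  IsSubbundle.of_map (ψ.incl_injective A) (by
    rw [hx.map_incl_map_fst]
    exact x.1.1.isSubbundle)

/-- The first subspace of a flag as a subspace of the hyperplane. -/
def Splitting.Contains.base (hx : ψ.Contains x) : (Gr k m).obj A :=
  grMk hx.isSubbundle

theorem Splitting.Contains.ker_proj (hx : ψ.Contains x) :
    LinearMap.ker (ψ.proj (GrPoint.submodule hx.base)) = flSub₁ x :=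
  (ψ.ker_proj _).trans hx.map_incl_map_fst

theorem Splitting.Contains.comap_map_proj (hx : ψ.Contains x) :
    ((flSub₂ x).map (ψ.proj (GrPoint.submodule hx.base))).comap
      (ψ.proj (GrPoint.submodule hx.base)) = flSub₂ x := by
  rw [Submodule.comap_map_eq, hx.ker_proj]
  exact sup_eq_left.2 x.2

/-- The subbundle `V₂ / V₁ ⊗ det V₁` of `𝒬(-1) ⊕ 𝒪(-1)` for a flag `V₁ ⊆ V₂` with `V₁` in the
hyperplane. -/
def Splitting.Contains.toGr (hx : ψ.Contains x) : GrPoint j (tautQTwist k m) A :=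
  GrPoint.mk (E := tautQTwist k m) hx.base
    (twistSub hx.base ((flSub₂ x).map (ψ.proj (GrPoint.submodule hx.base))))
    (isSubbundle_twistSub hx.base (by
      have := hx.base.isSubbundle.projective_quotient
      have : Module.Projective A ((Fin m → A) ⧸ GrPoint.submodule hx.base) := this
      refine IsSubbundle.of_comap (ψ.proj_surjective _) (k := k) ?_ ?_
      · rw [hx.ker_proj]
        exact x.1.1.isSubbundle
      · rw [hx.comap_map_proj]
        exact x.1.2.isSubbundle))

/-- The right side is the explicit inverse construction: `V₁` is the included base point and `V₂`
the preimage of the untwisted subbundle. Both injectivity and surjectivity of `toGr` are read off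
from it. -/
theorem Splitting.Contains.toGr_eq_iff (hx : ψ.Contains x) (p : GrPoint j (tautQTwist k m) A) :
    hx.toGr = p ↔ flSub₁ x = (GrPoint.submodule p.base).map (ψ.incl A) ∧
      flSub₂ x = (untwistSub p.base p.submoduleQTwist).comap
        (ψ.proj (GrPoint.submodule p.base)) := by
  constructor
  · rintro rfl
    refine ⟨hx.map_incl_map_fst.symm, hx.comap_map_proj.symm.trans ?_⟩
    exact congrArg (Submodule.comap (ψ.proj (GrPoint.submodule hx.base)))
      (untwistSub_twistSub hx.base _).symm
  · rintro ⟨h₁, h₂⟩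
    obtain ⟨w, L, hL⟩ := p
    have hw : hx.base = w := by
      refine GrPoint.trivial_ext (Submodule.map_injective_of_injective (ψ.incl_injective A) ?_)
      exact hx.map_incl_map_fst.trans h₁
    subst hw
    have : twistSub hx.base ((flSub₂ x).map (ψ.proj (GrPoint.submodule hx.base))) = L := by
      rw [h₂, Submodule.map_comap_eq_of_surjective (ψ.proj_surjective _)]
      exact twistSub_untwistSub hx.base L
    subst this
    rfl

theorem Splitting.Contains.exists_toGr_eq (ψ : Splitting m) (p : GrPoint j (tautQTwist k m) A) :
    ∃ (x : (Fl k (k + j) (m + 1)).obj A) (hx : ψ.Contains x), hx.toGr = p := by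
  have hk : IsSubbundle k (GrPoint.submodule p.base) := p.base.isSubbundle
  have hq : Module.Projective A ((Fin m → A) ⧸ GrPoint.submodule p.base) := hk.projective_quotient
  have h₁ := ψ.isSubbundle_map_incl hk
  have h₂ := IsSubbundle.comap (ψ.proj_surjective (GrPoint.submodule p.base))
    (by rwa [ψ.ker_proj]) (isSubbundle_untwistSub p.base p.isSubbundle)
  have h : (GrPoint.submodule p.base).map (ψ.incl A) ≤
      (untwistSub p.base p.submoduleQTwist).comap (ψ.proj (GrPoint.submodule p.base)) := by
    rw [← ψ.ker_proj]
    exact LinearMap.ker_le_comap _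
  have hx : ψ.Contains (flMk h₁ h₂ h) := by
    rintro _ ⟨w, -, rfl⟩
    simp [Splitting.incl]
  exact ⟨flMk h₁ h₂ h, hx, (hx.toGr_eq_iff p).2 ⟨rfl, rfl⟩⟩

theorem Splitting.Contains.toGr_map (hx : ψ.Contains x) {B : CommAlgCat.{0} ℂ} (f : A ⟶ B)
    (hy : ψ.Contains ((Fl k (k + j) (m + 1)).map f x)) : hx.toGr.map f = hy.toGr := by
  have hb : (Gr k m).map f hx.base = hy.base := GrPoint.trivial_ext
    (extendSub_map (g := mapVec f (m + 1)) (g' := mapVec f m) (α := ψ.fst A) (β := ψ.fst B)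
      (fun v => (congrArg Prod.fst (ψ.natural f v)).symm) (flSub₁ x))
  refine GrPoint.map_eq f hx.toGr hy.toGr hb ?_
  refine (extendSub_twistSub f hb _).trans (congrArg (twistSub hy.base) ?_)
  exact extendSub_map (g := mapVec f (m + 1)) (α := ψ.proj (GrPoint.submodule hx.base))
    (β := ψ.proj (GrPoint.submodule hy.base))
    (fun v => by
      refine Prod.ext (congrArg (Submodule.Quotient.mk (p := GrPoint.submodule hy.base)) ?_) ?_
      · exact (congrArg Prod.fst (ψ.natural f v)).symm
      · exact (congrArg Prod.snd (ψ.natural f v)).symm) (flSub₂ x)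

theorem mem_zeroLocus_secU {l : Fin (m + 1) → ℂ} (hl : l 0 ≠ 0) :
    x ∈ (VectBundle.zeroLocus (secU k (k + j) (m + 1) l)).obj A ↔
      (formSplitting l hl).Contains x := by
  constructor
  · intro h v hv
    exact LinearMap.congr_fun (f := (linForm l A).comp (flSub₁ x).subtype) (g := 0) h ⟨v, hv⟩
  · intro h
    exact LinearMap.ext (f := (linForm l A).comp (flSub₁ x).subtype) (g := 0) fun v => h v.1 v.2

theorem nonempty_zeroLocus_secU_iso (k j : ℕ) {m : ℕ} (l : Fin (m + 1) → ℂ) (hl : l 0 ≠ 0) :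
    Nonempty ((VectBundle.zeroLocus (secU k (k + j) (m + 1) l)).toFunctor ≅
      grassmannBundle j (tautQTwist k m)) := by
  let G : (VectBundle.zeroLocus (secU k (k + j) (m + 1) l)).toFunctor ⟶
      grassmannBundle j (tautQTwist k m) :=
    { app A := ↾fun x => ((mem_zeroLocus_secU hl).1 x.2).toGr
      naturality A B f := by
        ext x
        exact (((mem_zeroLocus_secU hl).1 x.2).toGr_map f _).symm }
  have : IsIso G := by
    rw [NatTrans.isIso_iff_isIso_app]
    intro A
    rw [isIso_iff_bijective]
    constructor
    · rintro ⟨x, hx⟩ ⟨y, hy⟩ h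
      have h₁ := (((mem_zeroLocus_secU hl).1 hx).toGr_eq_iff _).1 h
      have h₂ := (((mem_zeroLocus_secU hl).1 hy).toGr_eq_iff _).1 rfl
      exact Subtype.ext (Fl.ext (h₁.1.trans h₂.1.symm) (h₁.2.trans h₂.2.symm))
    · intro p
      obtain ⟨x, hx, rfl⟩ := Splitting.Contains.exists_toGr_eq (formSplitting l hl) p
      exact ⟨⟨x, (mem_zeroLocus_secU hl).2 hx⟩, rfl⟩
  exact ⟨asIso G⟩

end zeroLocusU

end

theorem lemma2p5 (k₁ k₂ n : ℕ) (hk₁ : 0 < k₁) (hk : k₁ < k₂) (hk₂ : k₂ < n) :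
    HoldsForGeneral (fun s : (flQ₂ k₁ k₂ n).globalSections =>
      Nonempty ((VectBundle.zeroLocus s).toFunctor ≅
        grassmannBundle k₁
          ((tautU (k₂ - 1) (n - 1)).sum (VectBundle.structureSheaf (Gr (k₂ - 1) (n - 1)))))) ∧
    HoldsForGeneral (fun s : (flU₁ k₁ k₂ n).dual.globalSections =>
      Nonempty ((VectBundle.zeroLocus s).toFunctor ≅
        grassmannBundle (k₂ - k₁)
          (((tautQ k₁ (n - 1)).tensor (grO k₁ (n - 1))).sum (grO k₁ (n - 1))))) := by
  -- Writing `n = m + 1`, then `k₂ = l + 1` or `k₂ = k₁ + j`, removes the truncated subtractions.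
  -- Genericity is the nonvanishing of the coordinate `0`.
  obtain ⟨m, rfl⟩ : ∃ m, n = m + 1 := ⟨n - 1, by omega⟩
  constructor
  · obtain ⟨l, rfl⟩ : ∃ l, k₂ = l + 1 := ⟨k₂ - 1, by omega⟩
    exact HoldsForGeneral.of_linearEquiv
      (LinearEquiv.ofBijective _ (secQ_bijective hk.le hk₂ (by omega))) 0
      nonempty_zeroLocus_secQ_iso
  · obtain ⟨j, rfl⟩ : ∃ j, k₂ = k₁ + j := ⟨k₂ - k₁, by omega⟩
    rw [Nat.add_sub_cancel_left]
    exact HoldsForGeneral.of_linearEquiv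
      (LinearEquiv.ofBijective _ (secU_bijective hk.le hk₂.le hk₁ (by omega))) 0
      (nonempty_zeroLocus_secU_iso k₁ j)
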